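/- Let $q\ge 4$ be a prime power, let $m\ge 2$ and let $T=\mathrm{PSL}(2,q)$. Let $H=T\wr S_m=T^m\rtimes S_m$, let $L=\{(x,\dots,x)\sigma : x\in T,\ \sigma\in S_m\}\le H$, and let $\varphi:L\to\mathrm{Aut}(T)$ send $(x,\dots,x)\sigma$ to the automorphism $i_x: t\mapsto x^{-1}tx$ (automorphisms act on the right). Put $$N=\{f: H\to T \;:\; f(z\ell)=f(z)^{\varphi(\ell)}\ \text{for all } z\in H,\ \ell\in L\},$$ a group under pointwise multiplication, on which $H$ acts by $f^x(z)=f(xz)$. Let $G(m,q)=N\rtimes H$ be the twisted wreath product, acting on the set $N$ by $\alpha^{nh}=(\alpha n)^h$ for $\alpha,n\in N$, $h\in H$. A subdegree of $G(m,q)$ is the size of an orbit of a point stabiliser $G(m,q)_\alpha$ on $N$; the set of subdegrees does not depend on $\alpha$. Then the following numbers are subdegrees of $G(m,q)$ (for all $m\ge 2$ and $q\geq 4$ that satisfy the stated conditions): 1. $(q+1)^m$, if $m\ge 3$, or if $m=2$ and $q\equiv 1\pmod 4$; 2. $\left(\tfrac12 q(q+1)\right)^m$, if $q\equiv 1\pmod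 4$; and $\left(\tfrac12 q(q-1)\right)^m$, if $q\equiv 3\pmod 4$; 3. $\left(\tfrac12 q(q-1)\right)^m$, if $q$ is even; 4. $(q(q-1))^m$, if $q$ is odd; $(q(q+1))^m$, if $q$ is odd and $q\ge 7$; and both $(q(q-1))^m$ and $(q(q+1))^m$, if $q$ is even; 5. $\left(\dfrac{q^2-1}{\gcd(2,q-1)}\right)^m$, for all $q$; 6. $\left(\dfrac{|T|}{24}\right)^m$, if $q$ is prime and $q\equiv\pm1\pmod 8$; 7. $\left(\dfrac{|T|}{60}\right)^m$, if $q\equiv\pm1\pmod{10}$ and either $q$ is prime or $q=p^2$ for a prime $p\equiv\pm3\pmod{10}$, except when $q=9$ and $m\in\{2,4,5\}$. -/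

import Mathlib

open scoped MatrixGroups

section Subdegrees

/-- The set of subdegrees of a group `G` acting on `Ω`, relative to the point `α`: the sizes of
the orbits of the point stabiliser of `α`. -/
def subdegrees (G : Type*) {Ω : Type*} [Group G] [MulAction G Ω] (α : Ω) : Set ℕ :=
  {d | ∃ β : Ω, Nat.card (MulAction.orbit (MulAction.stabilizer G α) β) = d}

end Subdegrees

section TwistedWreath

variable {T H : Type*} [Group T] [Group H] {L : Subgroup H}

/-- The group `N` of all functions `f : H → T` with `f (z ℓ) = f(z)^{φ(ℓ)}` for all `z ∈ H` and
`ℓ ∈ L`. Automorphisms written as exponents act on the right; in terms of the left action of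
`MulAut T` used by Mathlib, `t ^ a` is `a⁻¹ t`. -/
def twistedBase (φ : L →* MulAut T) : Subgroup (H → T) where
  carrier := {f | ∀ (z : H) (l : L), f (z * l) = (φ l)⁻¹ (f z)}
  one_mem' := by intro z l; simp
  mul_mem' := by
    intro f g hf hg z l
    simp only [Set.mem_ofPred_eq] at hf hg
    simp [hf z l, hg z l]
  inv_mem' := by
    intro f hf z l
    simp only [Set.mem_ofPred_eq] at hf
    simp [hf z l]

/-- The action of `H` on `N` by automorphisms. The right action `f ^ x (z) = f (x z)`
becomes the left action `x • f = f ^ (x⁻¹)`. -/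
def twistedAct (φ : L →* MulAut T) : H →* MulAut (twistedBase φ) where
  toFun x :=
    { toFun := fun f => ⟨fun z => f.1 (x⁻¹ * z), fun z l => by
        change f.1 (_ * (z * l)) = _
        rw [← mul_assoc]
        exact f.2 _ l⟩
      invFun := fun f => ⟨fun z => f.1 (x * z), fun z l => by
        change f.1 (_ * (z * l)) = _
        rw [← mul_assoc]
        exact f.2 _ l⟩
      left_inv := fun f => by ext z; simp
      right_inv := fun f => by ext z; simp
      map_mul' := fun f g => by ext z; simp }
  map_one' := by ext f z; simp
  map_mul' x y := by ext f z; simp [mul_assoc]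

/-- The twisted wreath product `N ⋊ H` determined from `(T, H, φ)`. -/
abbrev TwistedWreath (φ : L →* MulAut T) : Type _ := twistedBase φ ⋊[twistedAct φ] H

/-- The twisted wreath product acts on the set `N`, the subgroup `N` by right multiplication and
`H` by automorphisms. The right action `α ^ (n h) = (α n) ^ h` is turned into the left action
`g • α = α ^ (g⁻¹)`, so that `(n h) • α = α ^ (h⁻¹ n⁻¹) = (h • α) n⁻¹`. -/
instance twistedWreathAction (φ : L →* MulAut T) :
    MulAction (TwistedWreath φ) (twistedBase φ) where
  smul g α := twistedAct φ g.right α * g.left⁻¹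
  one_smul α := by
    change twistedAct φ (1 : TwistedWreath φ).right α * (1 : TwistedWreath φ).left⁻¹ = α
    simp
  mul_smul g h α := by
    change twistedAct φ (g * h).right α * (g * h).left⁻¹ =
      twistedAct φ g.right (twistedAct φ h.right α * h.left⁻¹) * g.left⁻¹
    simp [mul_assoc]

end TwistedWreath

section Diagonal

/-- The wreath product `T wr S_m = T ^ m ⋊ S_m`, with `S_m` permuting the coordinates; the
pair `⟨(t₁, …, t_m), σ⟩` is the element `(t₁, …, t_m) σ`. -/
abbrev WreathSym (m : ℕ) (T : Type*) [Group T] : Type _ :=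
  (Fin m → T) ⋊[(mulAutArrow : Equiv.Perm (Fin m) →* MulAut (Fin m → T))] Equiv.Perm (Fin m)

/-- The subgroup `L = {(x, …, x) σ | x ∈ T, σ ∈ S_m}` of `T wr S_m`. -/
def diagSubgroup (m : ℕ) (T : Type*) [Group T] : Subgroup (WreathSym m T) where
  carrier := {h | ∃ x : T, ∀ i, h.left i = x}
  one_mem' := ⟨1, fun i => by simp⟩
  mul_mem' := by
    rintro g h ⟨x, hx⟩ ⟨y, hy⟩
    refine ⟨x * y, fun i => ?_⟩
    change g.left i * h.left (g.right⁻¹ • i) = x * y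
    rw [hx, hy]
  inv_mem' := by
    rintro g ⟨x, hx⟩
    refine ⟨x⁻¹, fun i => ?_⟩
    change (g.left ((g.right⁻¹)⁻¹ • i))⁻¹ = x⁻¹
    rw [hx]

/-- The homomorphism `φ : L → Aut(T)` that sends `(x, …, x) σ` to conjugation by `x`. (The
automorphism `t ↦ x⁻¹ t x` acting on the right is `(MulAut.conj x)⁻¹` acting on the left.) -/
def diagHom (m : ℕ) [NeZero m] (T : Type*) [Group T] : diagSubgroup m T →* MulAut T where
  toFun l := MulAut.conj (l.1.left 0)
  map_one' := by simp
  map_mul' := by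
    rintro ⟨g, x, hx⟩ ⟨h, y, hy⟩
    change MulAut.conj (g.left 0 * h.left (g.right⁻¹ • 0)) = _
    simp only [hx, hy, map_mul]

/-- The set `N` on which `G(m, T)` acts. -/
abbrev GPoints (m : ℕ) [NeZero m] (T : Type*) [Group T] : Type _ := twistedBase (diagHom m T)

/-- The twisted wreath group `G(m, T)`, determined from `(T, T wr S_m, φ)`. -/
abbrev GTW (m : ℕ) [NeZero m] (T : Type*) [Group T] : Type _ := TwistedWreath (diagHom m T)

end Diagonal

/-!
# Subdegrees of the twisted wreath products `G(m, q)`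

The base group `N` acts regularly on itself and `H = T wr S_m` is the stabiliser of the trivial
function, so the subdegrees are the sizes of the orbits of `H` on `N`
(`mem_subdegrees_of_card_range`). Elements of `N` come from functions `Φ : Ω ^ m → T` that are
equivariant, `Φ (x • w) = x Φ(w) x⁻¹`, for an action of `T` on a set `Ω`. If `Φ` is symmetric in its
arguments, and its stabiliser in `T ^ m` is `A ^ m` for the stabiliser `A` of a point, then the
stabiliser in `H` is `A wr S_m`, and the orbit has size `|T : A| ^ m`
(`card_orbit_pow_mem_subdegrees`). It remains to find such functions for suitable subgroups `A`.

*Centralisers.* If `Ω` is the conjugacy class of `a ≠ 1`, let `Φ (t, …, t) = t`, and let `Φ` be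
trivial at the other tuples; then `A` is the centraliser of `a`
(`card_conjClass_pow_mem_subdegrees`). The classes of involutions and of nontrivial elements of tori
are counted through the trace: the elements of `SL(2, q)` of a given trace `τ` with `τ ^ 2 ≠ 4` form
one class (`isConj_iff_tr_eq`). The class of a transvection corresponds to the nonzero vectors up to
sign.

*Self-normalising subgroups.* Let `Φ` be supported on the translates of one tuple `b` of points, up
to order (`card_pow_mem_subdegrees_of_pattern`). For `b = (x₀ A, A, …, A)` and `Φ(b) = z` the
condition is that `A ∩ x₀ A x₀⁻¹ = C_A(z)`, and, if `m = 2`, that `x₀` is an involution commuting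
with `z` (`index_pow_mem_subdegrees`). This covers
* a Borel subgroup, with a torus as two-point stabiliser (`card_add_one_pow_mem_subdegrees`);
* the normaliser of a nonsplit torus for even `q` (`torusNormalizer_index_pow_mem_subdegrees`);
* the octahedral group `Sym(4)` (`UnitQuat.octahedral_index_pow_mem_subdegrees`);
* the icosahedral group `Alt(5)` for `q > 9` (`UnitQuat.icosahedral_index_pow_mem_subdegrees`).

The last two groups are the rotation groups of an octahedron and of an icosahedron, over `F`. They
are studied in the group of unit quaternions over `F`, which for odd `q` is a double cover of
`PSL(2, q)`. In the icosahedral case `x₀` is a half turn that commutes with a half turn `i ∈ A`.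
When it is in general position, the intersection `A ∩ x₀ A x₀⁻¹` is a group in which `i` generates
its own centraliser. By Burnside's transfer theorem it is of order two or dihedral of twice odd
order, and `x₀` or `x₀ i` centralises it (`exists_conj_mem_iff_commute`).

*The field of nine elements.* Here `Alt(5)` has index six, and general position is not available. If
`m = 3`, the functions that depend on one coordinate only have an orbit of size `3 * 72 = 6 ^ 3`
(`mul_card_conjClass_mem_subdegrees`). If `m ≥ 6`, take `b = (R, Q, Q, P, …, P)` for the fixed
points `P`, `Q`, `R` of an element `z` of order three of `Alt(6)`. Their multiplicities distinguish
these points, and the elements of `Alt(6)` that fix all three of them commute with `z`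
(`six_pow_mem_subdegrees`).
-/

/-! ### Subdegrees of twisted wreath products -/

section OrbitsOfTop

variable {T H : Type*} [Group T] [Group H] {L : Subgroup H}

/-- The stabiliser of the trivial function is the top group `H`, and the base group is regular, so
the subdegrees of a twisted wreath product are the sizes of the orbits of `H` on the base group. -/
theorem mem_subdegrees_of_card_range (φ : L →* MulAut T) (α f : twistedBase φ) :
    Nat.card (Set.range fun h : H => twistedAct φ h f) ∈ subdegrees (TwistedWreath φ) α := by
  let g : TwistedWreath φ := ⟨α⁻¹, 1⟩
  have smul_def : ∀ (k : TwistedWreath φ) (β : twistedBase φ),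
      k • β = twistedAct φ k.right β * k.left⁻¹ := fun _ _ => rfl
  have hg : ∀ β, g • β = β * α := fun β => by simp [smul_def, g]
  refine ⟨g • f, ?_⟩
  have key : MulAction.orbit (MulAction.stabilizer (TwistedWreath φ) α) (g • f) =
      (g • ·) '' (Set.range fun h : H => twistedAct φ h f) := by
    ext β
    constructor
    · rintro ⟨⟨k, hk⟩, rfl⟩
      have hk' : twistedAct φ k.right α * k.left⁻¹ = α := hk
      refine ⟨twistedAct φ k.right f, ⟨k.right, rfl⟩, ?_⟩
      change g • _ = k • g • f
      rw [hg, hg, smul_def, map_mul, mul_assoc, hk']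
    · rintro ⟨_, ⟨h, rfl⟩, rfl⟩
      refine ⟨⟨⟨α⁻¹ * twistedAct φ h α, h⟩, ?_⟩, ?_⟩
      · rw [MulAction.mem_stabilizer_iff, smul_def]; simp
      · change (⟨α⁻¹ * twistedAct φ h α, h⟩ : TwistedWreath φ) • g • f = g • twistedAct φ h f
        rw [hg, hg, smul_def]; simp
  rw [key]
  exact Nat.card_image_of_injective (MulAction.injective g) _

end OrbitsOfTop

/-! ### Equivariant functions and conjugacy classes -/

section DiagonalOrbits

theorem left_inv_mul_apply {m : ℕ} {T : Type*} [Group T] (h z : WreathSym m T) (i : Fin m) :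
    (h⁻¹ * z).left i = (h.left (h.right i))⁻¹ * z.left (h.right i) := by
  simp only [SemidirectProduct.mul_left, SemidirectProduct.inv_left, SemidirectProduct.inv_right]
  change (h.left (((h.right⁻¹)⁻¹) i))⁻¹ * z.left (((h.right⁻¹)⁻¹) i) = _
  rw [inv_inv]

variable {m : ℕ} [NeZero m] {T : Type*} [Group T]

theorem twistedAct_apply (h : WreathSym m T) (f : GPoints m T) (z : WreathSym m T) :
    (twistedAct (diagHom m T) h f).1 z = f.1 (h⁻¹ * z) := rfl

/-- A `T`-equivariant function `Φ` of `m`-tuples of points of a `T`-set gives an element of the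
base group: at `z = (z₁, …, zₘ) σ` its value is `Φ (z₁⁻¹ • ω₁, …, zₘ⁻¹ • ωₘ)`, for a fixed tuple
`ω`. -/
def pointOfEquivariant {Ω : Type*} [MulAction T Ω] (ω : Fin m → Ω) (Φ : (Fin m → Ω) → T)
    (hΦ : ∀ (x : T) (w : Fin m → Ω), Φ (x • w) = x * Φ w * x⁻¹) : GPoints m T :=
  ⟨fun z => Φ fun i => (z.left i)⁻¹ • ω i, fun z l => by
    obtain ⟨x, hx⟩ := l.2
    have h1 : (fun i => ((z * l.1).left i)⁻¹ • ω i) = x⁻¹ • fun i => (z.left i)⁻¹ • ω i := by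
      funext i
      change (z.left i * l.1.left (z.right⁻¹ • i))⁻¹ • ω i = x⁻¹ • (z.left i)⁻¹ • ω i
      rw [hx, mul_inv_rev, mul_smul]
    change Φ _ = (MulAut.conj (l.1.left 0))⁻¹ _
    rw [h1, hΦ, hx]
    simp [MulAut.inv_def]⟩

/-- If a symmetric equivariant function `Φ` of `m`-tuples has stabiliser `A ^ m` in `T ^ m`, where
`A` is the stabiliser of `ω`, then its stabiliser in `H` is `A wr S_m`, of index
`|ω ^ T| ^ m`. -/
theorem card_orbit_pow_mem_subdegrees {Ω : Type*} [MulAction T Ω] (ω : Ω) (Φ : (Fin m → Ω) → T)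
    (hΦ : ∀ (x : T) (w : Fin m → Ω), Φ (x • w) = x * Φ w * x⁻¹)
    (hsymm : ∀ (σ : Equiv.Perm (Fin m)) (w : Fin m → Ω), Φ (w ∘ σ) = Φ w)
    (hstab : ∀ x : Fin m → T, (∀ g : Fin m → T, Φ (fun i => g i • x i • ω) =
      Φ (fun i => g i • ω)) → ∀ i, x i • ω = ω) (α : GPoints m T) :
    Nat.card (MulAction.orbit T ω) ^ m ∈ subdegrees (GTW m T) α := by
  let f : (Fin m → MulAction.orbit T ω) → GPoints m T :=
    fun w => pointOfEquivariant (fun i => (w i : Ω)) Φ hΦ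
  have hinj : Function.Injective f := by
    intro w w' hww
    have h1 : ∀ i, ∃ x : T, x • ω = w i := fun i => (w i).2
    have h2 : ∀ i, ∃ x : T, x • ω = w' i := fun i => (w' i).2
    choose x hx using h1
    choose y hy using h2
    have h3 := hstab (fun i => (y i)⁻¹ * x i) fun g => by
      have h4 := congrArg (fun f : GPoints m T => f.1 ⟨fun i => (g i * (y i)⁻¹)⁻¹, 1⟩) hww
      simp only [f, pointOfEquivariant, inv_inv, ← hx, ← hy] at h4
      simpa only [mul_smul, inv_smul_smul] using h4
    funext i
    have h5 := h3 i
    rw [mul_smul, inv_smul_eq_iff, hx, hy] at h5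
    exact Subtype.ext h5
  have hrange : (Set.range fun h : WreathSym m T => twistedAct (diagHom m T) h
      (f fun _ => ⟨ω, MulAction.mem_orbit_self ω⟩)) = Set.range f := by
    have hact : ∀ h : WreathSym m T, twistedAct (diagHom m T) h
        (f fun _ => ⟨ω, MulAction.mem_orbit_self ω⟩) =
        f fun i => ⟨h.left i • ω, MulAction.mem_orbit _ _⟩ := by
      intro h
      refine Subtype.ext (funext fun z => ?_)
      rw [twistedAct_apply]
      change Φ (fun i => ((h⁻¹ * z).left i)⁻¹ • ω) = Φ fun i => (z.left i)⁻¹ • h.left i • ω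
      rw [← hsymm h.right fun i => (z.left i)⁻¹ • h.left i • ω]
      congr 1
      funext i
      rw [left_inv_mul_apply]
      simp [mul_smul]
    ext β
    constructor
    · rintro ⟨h, rfl⟩
      exact ⟨_, (hact h).symm⟩
    · rintro ⟨w, rfl⟩
      have h1 : ∀ i, ∃ x : T, x • ω = w i := fun i => (w i).2
      choose x hx using h1
      refine ⟨⟨x, 1⟩, (hact _).trans (congrArg f (funext fun i => Subtype.ext (hx i)))⟩
  have h := mem_subdegrees_of_card_range (diagHom m T) α (f fun _ => ⟨ω, MulAction.mem_orbit_self ω⟩)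
  rw [hrange, Nat.card_range_of_injective hinj, Nat.card_fun, Nat.card_fin] at h
  exact h

/-- The elements of a group, regarded as points on which the group acts by conjugation. -/
@[ext]
structure ConjPoint (T : Type*) where
  /-- The element itself. -/
  val : T

instance : MulAction T (ConjPoint T) where
  smul x t := ⟨x * t.val * x⁻¹⟩
  one_smul t := by ext; change 1 * t.val * 1⁻¹ = t.val; simp
  mul_smul x y t := by
    ext
    change x * y * t.val * (x * y)⁻¹ = x * (y * t.val * y⁻¹) * x⁻¹
    simp [mul_assoc]

open Classical in
/-- The `m`-th powers of the sizes of nontrivial conjugacy classes are subdegrees: the function of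
`m`-tuples from the class of `a` that is `t` at `(t, …, t)` and trivial elsewhere has stabiliser
`C(a) wr S_m`. -/
theorem card_conjClass_pow_mem_subdegrees (a : T) (ha : a ≠ 1) (α : GPoints m T) :
    Nat.card {b // IsConj a b} ^ m ∈ subdegrees (GTW m T) α := by
  let Φ : (Fin m → ConjPoint T) → T := fun w => if ∀ i, w i = w 0 then (w 0).val else 1
  have h := card_orbit_pow_mem_subdegrees (m := m) (T := T) (ConjPoint.mk a) Φ
    (fun x w => by
      have h1 : (∀ i, (x • w) i = (x • w) 0) ↔ ∀ i, w i = w 0 :=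
        forall_congr' fun i => (MulAction.injective x).eq_iff
      simp only [Φ, h1]
      split_ifs
      · rfl
      · simp)
    (fun σ w => by
      have h1 : (∀ i, (w ∘ σ) i = (w ∘ σ) 0) ↔ ∀ i, w i = w 0 := by
        constructor
        · intro h i
          have h2 := h (σ.symm i)
          have h3 := h (σ.symm 0)
          simp only [Function.comp_apply, Equiv.apply_symm_apply] at h2 h3
          rw [h2, h3]
        · intro h i
          simp only [Function.comp_apply]
          rw [h (σ i), h (σ 0)]
      simp only [Φ, h1]
      split_ifs with h2
      · exact congrArg ConjPoint.val (h2 _)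
      · rfl)
    (fun x hx i => by
      have h1 := hx 1
      simp only [Pi.one_apply, one_smul, Φ, implies_true, if_true] at h1
      by_cases h2 : ∀ i, x i • (ConjPoint.mk a) = x 0 • (ConjPoint.mk a)
      · rw [if_pos h2] at h1
        rw [h2 i]
        exact ConjPoint.ext h1
      · rw [if_neg h2] at h1
        exact absurd h1.symm ha) α
  have h2 : Nat.card (MulAction.orbit T (ConjPoint.mk a)) = Nat.card {b // IsConj a b} := by
    refine Nat.card_congr ⟨fun p => ⟨p.1.val, ?_⟩, fun b => ⟨⟨b.1⟩, ?_⟩, fun _ => rfl, fun _ => rfl⟩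
    · obtain ⟨x, hx⟩ := p.2
      exact isConj_iff.2 ⟨x, congrArg ConjPoint.val hx⟩
    · obtain ⟨x, hx⟩ := isConj_iff.1 b.2
      exact ⟨x, ConjPoint.ext hx⟩
  rwa [h2] at h

/-- The function `z ↦ z₀⁻¹ a z₀` of the first coordinate alone has an orbit of size
`m * |a ^ T|`. -/
theorem mul_card_conjClass_mem_subdegrees (a x : T) (hx : x * a ≠ a * x) (α : GPoints m T) :
    m * Nat.card {b // IsConj a b} ∈ subdegrees (GTW m T) α := by
  let f : Fin m × {b // IsConj a b} → GPoints m T := fun p =>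
    pointOfEquivariant (fun _ => ConjPoint.mk p.2.1) (fun w => (w p.1).val) fun x w => rfl
  have hf : ∀ p z, (f p).1 z = (z.left p.1)⁻¹ * p.2.1 * z.left p.1 := fun p z => by
    change (z.left p.1)⁻¹ * p.2.1 * ((z.left p.1)⁻¹)⁻¹ = _
    rw [inv_inv]
  have hinj : Function.Injective f := by
    rintro ⟨i, b, hb⟩ ⟨j, c, hc⟩ h
    have h1 : ∀ z, (f ⟨i, b, hb⟩).1 z = (f ⟨j, c, hc⟩).1 z := fun z => by rw [h]
    simp only [hf] at h1
    have h2 := h1 1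
    simp only [SemidirectProduct.one_left, Pi.one_apply, inv_one, one_mul, mul_one] at h2
    subst h2
    suffices i = j by subst this; rfl
    by_contra hij
    obtain ⟨y, rfl⟩ := isConj_iff.1 hb
    have h3 := h1 ⟨Pi.mulSingle i (y * x * y⁻¹), 1⟩
    simp only [Pi.mulSingle_eq_same, Pi.mulSingle_eq_of_ne (Ne.symm hij), inv_one, one_mul,
      mul_one] at h3
    apply hx
    have h4 : (y * x * y⁻¹)⁻¹ * (y * a * y⁻¹) * (y * x * y⁻¹) = y * (x⁻¹ * (a * x)) * y⁻¹ := by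
      group
    rw [h4] at h3
    have h5 := mul_left_cancel (mul_right_cancel h3)
    exact (inv_mul_eq_iff_eq_mul.1 h5).symm
  have hrange : (Set.range fun h : WreathSym m T => twistedAct (diagHom m T) h
      (f (0, ⟨a, IsConj.refl a⟩))) = Set.range f := by
    have hact : ∀ h : WreathSym m T, twistedAct (diagHom m T) h (f (0, ⟨a, IsConj.refl a⟩)) =
        f (h.right 0, ⟨h.left (h.right 0) * a * (h.left (h.right 0))⁻¹, isConj_iff.2 ⟨_, rfl⟩⟩) := by
      intro h
      refine Subtype.ext (funext fun z => ?_)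
      rw [twistedAct_apply, hf, hf, left_inv_mul_apply]
      group
    ext β
    constructor
    · rintro ⟨h, rfl⟩
      exact ⟨_, (hact h).symm⟩
    · rintro ⟨⟨i, b, hb⟩, rfl⟩
      obtain ⟨y, rfl⟩ := isConj_iff.1 hb
      refine ⟨⟨fun _ => y, Equiv.swap 0 i⟩, (hact _).trans (congrArg f ?_)⟩
      simp
  have h := mem_subdegrees_of_card_range (diagHom m T) α (f (0, ⟨a, IsConj.refl a⟩))
  rw [hrange, Nat.card_range_of_injective hinj, Nat.card_prod, Nat.card_fin] at h
  exact h

end DiagonalOrbits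

/-! ### Functions supported on the translates of one tuple -/

section Patterns

variable {m : ℕ} [NeZero m] {T : Type*} [Group T]

open Classical in
/-- Consider the symmetric equivariant function whose value is `x z x⁻¹` at the tuples that are, up
to order, the translate `x • b` of a fixed tuple `b`, and `1` at all other tuples. By `hfix` it is
well defined. By `hi₀` no change of the entry `b i₀` alone gives a tuple with the value `z`, and
therefore the elements of the `i₀`-th factor of `T ^ m` that fix the function are those fixing
`ω₀`. By `hself` the stabiliser of `ω₀` is its own normaliser, so nothing else in `T ^ m` fixes the
function than the power of this stabiliser. -/
theorem card_pow_mem_subdegrees_of_pattern {Ω : Type*} [MulAction T Ω] [MulAction.IsPretransitive T Ω]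
    (ω₀ : Ω) (b : Fin m → Ω) (z : T) (hz : z ≠ 1)
    (hfix : ∀ (x : T) (π : Equiv.Perm (Fin m)), x • b = b ∘ π → x * z = z * x)
    (i₀ : Fin m) (hi₀ : ∀ (x : T) (π : Equiv.Perm (Fin m)) (ω : Ω),
      Function.update b i₀ ω = x • b ∘ π → x * z = z * x → ω = b i₀)
    (hself : ∀ ω : Ω, (∀ a : T, a • ω₀ = ω₀ → a • ω = ω) → ω = ω₀) (α : GPoints m T) :
    Nat.card Ω ^ m ∈ subdegrees (GTW m T) α := by
  let P : (Fin m → Ω) → T → Prop := fun w x => ∃ π : Equiv.Perm (Fin m), w = x • b ∘ π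
  let Φ : (Fin m → Ω) → T := fun w => if h : ∃ x, P w x then h.choose * z * h.choose⁻¹ else 1
  have P_unique : ∀ w x y, P w x → P w y → x * z * x⁻¹ = y * z * y⁻¹ := by
    rintro w x y ⟨π, rfl⟩ ⟨ρ, h⟩
    have h1 : (y⁻¹ * x) • b = b ∘ (π.symm.trans ρ) := by
      rw [mul_smul, inv_smul_eq_iff]
      funext i
      have h2 := congrFun h (π.symm i)
      simpa using h2
    have h3 := hfix _ _ h1
    have h4 : x * z * x⁻¹ = y * (y⁻¹ * x * z) * x⁻¹ := by group
    rw [h4, h3]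
    group
  have Φ_of : ∀ w x, P w x → Φ w = x * z * x⁻¹ := by
    intro w x h
    have h' : ∃ x, P w x := ⟨x, h⟩
    simp only [Φ, dif_pos h']
    exact P_unique w _ _ h'.choose_spec h
  have Φ_not : ∀ w, (¬ ∃ x, P w x) → Φ w = 1 := fun w h => dif_neg h
  have P_smul : ∀ w x y, P w x → P (y • w) (y * x) := by
    rintro w x y ⟨π, rfl⟩
    exact ⟨π, by rw [mul_smul]⟩
  have P_comp : ∀ w x (σ : Equiv.Perm (Fin m)), P w x → P (w ∘ σ) x := by
    rintro w x σ ⟨π, rfl⟩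
    exact ⟨σ.trans π, rfl⟩
  have P_of_Φ : ∀ w, Φ w = z → ∃ x, P w x ∧ x * z = z * x := by
    intro w h
    by_cases h1 : ∃ x, P w x
    · obtain ⟨x, hx⟩ := h1
      rw [Φ_of w x hx] at h
      exact ⟨x, hx, mul_inv_eq_iff_eq_mul.1 h⟩
    · rw [Φ_not w h1] at h
      exact absurd h.symm hz
  have hsymm : ∀ (σ : Equiv.Perm (Fin m)) (w : Fin m → Ω), Φ (w ∘ σ) = Φ w := by
    intro σ w
    by_cases h : ∃ x, P w x
    · obtain ⟨x, hx⟩ := h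
      rw [Φ_of w x hx, Φ_of _ x (P_comp w x σ hx)]
    · rw [Φ_not w h, Φ_not]
      rintro ⟨x, hx⟩
      have h1 := P_comp _ _ σ.symm hx
      rw [Function.comp_assoc, Equiv.self_comp_symm, Function.comp_id] at h1
      exact h ⟨x, h1⟩
  have hequiv : ∀ (x : T) (w : Fin m → Ω), Φ (x • w) = x * Φ w * x⁻¹ := by
    intro y w
    by_cases h : ∃ x, P w x
    · obtain ⟨x, hx⟩ := h
      rw [Φ_of w x hx, Φ_of _ _ (P_smul w x y hx)]
      group
    · rw [Φ_not w h, Φ_not]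
      · simp
      · rintro ⟨x, hx⟩
        have h1 := P_smul _ _ y⁻¹ hx
        rw [inv_smul_smul] at h1
        exact h ⟨_, h1⟩
  have hΦb : Φ b = z := by
    rw [Φ_of b 1 ⟨1, by simp⟩]
    simp
  choose t ht using fun i => MulAction.exists_smul_eq T ω₀ (b i)
  have single : ∀ c : T, (∀ g : Fin m → T, Φ (fun i => g i • (Pi.mulSingle i₀ c : Fin m → T) i • ω₀)
      = Φ fun i => g i • ω₀) → c • ω₀ = ω₀ := by
    intro c hc
    have h1 := hc t
    simp only [ht] at h1
    have h2 : (fun i => t i • (Pi.mulSingle i₀ c : Fin m → T) i • ω₀) =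
        Function.update b i₀ (t i₀ • c • ω₀) := by
      funext i
      by_cases h : i = i₀
      · subst h; simp
      · simp [h, ht]
    rw [h2] at h1
    obtain ⟨x, ⟨π, hx⟩, hxz⟩ := P_of_Φ _ (h1.trans hΦb)
    have h3 := hi₀ x π _ hx hxz
    rw [← ht i₀] at h3
    exact (MulAction.injective (t i₀)) h3
  have h := card_orbit_pow_mem_subdegrees (m := m) ω₀ Φ hequiv hsymm ?_ α
  · rwa [MulAction.orbit_eq_univ, Nat.card_univ] at h
  · intro x hx
    have hx₀ : ∀ x : Fin m → T, (∀ g : Fin m → T, Φ (fun i => g i • x i • ω₀) =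
        Φ fun i => g i • ω₀) → x i₀ • ω₀ = ω₀ := by
      intro x hx
      have hinv : (x i₀)⁻¹ • ω₀ = ω₀ := by
        refine hself _ fun a ha => ?_
        have h1 : (x i₀ * a * (x i₀)⁻¹) • ω₀ = ω₀ := by
          refine single _ fun g => ?_
          have h2 : (fun i => g i • (Pi.mulSingle i₀ (x i₀ * a * (x i₀)⁻¹) : Fin m → T) i • ω₀) =
              fun i => (g i * x i * (Pi.mulSingle i₀ a : Fin m → T) i) • (x i)⁻¹ • ω₀ := by
            funext i
            by_cases h : i = i₀
            · subst h; simp [mul_smul]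
            · simp [h, mul_smul]
          have h3 : ∀ g : Fin m → T, Φ (fun i => g i • (x i)⁻¹ • ω₀) = Φ fun i => g i • ω₀ := by
            intro g
            have h4 := hx fun i => g i * (x i)⁻¹
            simp only [mul_smul, inv_smul_smul] at h4
            exact h4.symm
          rw [h2, h3]
          have h5 : (fun i => (g i * x i * (Pi.mulSingle i₀ a : Fin m → T) i) • ω₀) =
              fun i => g i • x i • ω₀ := by
            funext i
            by_cases h : i = i₀
            · subst h; simp [mul_smul, ha]
            · simp [h, mul_smul]
          rw [h5, hx]
        rw [mul_smul, mul_smul] at h1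
        rwa [eq_inv_smul_iff]
      rw [← hinv, smul_inv_smul, hinv]
    intro i
    have h1 := hx₀ (x ∘ Equiv.swap i₀ i) fun g => by
      have h2 := hx (g ∘ Equiv.swap i₀ i)
      rw [← hsymm (Equiv.swap i₀ i), ← hsymm (Equiv.swap i₀ i) fun i => _ • ω₀] at h2
      simpa [Function.comp_def] using h2
    simpa using h1

/-- The case of the pattern `(x₀ A, A, …, A)` in `T ⧸ A`. For `m ≥ 3` an element permuting its
entries fixes both cosets; for `m = 2` it may also interchange them, and then `x₀` is required to
be an involution that does so and commutes with `z`. -/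
theorem index_pow_mem_subdegrees (A : Subgroup T) (x₀ z : T) (hz : z ≠ 1) (hx₀ : x₀ ∉ A)
    (hA : ∀ a ∈ A, x₀⁻¹ * a * x₀ ∈ A ↔ a * z = z * a)
    (hself : ∀ x : T, (∀ a ∈ A, x⁻¹ * a * x ∈ A) → x ∈ A)
    (hm : 3 ≤ m ∨ (m = 2 ∧ x₀ * x₀ = 1 ∧ x₀ * z = z * x₀)) (α : GPoints m T) :
    A.index ^ m ∈ subdegrees (GTW m T) α := by
  classical
  let p : T ⧸ A := ((1 : T) : T ⧸ A)
  let r : T ⧸ A := (x₀ : T ⧸ A)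
  let b : Fin m → T ⧸ A := Function.update (fun _ => p) 0 r
  have hb0 : b 0 = r := by simp [b]
  have hb : ∀ i, i ≠ 0 → b i = p := fun i hi => by simp [b, hi]
  have hrp : r ≠ p := by
    intro h
    apply hx₀
    have h1 : x₀⁻¹ * 1 ∈ A := QuotientGroup.eq.1 h
    simpa using h1
  have fix_p : ∀ x : T, x • p = p ↔ x ∈ A := by
    intro x
    change ((x * 1 : T) : T ⧸ A) = ((1 : T) : T ⧸ A) ↔ _
    rw [QuotientGroup.eq]
    simp
  have fix_r : ∀ x : T, x • r = r ↔ x₀⁻¹ * x * x₀ ∈ A := by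
    intro x
    change ((x * x₀ : T) : T ⧸ A) = (x₀ : T ⧸ A) ↔ _
    rw [eq_comm, QuotientGroup.eq, mul_assoc]
  -- What is needed of a permutation of the pattern, up to the swap when `m = 2`.
  have key : ∀ (x : T) (π : Equiv.Perm (Fin m)) (ω : T ⧸ A), Function.update b 0 ω = x • b ∘ π →
      (x • p = p ∧ ω = x • r) ∨
      (x₀ * z = z * x₀ ∧ (x * x₀) • p = p ∧ ω = (x * x₀) • r) := by
    intro x π ω h
    have hval : ∀ i, i ≠ 0 → x • b (π i) = p := fun i hi => by
      have h1 := congrFun h i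
      rw [Function.update_of_ne hi, hb i hi] at h1
      exact h1.symm
    have hval0 : ω = x • b (π 0) := by
      have h1 := congrFun h 0
      rwa [Function.update_self] at h1
    by_cases hπ : π 0 = 0
    · left
      have hm2 : 2 ≤ m := by omega
      have h1 : (⟨1, by omega⟩ : Fin m) ≠ 0 := by simp [Fin.ext_iff]
      have h2 : π ⟨1, by omega⟩ ≠ 0 := fun h3 => h1 (π.injective (h3.trans hπ.symm))
      have h4 := hval _ h1
      rw [hb _ h2] at h4
      rw [hπ, hb0] at hval0
      exact ⟨h4, hval0⟩
    · rw [hb _ hπ] at hval0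
      have h5 : π.symm 0 ≠ 0 := fun h6 => hπ (by rw [← h6, Equiv.apply_symm_apply, h6])
      have h7 := hval _ h5
      rw [Equiv.apply_symm_apply, hb0] at h7
      rcases hm with hm | ⟨-, h8, h9⟩
      · -- With three coordinates some `j ≠ 0` has `π j ≠ 0`, and `x` would fuse the two cosets.
        obtain ⟨j, hj⟩ : ∃ j : Fin m, j ≠ 0 ∧ j ≠ π.symm 0 := by
          have h10 : ({0, π.symm 0} : Finset (Fin m)).card < Fintype.card (Fin m) := by
            rw [Fintype.card_fin]
            exact lt_of_le_of_lt Finset.card_le_two (by omega)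
          obtain ⟨j, hj⟩ := Finset.exists_mem_notMem_of_card_lt_card
            (s := {0, π.symm 0}) (t := (Finset.univ : Finset (Fin m))) (by simpa using h10)
          simp only [Finset.mem_insert, Finset.mem_singleton, not_or] at hj
          exact ⟨j, hj.2⟩
        have h11 : π j ≠ 0 := fun h12 => hj.2 (by rw [← h12, Equiv.symm_apply_apply])
        have h13 := hval _ hj.1
        rw [hb _ h11] at h13
        exact absurd (MulAction.injective x (h7.trans h13.symm)) hrp
      · right
        have h10 : x₀ • p = r := by
          change ((x₀ * 1 : T) : T ⧸ A) = _
          rw [mul_one]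
        have h11 : x₀ • r = p := by rw [← h10, ← mul_smul, h8, one_smul]
        refine ⟨h9, ?_, ?_⟩
        · rw [mul_smul, h10, h7]
        · rw [mul_smul, h11, hval0]
  have hbr : Function.update b 0 r = b := by rw [← hb0, Function.update_eq_self]
  refine card_pow_mem_subdegrees_of_pattern (Ω := T ⧸ A) p b z hz ?_ 0 ?_ ?_ α
  · intro x π h
    have h1 : Function.update b 0 r = x⁻¹ • b ∘ π := by
      rw [hbr, eq_inv_smul_iff, h]
    have comm : ∀ y : T, y • p = p → r = y • r → y * z = z * y := fun y hy hyr =>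
      (hA y ((fix_p y).1 hy)).1 ((fix_r y).1 hyr.symm)
    have h2 : x⁻¹ * z = z * x⁻¹ := by
      rcases key x⁻¹ π r h1 with ⟨h2, h3⟩ | ⟨h2, h3, h4⟩
      · exact comm _ h2 h3
      · have h5 : Commute (x⁻¹ * x₀) z := comm _ h3 h4
        have h6 : Commute (x⁻¹ * x₀ * x₀⁻¹) z := h5.mul_left (Commute.inv_left h2)
        simpa using h6.eq
    have h3 : Commute x⁻¹ z := h2
    simpa using h3.inv_left.eq
  · intro x π ω h hxz
    rw [hb0]
    have fixed : ∀ y : T, y • p = p → y * z = z * y → y • r = r := fun y hy hyz =>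
      (fix_r y).2 ((hA y ((fix_p y).1 hy)).2 hyz)
    rcases key x π ω h with ⟨h2, h3⟩ | ⟨h2, h3, h4⟩
    · rw [h3, fixed x h2 hxz]
    · have h5 : Commute (x * x₀) z := Commute.mul_left hxz h2
      rw [h4, fixed _ h3 h5]
  · intro ω hω
    induction ω using QuotientGroup.induction_on with
    | H x =>
      have h1 : x ∈ A := hself x fun a ha => by
        have h2 := hω a ((fix_p a).2 ha)
        change ((a * x : T) : T ⧸ A) = (x : T ⧸ A) at h2
        rw [eq_comm, QuotientGroup.eq, ← mul_assoc] at h2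
        exact h2
      rw [QuotientGroup.eq]
      simpa using h1

end Patterns

/-! ### Quotients by a central element of order two -/

section DoubleCover

variable {U T : Type*} [Group U] [HasDistribNeg U] [Group T] (π : U →* T)

theorem neg_mem_iff_of_neg_one_mem {A : Subgroup U} (hA : -1 ∈ A) (g : U) : -g ∈ A ↔ g ∈ A := by
  rw [← neg_one_mul, A.mul_mem_cancel_left hA]

variable {π} in
theorem mem_map_iff_of_cover (hπ : ∀ g h, π g = π h ↔ g = h ∨ g = -h) {A : Subgroup U}
    (hA : -1 ∈ A) (g : U) : π g ∈ A.map π ↔ g ∈ A := by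
  constructor
  · rintro ⟨h, hh, hgh⟩
    rcases (hπ h g).1 hgh with rfl | rfl
    · exact hh
    · exact (neg_mem_iff_of_neg_one_mem hA _).1 hh
  · exact fun h => ⟨g, h, rfl⟩

variable {π} in
theorem index_map_of_cover (hsurj : Function.Surjective π)
    (hπ : ∀ g h, π g = π h ↔ g = h ∨ g = -h) {A : Subgroup U} (hA : -1 ∈ A) :
    (A.map π).index = A.index := by
  rw [← Subgroup.index_comap_of_surjective _ hsurj]
  congr 1
  ext g
  exact mem_map_iff_of_cover hπ hA g

/-- `index_pow_mem_subdegrees` for a quotient `T = U / {1, -1}`, in terms of a subgroup and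
elements of `U`. -/
theorem index_pow_mem_subdegrees_of_cover {m : ℕ} [NeZero m] (hsurj : Function.Surjective π)
    (hπ : ∀ g h, π g = π h ↔ g = h ∨ g = -h) (A : Subgroup U) (hneg : -1 ∈ A) (x₀ z : U)
    (hz : z ≠ 1) (hz' : z ≠ -1) (hx₀ : x₀ ∉ A)
    (hA : ∀ a ∈ A, x₀⁻¹ * a * x₀ ∈ A ↔ (a * z = z * a ∨ a * z = -(z * a)))
    (hself : ∀ x : U, (∀ a ∈ A, x⁻¹ * a * x ∈ A) → x ∈ A)
    (hm : 3 ≤ m ∨ (m = 2 ∧ (x₀ * x₀ = 1 ∨ x₀ * x₀ = -1) ∧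
      (x₀ * z = z * x₀ ∨ x₀ * z = -(z * x₀)))) (α : GPoints m T) :
    A.index ^ m ∈ subdegrees (GTW m T) α := by
  rw [← index_map_of_cover hsurj hπ hneg]
  refine index_pow_mem_subdegrees (A.map π) (π x₀) (π z) ?_ ?_ ?_ ?_ ?_ α
  · rw [← map_one π, Ne, hπ]
    tauto
  · rwa [mem_map_iff_of_cover hπ hneg]
  · intro a ha
    obtain ⟨a, rfl⟩ := hsurj a
    rw [mem_map_iff_of_cover hπ hneg] at ha
    rw [← map_inv, ← map_mul, ← map_mul, ← map_mul, ← map_mul, mem_map_iff_of_cover hπ hneg, hπ,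
      hA a ha]
  · intro x hx
    obtain ⟨x, rfl⟩ := hsurj x
    rw [mem_map_iff_of_cover hπ hneg]
    refine hself x fun a ha => ?_
    have h := hx (π a) ⟨a, ha, rfl⟩
    rwa [← map_inv, ← map_mul, ← map_mul, mem_map_iff_of_cover hπ hneg] at h
  · refine hm.imp_right fun ⟨h1, h2, h3⟩ => ⟨h1, ?_, ?_⟩
    · rw [← map_mul, ← map_one π, hπ]
      exact h2
    · rw [← map_mul, ← map_mul, hπ]
      exact h3

end DoubleCover

/-! ### The projection of `SL(2, F)` onto `PSL(2, F)` -/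

section ProjectiveSpecialLinear

variable {F : Type*} [Field F]

theorem neg_mem_center_SL2 : (-1 : SL(2, F)) ∈ Subgroup.center SL(2, F) := by
  rw [Subgroup.mem_center_iff]
  intro g
  ext i j
  simp

/-- The projection from `SL(2, F)` onto `PSL(2, F)`. -/
def toPSL2 : SL(2, F) →* PSL(2, F) := QuotientGroup.mk' (Subgroup.center SL(2, F))

theorem toPSL2_surjective : Function.Surjective (toPSL2 : SL(2, F) →* PSL(2, F)) :=
  QuotientGroup.mk'_surjective _

theorem toPSL2_eq_iff (g h : SL(2, F)) : toPSL2 g = toPSL2 h ↔ g = h ∨ g = -h := by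
  rw [eq_comm (a := toPSL2 g)]
  change (QuotientGroup.mk h : SL(2, F) ⧸ Subgroup.center SL(2, F)) = QuotientGroup.mk g ↔ _
  rw [QuotientGroup.eq]
  constructor
  · intro hc
    obtain ⟨r, hr, hs⟩ := Matrix.SpecialLinearGroup.mem_center_iff.1 hc
    rw [Fintype.card_fin, sq_eq_one_iff] at hr
    rcases hr with rfl | rfl
    · left
      have h1 : h⁻¹ * g = 1 := by
        ext i j
        rw [← hs]
        simp
      rw [inv_mul_eq_one] at h1
      exact h1.symm
    · right
      have h1 : h⁻¹ * g = -1 := by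
        ext i j
        rw [← hs]
        fin_cases i <;> fin_cases j <;> simp
      rw [inv_mul_eq_iff_eq_mul] at h1
      rw [h1, mul_neg, mul_one]
  · rintro (rfl | rfl)
    · simp
    · rw [mul_neg, inv_mul_cancel]
      exact neg_mem_center_SL2

variable {m : ℕ} [NeZero m]

/-- `index_pow_mem_subdegrees` for `PSL(2, F)`, in terms of a subgroup and elements of
`SL(2, F)`. -/
theorem index_pow_mem_subdegrees_PSL2 (A : Subgroup SL(2, F)) (hneg : -1 ∈ A) (x₀ z : SL(2, F))
    (hz : z ≠ 1) (hz' : z ≠ -1) (hx₀ : x₀ ∉ A)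
    (hA : ∀ a ∈ A, x₀⁻¹ * a * x₀ ∈ A ↔ (a * z = z * a ∨ a * z = -(z * a)))
    (hself : ∀ x : SL(2, F), (∀ a ∈ A, x⁻¹ * a * x ∈ A) → x ∈ A)
    (hm : 3 ≤ m ∨ (m = 2 ∧ (x₀ * x₀ = 1 ∨ x₀ * x₀ = -1) ∧
      (x₀ * z = z * x₀ ∨ x₀ * z = -(z * x₀)))) (α : GPoints m PSL(2, F)) :
    A.index ^ m ∈ subdegrees (GTW m PSL(2, F)) α :=
  index_pow_mem_subdegrees_of_cover toPSL2 toPSL2_surjective toPSL2_eq_iff A hneg x₀ z hz hz' hx₀ hA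
    hself hm α

theorem toPSL2_eq_one_iff (g : SL(2, F)) : toPSL2 g = 1 ↔ g = 1 ∨ g = -1 :=
  toPSL2_eq_iff g 1

theorem isConj_toPSL2_iff (a g : SL(2, F)) :
    IsConj (toPSL2 a) (toPSL2 g) ↔ IsConj a g ∨ IsConj a (-g) := by
  constructor
  · intro h
    obtain ⟨c, hc⟩ := isConj_iff.1 h
    obtain ⟨c, rfl⟩ := toPSL2_surjective c
    rw [← map_inv, ← map_mul, ← map_mul, toPSL2_eq_iff] at hc
    exact hc.imp (fun h => isConj_iff.2 ⟨c, h⟩) (fun h => isConj_iff.2 ⟨c, h⟩)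
  · rintro (h | h) <;> obtain ⟨c, hc⟩ := isConj_iff.1 h <;> refine isConj_iff.2 ⟨toPSL2 c, ?_⟩ <;>
      rw [← map_inv, ← map_mul, ← map_mul, toPSL2_eq_iff] <;> tauto

theorem card_conjClass_toPSL2 (a : SL(2, F))
    (h : ∀ g, IsConj a g → IsConj a (-g) → g = -g) :
    Nat.card {b // IsConj (toPSL2 a) b} = Nat.card {g // IsConj a g} := by
  symm
  refine Nat.card_congr (Equiv.ofBijective (fun g => ⟨toPSL2 g.1,
    (isConj_toPSL2_iff _ _).2 (Or.inl g.2)⟩) ⟨?_, ?_⟩)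
  · rintro ⟨g, hg⟩ ⟨k, hk⟩ hgk
    rcases (toPSL2_eq_iff g k).1 (congrArg Subtype.val hgk) with h1 | h1
    · exact Subtype.ext h1
    · refine Subtype.ext ?_
      change g = k
      rw [h1, ← h k hk (h1 ▸ hg)]
  · rintro ⟨b, hb⟩
    obtain ⟨g, rfl⟩ := toPSL2_surjective b
    rcases (isConj_toPSL2_iff _ _).1 hb with h1 | h1
    · exact ⟨⟨g, h1⟩, rfl⟩
    · exact ⟨⟨-g, h1⟩, Subtype.ext ((toPSL2_eq_iff _ _).2 (Or.inr rfl))⟩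

theorem Nat.card_eq_mul_of_fiber {X Y : Type*} [Finite X] [Finite Y] (f : X → Y) (k : ℕ)
    (h : ∀ y, Nat.card {x // f x = y} = k) : Nat.card X = k * Nat.card Y := by
  have := Fintype.ofFinite Y
  rw [← Nat.card_congr (Equiv.sigmaFiberEquiv f), Nat.card_sigma]
  simp [h, mul_comm]

theorem SL2_ne_neg (h2 : (2 : F) ≠ 0) (g : SL(2, F)) : g ≠ -g := by
  intro h
  have h1 : ∀ i j, g i j = 0 := fun i j => by
    have h3 : g i j = (-g) i j := by rw [← h]
    rw [Matrix.SpecialLinearGroup.coe_neg, Matrix.neg_apply] at h3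
    have h4 : 2 * g i j = 0 := by linear_combination h3
    exact (mul_eq_zero.1 h4).resolve_left h2
  have h5 := g.det_coe
  rw [Matrix.det_fin_two] at h5
  simp [h1] at h5

theorem two_mul_card_conjClass_toPSL2 [Finite F] (h2 : (2 : F) ≠ 0) (a : SL(2, F))
    (h : IsConj a (-a)) :
    2 * Nat.card {b // IsConj (toPSL2 a) b} = Nat.card {g // IsConj a g} := by
  have hneg : ∀ g, IsConj a g → IsConj a (-g) := by
    intro g hg
    obtain ⟨c, rfl⟩ := isConj_iff.1 hg
    refine h.trans (isConj_iff.2 ⟨c, ?_⟩)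
    simp
  have : Finite PSL(2, F) := Finite.of_surjective _ toPSL2_surjective
  symm
  refine Nat.card_eq_mul_of_fiber (fun g => (⟨toPSL2 g.1,
    (isConj_toPSL2_iff _ _).2 (Or.inl g.2)⟩ : {b // IsConj (toPSL2 a) b})) 2 ?_
  rintro ⟨b, hb⟩
  obtain ⟨g, rfl⟩ := toPSL2_surjective b
  have hg : IsConj a g := by
    rcases (isConj_toPSL2_iff _ _).1 hb with h1 | h1
    · exact h1
    · simpa using hneg _ h1
  rw [Nat.card_eq_two_iff]
  refine ⟨⟨⟨g, hg⟩, rfl⟩, ⟨⟨-g, hneg g hg⟩, Subtype.ext ((toPSL2_eq_iff _ _).2 (Or.inr rfl))⟩, ?_, ?_⟩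
  · intro h3
    exact SL2_ne_neg h2 g (congrArg (fun x => x.1.1) h3)
  · ext ⟨⟨k, hk⟩, hkg⟩
    have h4 := (toPSL2_eq_iff k g).1 (congrArg Subtype.val hkg)
    simpa [Subtype.ext_iff] using h4

end ProjectiveSpecialLinear

/-! ### Conjugacy classes of `SL(2, F)` and the trace -/

section TraceClasses

variable {F : Type*} [Field F]

/-- A nondegenerate binary quadratic form over a finite field represents every element. -/
theorem exists_binary_form_eq [Finite F] (a b c k : F) (h : b ^ 2 - 4 * a * c ≠ 0) :
    ∃ x y : F, a * x ^ 2 + b * x * y + c * y ^ 2 = k := by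
  have := Fintype.ofFinite F
  by_cases hF : ringChar F = 2
  · have : CharP F 2 := ringChar.of_eq hF
    have h2 : (2 : F) = 0 := CharTwo.two_eq_zero
    by_cases ha : a = 0
    · have hb : b ≠ 0 := by
        rintro rfl
        apply h
        rw [ha]
        ring
      refine ⟨(k - c) / b, 1, ?_⟩
      rw [ha]
      field_simp
      ring
    · obtain ⟨x, hx⟩ := FiniteField.isSquare_of_char_two hF (k / a)
      refine ⟨x, 0, ?_⟩
      have : a * (k / a) = k := by field_simp
      rw [hx] at this
      linear_combination this
  · have h2 : (2 : F) ≠ 0 := Ring.two_ne_zero hF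
    -- Completing the square is possible as soon as one of the squares has a nonzero coefficient.
    have main : ∀ a c : F, a ≠ 0 → b ^ 2 - 4 * a * c ≠ 0 →
        ∃ x y : F, a * x ^ 2 + b * x * y + c * y ^ 2 = k := by
      intro a c ha h
      obtain ⟨X, y, hXy⟩ := FiniteField.exists_root_sum_quadratic
        (f := Polynomial.X ^ 2) (g := Polynomial.C (-(b ^ 2 - 4 * a * c)) * Polynomial.X ^ 2 +
          Polynomial.C 0 * Polynomial.X + Polynomial.C (-(4 * a * k)))
        (Polynomial.degree_X_pow 2) (Polynomial.degree_quadratic (neg_ne_zero.2 h))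
        (FiniteField.odd_card_of_char_ne_two hF)
      simp only [Polynomial.eval_pow, Polynomial.eval_X, Polynomial.eval_add, Polynomial.eval_mul,
        Polynomial.eval_C] at hXy
      refine ⟨(X - b * y) / (2 * a), y, ?_⟩
      have h4 : 4 * a ≠ 0 := by
        have : (4 : F) = 2 * 2 := by norm_num
        rw [this]
        exact mul_ne_zero (mul_ne_zero h2 h2) ha
      field_simp
      linear_combination hXy
    by_cases ha : a = 0
    · by_cases hc : c = 0
      · have hb : b ≠ 0 := by
          rintro rfl
          apply h
          rw [ha]
          ring
        refine ⟨k / b, 1, ?_⟩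
        rw [ha, hc]
        field_simp
        ring
      · obtain ⟨x, y, hxy⟩ := main c a hc (by rwa [mul_right_comm])
        exact ⟨y, x, by linear_combination hxy⟩
    · exact main a c ha h

theorem SL2_det (g : SL(2, F)) : g 0 0 * g 1 1 - g 0 1 * g 1 0 = 1 := by
  rw [← Matrix.det_fin_two]
  exact g.det_coe

theorem SL2_ext {g h : SL(2, F)} (h00 : g 0 0 = h 0 0) (h01 : g 0 1 = h 0 1) (h10 : g 1 0 = h 1 0)
    (h11 : g 1 1 = h 1 1) : g = h := by
  ext i j
  fin_cases i <;> fin_cases j <;> assumption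

theorem SL2_mul_apply (g h : SL(2, F)) (i j : Fin 2) :
    (g * h) i j = g i 0 * h 0 j + g i 1 * h 1 j := by
  rw [Matrix.SpecialLinearGroup.coe_mul, Matrix.mul_apply, Fin.sum_univ_two]

theorem SL2_neg_apply (g : SL(2, F)) (i j : Fin 2) : (-g) i j = -g i j := by
  rw [Matrix.SpecialLinearGroup.coe_neg, Matrix.neg_apply]

theorem SL2_inv_apply (g : SL(2, F)) : g⁻¹ 0 0 = g 1 1 ∧ g⁻¹ 0 1 = -g 0 1 ∧ g⁻¹ 1 0 = -g 1 0 ∧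
    g⁻¹ 1 1 = g 0 0 := by
  rw [Matrix.SpecialLinearGroup.SL2_inv_expl]
  exact ⟨rfl, rfl, rfl, rfl⟩

/-- The element of `SL(2, F)` with given entries. -/
def SL2.of (a b c d : F) (h : a * d - b * c = 1) : SL(2, F) :=
  ⟨!![a, b; c, d], by rw [Matrix.det_fin_two_of, h]⟩

@[simp] theorem SL2.of_zero_zero (a b c d : F) (h) : (SL2.of a b c d h) 0 0 = a := rfl
@[simp] theorem SL2.of_zero_one (a b c d : F) (h) : (SL2.of a b c d h) 0 1 = b := rfl
@[simp] theorem SL2.of_one_zero (a b c d : F) (h) : (SL2.of a b c d h) 1 0 = c := rfl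
@[simp] theorem SL2.of_one_one (a b c d : F) (h) : (SL2.of a b c d h) 1 1 = d := rfl

/-- The trace of an element of `SL(2, F)`. -/
def SL2.tr (g : SL(2, F)) : F := g 0 0 + g 1 1

theorem SL2.tr_mul_comm (g h : SL(2, F)) : SL2.tr (g * h) = SL2.tr (h * g) := by
  simp only [SL2.tr, SL2_mul_apply]
  ring

theorem SL2.tr_conj (g h : SL(2, F)) : SL2.tr (g * h * g⁻¹) = SL2.tr h := by
  rw [SL2.tr_mul_comm, ← mul_assoc, inv_mul_cancel, one_mul]

theorem SL2.tr_neg (g : SL(2, F)) : SL2.tr (-g) = -SL2.tr g := by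
  simp only [SL2.tr, SL2_neg_apply]
  ring

theorem SL2.tr_inv (g : SL(2, F)) : SL2.tr g⁻¹ = SL2.tr g := by
  obtain ⟨h1, -, -, h2⟩ := SL2_inv_apply g
  simp only [SL2.tr, h1, h2]
  ring

/-- If the form `det (v, g v)` represents `1` at `v`, then the matrix with columns `v, g v`
conjugates the companion matrix of `g` to `g`; so the elements of `SL(2, F)` of trace `τ` form one
conjugacy class when this form, of discriminant `τ ^ 2 - 4`, is nondegenerate. -/
theorem isConj_iff_tr_eq [Finite F] (g h : SL(2, F)) (hg : SL2.tr g ^ 2 ≠ 4) :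
    IsConj g h ↔ SL2.tr h = SL2.tr g := by
  constructor
  · intro hc
    obtain ⟨c, rfl⟩ := isConj_iff.1 hc
    exact SL2.tr_conj _ _
  · intro hgh
    have companion : ∀ k : SL(2, F), SL2.tr k = SL2.tr g →
        IsConj (SL2.of 0 (-1) 1 (SL2.tr g) (by ring)) k := by
      intro k hk
      have hdet := SL2_det k
      have htr : k 0 0 + k 1 1 = SL2.tr g := hk
      obtain ⟨x, y, hxy⟩ := exists_binary_form_eq (k 1 0) (k 1 1 - k 0 0) (-k 0 1) 1 (by
        intro h
        apply hg
        rw [← htr]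
        linear_combination h + 4 * hdet)
      let P : SL(2, F) := SL2.of x (k 0 0 * x + k 0 1 * y) y (k 1 0 * x + k 1 1 * y)
        (by linear_combination hxy)
      refine isConj_iff.2 ⟨P, ?_⟩
      rw [mul_inv_eq_iff_eq_mul]
      apply SL2_ext <;>
        simp only [SL2_mul_apply, P, SL2.of_zero_zero, SL2.of_zero_one, SL2.of_one_zero,
          SL2.of_one_one, ← htr]
      · ring
      · linear_combination x * hdet
      · ring
      · linear_combination y * hdet
    exact (companion g rfl).symm.trans (companion h hgh)

open Classical in
theorem card_mul_eq [Finite F] (k : F) : Nat.card {p : F × F // p.1 * p.2 = k} =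
    (Nat.card F - 1) + if k = 0 then Nat.card F else 0 := by
  have := Fintype.ofFinite F
  have hsig : Nat.card {p : F × F // p.1 * p.2 = k} = ∑ a : F, Nat.card {b : F // a * b = k} := by
    rw [← Nat.card_sigma]
    exact Nat.card_congr ⟨fun p => ⟨p.1.1, p.1.2, p.2⟩, fun p => ⟨(p.1, p.2.1), p.2.2⟩,
      fun _ => rfl, fun _ => rfl⟩
  have hne : ∀ a : F, a ≠ 0 → Nat.card {b : F // a * b = k} = 1 := fun a ha => by
    rw [Nat.card_eq_one_iff_exists]
    refine ⟨⟨k / a, by field_simp⟩, ?_⟩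
    rintro ⟨b, rfl⟩
    exact Subtype.ext (by field_simp)
  have h0 : Nat.card {b : F // 0 * b = k} = if k = 0 then Nat.card F else 0 := by
    split_ifs with hk
    · rw [hk]
      simp only [zero_mul]
      exact Nat.card_congr (Equiv.subtypeUnivEquiv fun _ => trivial)
    · have : IsEmpty {b : F // 0 * b = k} := ⟨fun b => hk (by rw [← b.2, zero_mul])⟩
      exact Nat.card_of_isEmpty
  rw [hsig, ← Finset.sum_erase_add _ _ (Finset.mem_univ (0 : F)), h0,
    Finset.sum_congr rfl fun a ha => hne a (Finset.ne_of_mem_erase ha)]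
  simp [Finset.card_erase_of_mem, Nat.card_eq_fintype_card]

/-- There are `q (q - 1) + q r` elements of trace `τ` in `SL(2, q)`, where `r` is the number of
eigenvalues in the field. -/
theorem card_tr_eq [Finite F] (τ : F) : Nat.card {g : SL(2, F) // SL2.tr g = τ} =
    Nat.card F * (Nat.card F - 1) + Nat.card {a : F // a * (τ - a) = 1} * Nat.card F := by
  classical
  have := Fintype.ofFinite F
  have e : {g : SL(2, F) // SL2.tr g = τ} ≃
      Σ a : F, {p : F × F // p.1 * p.2 = a * (τ - a) - 1} :=
    { toFun := fun g => ⟨g.1 0 0, (g.1 0 1, g.1 1 0), by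
        have h1 := SL2_det g.1
        have h2 : g.1 0 0 + g.1 1 1 = τ := g.2
        change g.1 0 1 * g.1 1 0 = g.1 0 0 * (τ - g.1 0 0) - 1
        linear_combination -h1 + g.1 0 0 * h2⟩
      invFun := fun p => ⟨SL2.of p.1 p.2.1.1 p.2.1.2 (τ - p.1) (by rw [p.2.2]; ring), by
        simp [SL2.tr]⟩
      left_inv := fun g => by
        have h2 : g.1 0 0 + g.1 1 1 = τ := g.2
        refine Subtype.ext (SL2_ext rfl rfl rfl ?_)
        change τ - g.1 0 0 = g.1 1 1
        linear_combination -h2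
      right_inv := fun p => rfl }
  rw [Nat.card_congr e, Nat.card_sigma, Finset.sum_congr rfl fun a _ => card_mul_eq _,
    Finset.sum_add_distrib, ← Finset.sum_filter]
  simp only [Finset.sum_const, Finset.card_univ, smul_eq_mul, sub_eq_zero,
    Nat.card_eq_fintype_card, Fintype.card_subtype]

theorem card_eigenvalues_of_split (l : F) (hl : l ≠ 0) (hl' : l ^ 2 ≠ 1) :
    Nat.card {a : F // a * (l + l⁻¹ - a) = 1} = 2 := by
  rw [Nat.card_eq_two_iff]
  refine ⟨⟨l, by field_simp; ring⟩, ⟨l⁻¹, by field_simp; ring⟩, ?_, ?_⟩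
  · intro h
    have h1 : l = l⁻¹ := congrArg Subtype.val h
    apply hl'
    rw [sq]
    nth_rw 2 [h1]
    exact mul_inv_cancel₀ hl
  · ext ⟨a, ha⟩
    have h1 : (a - l) * (a - l⁻¹) = 0 := by
      field_simp
      field_simp at ha
      linear_combination -ha
    have := mul_eq_zero.1 h1
    simpa [Subtype.ext_iff, sub_eq_zero] using this

theorem card_eigenvalues_of_nonsplit (τ : F) (h : ∀ a : F, a * (τ - a) ≠ 1) :
    Nat.card {a : F // a * (τ - a) = 1} = 0 := by
  have : IsEmpty {a : F // a * (τ - a) = 1} := ⟨fun a => h a.1 a.2⟩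
  exact Nat.card_of_isEmpty

theorem exists_SL2_tr_eq (τ : F) : ∃ g : SL(2, F), SL2.tr g = τ :=
  ⟨SL2.of 0 (-1) 1 τ (by ring), by simp [SL2.tr]⟩

theorem card_conjClass_of_tr [Finite F] (g : SL(2, F)) (hg : SL2.tr g ^ 2 ≠ 4) :
    Nat.card {h // IsConj g h} = Nat.card {h : SL(2, F) // SL2.tr h = SL2.tr g} :=
  Nat.card_congr (Equiv.subtypeEquivRight fun h => isConj_iff_tr_eq g h hg)

variable {m : ℕ} [NeZero m]

theorem tr_ne_of_toPSL2_eq_one {g : SL(2, F)} (hg : SL2.tr g ^ 2 ≠ 4) : toPSL2 g ≠ 1 := by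
  rw [Ne, toPSL2_eq_one_iff]
  rintro (rfl | rfl) <;> apply hg <;> simp [SL2.tr] <;> norm_num

/-- Elements of nonzero trace are not conjugate to their negatives in odd characteristic. -/
theorem card_conjClass_toPSL2_of_tr [Finite F] (g : SL(2, F)) (hg : SL2.tr g ^ 2 ≠ 4)
    (hg' : (2 : F) = 0 ∨ SL2.tr g ≠ 0) :
    Nat.card {b // IsConj (toPSL2 g) b} = Nat.card F * (Nat.card F - 1) +
      Nat.card {a : F // a * (SL2.tr g - a) = 1} * Nat.card F := by
  rw [← card_tr_eq, ← card_conjClass_of_tr g hg]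
  refine card_conjClass_toPSL2 g fun h h1 h2 => ?_
  rw [isConj_iff_tr_eq g _ hg] at h1 h2
  rw [SL2.tr_neg, h1] at h2
  have h3 : 2 * SL2.tr g = 0 := by linear_combination -h2
  have h4 : (2 : F) = 0 := hg'.elim id fun h => (mul_eq_zero.1 h3).resolve_right h
  have h5 : ∀ x : F, x = -x := fun x => by linear_combination x * h4
  ext i j
  rw [SL2_neg_apply]
  exact h5 _

theorem two_mul_card_conjClass_toPSL2_of_tr_zero [Finite F] (h2 : (2 : F) ≠ 0) (g : SL(2, F))
    (hg : SL2.tr g = 0) :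
    2 * Nat.card {b // IsConj (toPSL2 g) b} = Nat.card F * (Nat.card F - 1) +
      Nat.card {a : F // a * (0 - a) = 1} * Nat.card F := by
  have h4 : SL2.tr g ^ 2 ≠ 4 := by
    rw [hg]
    intro h
    have h3 : (2 : F) * 2 = 0 := by linear_combination -h
    simp [h2] at h3
  rw [← card_tr_eq, ← hg, ← card_conjClass_of_tr g h4]
  refine two_mul_card_conjClass_toPSL2 h2 g ((isConj_iff_tr_eq _ _ h4).2 ?_)
  rw [SL2.tr_neg, hg, neg_zero]

end TraceClasses

/-! ### Sizes of conjugacy classes of `PSL(2, F)` -/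

section ClassSizes

variable {F : Type*} [Field F]

/-- In odd characteristic, `X ^ 2 - τ X + 1` is irreducible for some `τ ≠ 0`. -/
theorem exists_nonsplit_tr_of_odd [Finite F] (h2 : (2 : F) ≠ 0) (hq : 4 ≤ Nat.card F) :
    ∃ τ : F, τ ≠ 0 ∧ ∀ a : F, a * (τ - a) ≠ 1 := by
  have hchar : ringChar F ≠ 2 := fun h => h2 (by
    have : CharP F 2 := ringChar.of_eq h
    exact CharTwo.two_eq_zero)
  have := Fintype.ofFinite F
  obtain ⟨n, hn⟩ := FiniteField.exists_nonsquare hchar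
  have hn0 : n ≠ 0 := by
    rintro rfl
    exact hn ⟨0, by ring⟩
  let p : Polynomial F := Polynomial.X * (1 + Polynomial.C n * Polynomial.X ^ 2)
  have hdeg : p.natDegree ≤ 3 := by
    simp only [p]
    compute_degree
  have hp : p ≠ 0 := by
    intro h
    have := congrArg (Polynomial.coeff · 1) h
    simp [p, Polynomial.coeff_one] at this
  obtain ⟨t, ht⟩ := Polynomial.exists_eval_ne_zero_of_natDegree_lt_card p hp (by
    rw [← Nat.cast_card]
    exact_mod_cast lt_of_le_of_lt hdeg (by omega))
  simp only [p, Polynomial.eval_mul, Polynomial.eval_X, Polynomial.eval_add, Polynomial.eval_one,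
    Polynomial.eval_C, Polynomial.eval_pow] at ht
  have ht0 : t ≠ 0 := left_ne_zero_of_mul ht
  have ht1 : 1 + n * t ^ 2 ≠ 0 := right_ne_zero_of_mul ht
  have ht2 : 1 - n * t ^ 2 ≠ 0 := by
    intro h
    apply hn
    refine ⟨t⁻¹, ?_⟩
    field_simp
    linear_combination -h
  -- The traces of the norm-one elements `(1 + t √n) / (1 - t √n)` of `F(√n)`.
  refine ⟨2 * (1 + n * t ^ 2) / (1 - n * t ^ 2), div_ne_zero (mul_ne_zero h2 ht1) ht2, ?_⟩
  intro a ha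
  apply hn
  have h4 : (4 : F) = 2 * 2 := by norm_num
  have h4' : (4 : F) ≠ 0 := by rw [h4]; exact mul_ne_zero h2 h2
  refine ⟨(2 * a * (1 - n * t ^ 2) - 2 * (1 + n * t ^ 2)) / (4 * t), ?_⟩
  field_simp at ha ⊢
  linear_combination (4 * (1 - n * t ^ 2)) * ha

/-- In characteristic two, `X ^ 2 - τ X + 1` is irreducible if `τ ^ (-2)` is not of the form
`u ^ 2 + u`. -/
theorem exists_nonsplit_tr_of_even [Finite F] (h2 : (2 : F) = 0) :
    ∃ τ : F, τ ≠ 0 ∧ ∀ a : F, a * (τ - a) ≠ 1 := by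
  have : CharP F 2 := CharTwo.of_one_ne_zero_of_two_eq_zero one_ne_zero h2
  have := Fintype.ofFinite F
  have hns : ¬ Function.Surjective fun u : F => u ^ 2 + u := by
    rw [← Finite.injective_iff_surjective]
    intro h
    have h01 : (0 : F) = 1 := h (by
      change (0 : F) ^ 2 + 0 = 1 ^ 2 + 1
      linear_combination -h2)
    exact zero_ne_one h01
  simp only [Function.Surjective, not_forall, not_exists] at hns
  obtain ⟨c, hc⟩ := hns
  have hc0 : c ≠ 0 := fun h => hc 0 (by rw [h]; ring)
  obtain ⟨s, hs⟩ := FiniteField.isSquare_of_char_two (ringChar.eq F 2) c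
  have hs0 : s ≠ 0 := by
    rintro rfl
    exact hc0 (by rw [hs, zero_mul])
  refine ⟨s⁻¹, inv_ne_zero hs0, fun a ha => hc (a * s) ?_⟩
  rw [hs]
  field_simp at ha
  linear_combination s * ha + a ^ 2 * s ^ 2 * h2

theorem ne_four_of_nonsplit {τ : F} (h2 : (2 : F) = 0 → τ ≠ 0) (h : ∀ a : F, a * (τ - a) ≠ 1) :
    τ ^ 2 ≠ 4 := by
  intro h4
  by_cases h0 : (2 : F) = 0
  · exact h2 h0 (pow_eq_zero_iff two_ne_zero |>.1 (by linear_combination h4 + 2 * h0))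
  · have h4' : (4 : F) ≠ 0 := by
      have : (4 : F) = 2 * 2 := by norm_num
      rw [this]
      exact mul_ne_zero h0 h0
    refine h (τ / 2) ?_
    field_simp
    linear_combination h4

theorem split_ne_four {l : F} (hl : l ≠ 0) (hl' : l ^ 2 ≠ 1) : (l + l⁻¹) ^ 2 ≠ 4 := by
  intro h
  have h1 : (l ^ 2 - 1) ^ 2 = 0 := by
    field_simp at h
    linear_combination h
  exact hl' (sub_eq_zero.1 (pow_eq_zero_iff two_ne_zero |>.1 h1))

variable {m : ℕ} [NeZero m]

theorem card_conjClass_toPSL2_of_nonsplit [Finite F] (g : SL(2, F))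
    (h2 : (2 : F) = 0 ∨ SL2.tr g ≠ 0) (h4 : SL2.tr g ^ 2 ≠ 4)
    (h : ∀ a : F, a * (SL2.tr g - a) ≠ 1) :
    Nat.card {b // IsConj (toPSL2 g) b} = Nat.card F * (Nat.card F - 1) := by
  rw [card_conjClass_toPSL2_of_tr g h4 h2, card_eigenvalues_of_nonsplit _ h, zero_mul, add_zero]

/-- The class of an element without eigenvalues in `F` that is not an involution; its centraliser is
a nonsplit torus. -/
theorem nonsplit_class_mem_subdegrees [Finite F] (hq : 4 ≤ Nat.card F) (α : GPoints m PSL(2, F)) :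
    (Nat.card F * (Nat.card F - 1)) ^ m ∈ subdegrees (GTW m PSL(2, F)) α := by
  obtain ⟨τ, hτ, h⟩ : ∃ τ : F, τ ≠ 0 ∧ ∀ a : F, a * (τ - a) ≠ 1 := by
    by_cases h2 : (2 : F) = 0
    · exact exists_nonsplit_tr_of_even h2
    · exact exists_nonsplit_tr_of_odd h2 hq
  obtain ⟨g, rfl⟩ := exists_SL2_tr_eq τ
  have h4 := ne_four_of_nonsplit (fun _ => hτ) h
  rw [← card_conjClass_toPSL2_of_nonsplit g (Or.inr hτ) h4 h]
  exact card_conjClass_pow_mem_subdegrees _ (tr_ne_of_toPSL2_eq_one h4) α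

/-- The class of a diagonal element that is not an involution; its centraliser is a split torus. -/
theorem split_class_mem_subdegrees [Finite F] (hq : 4 ≤ Nat.card F)
    (hq' : (2 : F) ≠ 0 → 6 ≤ Nat.card F) (α : GPoints m PSL(2, F)) :
    (Nat.card F * (Nat.card F + 1)) ^ m ∈ subdegrees (GTW m PSL(2, F)) α := by
  obtain ⟨l, hl, hl', hl2⟩ : ∃ l : F, l ≠ 0 ∧ l ^ 2 ≠ 1 ∧ ((2 : F) = 0 ∨ l + l⁻¹ ≠ 0) := by
    by_cases h2 : (2 : F) = 0
    · obtain ⟨l, hl⟩ := Polynomial.exists_eval_ne_zero_of_natDegree_lt_card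
        (Polynomial.X ^ 3 - Polynomial.X : Polynomial F) (by
          intro h
          have := congrArg (Polynomial.coeff · 1) h
          simp [Polynomial.coeff_X, Polynomial.coeff_X_pow] at this) (by
          rw [← Nat.cast_card]
          refine Nat.cast_lt.2 (lt_of_le_of_lt (b := 3) ?_ (by omega))
          compute_degree)
      simp only [Polynomial.eval_sub, Polynomial.eval_pow, Polynomial.eval_X] at hl
      refine ⟨l, ?_, ?_, Or.inl h2⟩
      · rintro rfl
        exact hl (by ring)
      · intro h
        exact hl (by linear_combination l * h)
    · obtain ⟨l, hl⟩ := Polynomial.exists_eval_ne_zero_of_natDegree_lt_card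
        (Polynomial.X ^ 5 - Polynomial.X : Polynomial F) (by
          intro h
          have := congrArg (Polynomial.coeff · 1) h
          simp [Polynomial.coeff_X, Polynomial.coeff_X_pow] at this) (by
          rw [← Nat.cast_card]
          refine Nat.cast_lt.2 (lt_of_le_of_lt (b := 5) ?_ (by have := hq' h2; omega))
          compute_degree)
      simp only [Polynomial.eval_sub, Polynomial.eval_pow, Polynomial.eval_X] at hl
      have hl0 : l ≠ 0 := by
        rintro rfl
        exact hl (by ring)
      refine ⟨l, hl0, ?_, Or.inr ?_⟩
      · intro h
        exact hl (by linear_combination l * (l ^ 2 + 1) * h)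
      · intro h
        field_simp at h
        exact hl (by linear_combination l * (l ^ 2 - 1) * h)
  obtain ⟨g, hg⟩ := exists_SL2_tr_eq (l + l⁻¹)
  have h4 : SL2.tr g ^ 2 ≠ 4 := by rw [hg]; exact split_ne_four hl hl'
  have h := card_conjClass_pow_mem_subdegrees _ (tr_ne_of_toPSL2_eq_one h4) α
  rw [card_conjClass_toPSL2_of_tr g h4 (by rwa [hg]), hg, card_eigenvalues_of_split l hl hl'] at h
  obtain ⟨k, hk⟩ : ∃ k, Nat.card F = k + 1 := ⟨Nat.card F - 1, by omega⟩
  rw [hk] at h ⊢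
  convert h using 2
  rw [Nat.add_sub_cancel]
  ring

/-- The class of involutions in odd characteristic: the images of the elements of trace zero. -/
theorem involution_class_mem_subdegrees [Finite F] (h2 : (2 : F) ≠ 0) (r : ℕ)
    (hr : Nat.card {a : F // a * (0 - a) = 1} = r) (α : GPoints m PSL(2, F)) :
    ((Nat.card F * (Nat.card F - 1) + r * Nat.card F) / 2) ^ m ∈
      subdegrees (GTW m PSL(2, F)) α := by
  obtain ⟨g, hg⟩ := exists_SL2_tr_eq (0 : F)
  have h4 : SL2.tr g ^ 2 ≠ 4 := by
    rw [hg]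
    intro h
    have h3 : (2 : F) * 2 = 0 := by linear_combination -h
    simp [h2] at h3
  have h := card_conjClass_pow_mem_subdegrees _ (tr_ne_of_toPSL2_eq_one h4) α
  have h1 := two_mul_card_conjClass_toPSL2_of_tr_zero h2 g hg
  rw [hr] at h1
  rwa [← h1, Nat.mul_div_cancel_left _ two_pos]

theorem involution_class_mem_subdegrees_of_one_mod_four [Finite F] (hq : Nat.card F % 4 = 1)
    (h2 : (2 : F) ≠ 0) (α : GPoints m PSL(2, F)) :
    (Nat.card F * (Nat.card F + 1) / 2) ^ m ∈ subdegrees (GTW m PSL(2, F)) α := by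
  have := Fintype.ofFinite F
  obtain ⟨l, hl⟩ : IsSquare (-1 : F) := by
    rw [FiniteField.isSquare_neg_one_iff, ← Nat.card_eq_fintype_card]
    omega
  have hl0 : l ≠ 0 := by
    rintro rfl
    simp at hl
  have hl1 : l + l⁻¹ = 0 := by
    field_simp
    linear_combination -hl
  have hl2 : l ^ 2 ≠ 1 := by
    intro h
    apply h2
    linear_combination -h - hl
  have hr := card_eigenvalues_of_split l hl0 hl2
  rw [hl1] at hr
  have h := involution_class_mem_subdegrees h2 2 hr α
  obtain ⟨k, hk⟩ : ∃ k, Nat.card F = k + 1 := ⟨Nat.card F - 1, by omega⟩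
  rw [hk] at h ⊢
  convert h using 3
  rw [Nat.add_sub_cancel]
  ring

theorem involution_class_mem_subdegrees_of_three_mod_four [Finite F] (hq : Nat.card F % 4 = 3)
    (h2 : (2 : F) ≠ 0) (α : GPoints m PSL(2, F)) :
    (Nat.card F * (Nat.card F - 1) / 2) ^ m ∈ subdegrees (GTW m PSL(2, F)) α := by
  have := Fintype.ofFinite F
  have hl : ¬ IsSquare (-1 : F) := by
    rw [FiniteField.isSquare_neg_one_iff, ← Nat.card_eq_fintype_card]
    omega
  have hr := card_eigenvalues_of_nonsplit (0 : F) fun a ha => hl ⟨a, by linear_combination ha⟩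
  simpa using involution_class_mem_subdegrees h2 0 hr α

/-- The transvection `w ↦ w + det (w, v) v`, up to sign, attached to a vector `v`. -/
def SL2.transv (v : F × F) : SL(2, F) :=
  SL2.of (1 - v.1 * v.2) (v.1 ^ 2) (-v.2 ^ 2) (1 + v.1 * v.2) (by ring)

theorem SL2.transv_conj (g : SL(2, F)) (v : F × F) :
    g * SL2.transv v * g⁻¹ =
      SL2.transv (g 0 0 * v.1 + g 0 1 * v.2, g 1 0 * v.1 + g 1 1 * v.2) := by
  rw [mul_inv_eq_iff_eq_mul]
  have hdet := SL2_det g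
  apply SL2_ext <;>
    simp only [SL2_mul_apply, SL2.transv, SL2.of_zero_zero, SL2.of_zero_one, SL2.of_one_zero,
      SL2.of_one_one]
  · linear_combination ((g 0 0 * v.1 + g 0 1 * v.2) * v.2) * hdet
  · linear_combination (-(g 0 0 * v.1 + g 0 1 * v.2) * v.1) * hdet
  · linear_combination ((g 1 0 * v.1 + g 1 1 * v.2) * v.2) * hdet
  · linear_combination (-(g 1 0 * v.1 + g 1 1 * v.2) * v.1) * hdet

theorem SL2.transv_eq_iff (v w : F × F) : SL2.transv v = SL2.transv w ↔ v = w ∨ v = -w := by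
  constructor
  · intro h
    have h01 : v.1 ^ 2 = w.1 ^ 2 := congrArg (fun g : SL(2, F) => g 0 1) h
    have h10 : -v.2 ^ 2 = -w.2 ^ 2 := congrArg (fun g : SL(2, F) => g 1 0) h
    have h11 : 1 + v.1 * v.2 = 1 + w.1 * w.2 := congrArg (fun g : SL(2, F) => g 1 1) h
    have h10' : v.2 ^ 2 = w.2 ^ 2 := by linear_combination -h10
    rcases sq_eq_sq_iff_eq_or_eq_neg.1 h01 with h1 | h1
    · by_cases h0 : w.1 = 0
      · rcases sq_eq_sq_iff_eq_or_eq_neg.1 h10' with h2 | h2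
        · exact Or.inl (Prod.ext h1 h2)
        · exact Or.inr (Prod.ext (by rw [h1, Prod.fst_neg, h0, neg_zero]) h2)
      · rw [h1] at h11
        exact Or.inl (Prod.ext h1 (mul_left_cancel₀ h0 (by linear_combination h11)))
    · by_cases h0 : w.1 = 0
      · rcases sq_eq_sq_iff_eq_or_eq_neg.1 h10' with h2 | h2
        · exact Or.inl (Prod.ext (by rw [h1, h0, neg_zero]) h2)
        · exact Or.inr (Prod.ext h1 h2)
      · rw [h1] at h11
        refine Or.inr (Prod.ext h1 (mul_left_cancel₀ h0 ?_))
        rw [Prod.snd_neg]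
        linear_combination -h11
  · rintro (rfl | rfl)
    · rfl
    · apply SL2_ext <;> simp [SL2.transv]

/-- The conjugates of a transvection are the transvections attached to all nonzero vectors, two
vectors giving the same transvection if and only if they agree up to sign. -/
theorem card_conjClass_transv [Finite F] :
    Nat.card {b // IsConj (toPSL2 (SL2.transv ((1, 0) : F × F))) b} =
      (Nat.card F ^ 2 - 1) / Nat.gcd 2 (Nat.card F - 1) := by
  have := Fintype.ofFinite F
  have htr : ∀ v : F × F, SL2.tr (SL2.transv v) = 2 := fun v => by
    simp only [SL2.tr, SL2.transv, SL2.of_zero_zero, SL2.of_one_one]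
    ring
  rw [card_conjClass_toPSL2]
  · have hclass : ∀ v : {v : F × F // v ≠ 0}, IsConj (SL2.transv ((1, 0) : F × F))
        (SL2.transv v.1) := by
      rintro ⟨⟨x, y⟩, hv⟩
      obtain ⟨z, w, hzw⟩ : ∃ z w : F, x * w - z * y = 1 := by
        by_cases hx : x = 0
        · have hy : y ≠ 0 := by
            rintro rfl
            exact hv (by rw [hx]; rfl)
          exact ⟨-y⁻¹, 0, by field_simp; ring⟩
        · exact ⟨0, x⁻¹, by field_simp; ring⟩
      refine isConj_iff.2 ⟨SL2.of x z y w hzw, ?_⟩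
      rw [SL2.transv_conj]
      simp
    let f : {v : F × F // v ≠ 0} → {g // IsConj (SL2.transv ((1, 0) : F × F)) g} :=
      fun v => ⟨SL2.transv v.1, hclass v⟩
    have hf : ∀ v w, f v = f w ↔ v.1 = w.1 ∨ v.1 = -w.1 := fun v w =>
      Subtype.ext_iff.trans (SL2.transv_eq_iff _ _)
    have hsurj : Function.Surjective f := by
      rintro ⟨g, hg⟩
      obtain ⟨c, rfl⟩ := isConj_iff.1 hg
      have hv : (c 0 0, c 1 0) ≠ (0 : F × F) := by
        intro h
        have h1 : c 0 0 = 0 := congrArg Prod.fst h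
        have h2 : c 1 0 = 0 := congrArg Prod.snd h
        have := SL2_det c
        simp [h1, h2] at this
      refine ⟨⟨(c 0 0, c 1 0), hv⟩, Subtype.ext ?_⟩
      change _ = c * SL2.transv ((1, 0) : F × F) * c⁻¹
      rw [SL2.transv_conj]
      simp [f]
    have hcard : Nat.card {v : F × F // v ≠ 0} = Nat.card F ^ 2 - 1 := by
      classical
      rw [Nat.card_eq_fintype_card, Fintype.card_subtype_compl, Fintype.card_prod,
        Fintype.card_subtype_eq, ← Nat.card_eq_fintype_card, sq]
    have hmain := Nat.card_eq_mul_of_fiber f (Nat.gcd 2 (Nat.card F - 1)) (by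
      intro y
      obtain ⟨v, rfl⟩ := hsurj y
      have hq : 0 < Nat.card F := Nat.card_pos
      by_cases h2 : (2 : F) = 0
      · have : CharP F 2 := CharTwo.of_one_ne_zero_of_two_eq_zero one_ne_zero h2
        have hev : Nat.card F % 2 = 0 := by
          rw [Nat.card_eq_fintype_card]
          exact FiniteField.even_card_of_char_two (ringChar.eq F 2)
        have hg : Nat.gcd 2 (Nat.card F - 1) = 1 := by
          rw [← Nat.coprime_iff_gcd_eq_one, Nat.coprime_two_left, Nat.odd_iff]
          omega
        rw [hg, Nat.card_eq_one_iff_exists]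
        refine ⟨⟨v, rfl⟩, ?_⟩
        rintro ⟨w, hw⟩
        refine Subtype.ext (Subtype.ext ?_)
        rcases (hf w v).1 hw with h | h
        · exact h
        · rw [h]
          exact Prod.ext (CharTwo.neg_eq _) (CharTwo.neg_eq _)
      · have hchar : ringChar F ≠ 2 := fun h => h2 (by
          have : CharP F 2 := ringChar.of_eq h
          exact CharTwo.two_eq_zero)
        have hodd : Nat.card F % 2 = 1 := by
          rw [Nat.card_eq_fintype_card]
          exact FiniteField.odd_card_of_char_ne_two hchar
        have hg : Nat.gcd 2 (Nat.card F - 1) = 2 :=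
          Nat.gcd_eq_left (by omega)
        rw [hg, Nat.card_eq_two_iff]
        refine ⟨⟨v, rfl⟩, ⟨⟨-v.1, neg_ne_zero.2 v.2⟩, (hf _ _).2 (Or.inr rfl)⟩, ?_, ?_⟩
        · intro h
          have h3 : v.1 = -v.1 := congrArg (fun x => x.1.1) h
          have h4 : (2 : F) • v.1 = 0 := by
            rw [two_smul]
            nth_rw 1 [h3]
            exact neg_add_cancel _
          exact v.2 ((smul_eq_zero.1 h4).resolve_left h2)
        · ext ⟨w, hw⟩
          simpa [Subtype.ext_iff] using (hf w v).1 hw)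
    rw [hcard] at hmain
    rw [hmain, Nat.mul_div_cancel_left]
    exact Nat.gcd_pos_of_pos_left _ two_pos
  · intro g h1 h2
    obtain ⟨c, hc⟩ := isConj_iff.1 h1
    obtain ⟨d, hd⟩ := isConj_iff.1 h2
    have h3 := SL2.tr_conj c (SL2.transv ((1, 0) : F × F))
    have h4 := SL2.tr_conj d (SL2.transv ((1, 0) : F × F))
    rw [hc, htr] at h3
    rw [hd, htr, SL2.tr_neg, h3] at h4
    have h5 : (2 : F) * 2 = 0 := by linear_combination -h4
    have h6 : (2 : F) = 0 := mul_self_eq_zero.1 h5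
    ext i j
    rw [SL2_neg_apply]
    linear_combination g i j * h6

/-- The class of a transvection; its centraliser in `PSL(2, F)` has order `q`. -/
theorem unipotent_class_mem_subdegrees [Finite F] (α : GPoints m PSL(2, F)) :
    ((Nat.card F ^ 2 - 1) / Nat.gcd 2 (Nat.card F - 1)) ^ m ∈
      subdegrees (GTW m PSL(2, F)) α := by
  rw [← card_conjClass_transv]
  refine card_conjClass_pow_mem_subdegrees _ ?_ α
  rw [Ne, toPSL2_eq_one_iff]
  rintro (h | h) <;> have := congrArg (fun g : SL(2, F) => g 0 1) h <;>
    simp [SL2.transv] at this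

end ClassSizes

/-! ### Borel subgroups -/

section Borel

variable {F : Type*} [Field F]

open scoped LinearAlgebra.Projectivization in
/-- The stabiliser of a point of the projective line. -/
theorem exists_borel (F : Type*) [Field F] [Finite F] :
    ∃ A : Subgroup SL(2, F), (∀ g, g ∈ A ↔ g 1 0 = 0) ∧ A.index = Nat.card F + 1 := by
  have hv : (![1, 0] : Fin 2 → F) ≠ 0 := fun h => one_ne_zero (congrFun h 0)
  refine ⟨MulAction.stabilizer SL(2, F) (Projectivization.mk F ![1, 0] hv), fun g => ?_, ?_⟩
  · rw [MulAction.mem_stabilizer_iff, Projectivization.smul_mk, Projectivization.mk_eq_mk_iff']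
    have h1 : (g • (![1, 0] : Fin 2 → F)) = ![g 0 0, g 1 0] := by
      change g.1.mulVec ![1, 0] = _
      ext i
      fin_cases i <;> simp [Matrix.mulVec, dotProduct]
    rw [h1]
    constructor
    · rintro ⟨a, ha⟩
      simpa using (congrFun ha 1).symm
    · intro h
      refine ⟨g 0 0, ?_⟩
      rw [h]
      simp
  · rw [MulAction.index_stabilizer_of_transitive, Projectivization.card_of_finrank_two]
    simp

variable {m : ℕ} [NeZero m]

/-- For the point stabiliser on the projective line, the two-point stabiliser is a torus, which is
the centraliser of a diagonal matrix `z` in the point stabiliser. If `-1` is a square, `z` can be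
chosen to commute modulo `±1` with an element that interchanges the two points. -/
theorem card_add_one_pow_mem_subdegrees [Finite F] (hq : 4 ≤ Nat.card F)
    (hm : 3 ≤ m ∨ (m = 2 ∧ (2 : F) ≠ 0 ∧ IsSquare (-1 : F))) (α : GPoints m PSL(2, F)) :
    (Nat.card F + 1) ^ m ∈ subdegrees (GTW m PSL(2, F)) α := by
  have := Fintype.ofFinite F
  obtain ⟨A, hA, hindex⟩ := exists_borel F
  rw [← hindex]
  obtain ⟨l, hl0, hl1, hlm⟩ : ∃ l : F, l ≠ 0 ∧ l ^ 2 ≠ 1 ∧ (3 ≤ m ∨ (m = 2 ∧ l ^ 2 = -1)) := by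
    rcases hm with hm | ⟨hm, h2, i, hi⟩
    · obtain ⟨l, hl⟩ := Polynomial.exists_eval_ne_zero_of_natDegree_lt_card
        (Polynomial.X ^ 3 - Polynomial.X : Polynomial F) (by
          intro h
          have := congrArg (Polynomial.coeff · 1) h
          simp [Polynomial.coeff_X, Polynomial.coeff_X_pow] at this) (by
          rw [← Nat.cast_card]
          refine Nat.cast_lt.2 (lt_of_le_of_lt (b := 3) ?_ (by omega))
          compute_degree)
      simp only [Polynomial.eval_sub, Polynomial.eval_pow, Polynomial.eval_X] at hl
      refine ⟨l, ?_, ?_, Or.inl hm⟩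
      · rintro rfl
        exact hl (by ring)
      · intro h
        exact hl (by linear_combination l * h)
    · refine ⟨i, ?_, ?_, Or.inr ⟨hm, by rw [hi, sq]⟩⟩
      · rintro rfl
        simp at hi
      · intro h
        apply h2
        linear_combination -hi - h
  have hll : l * l⁻¹ = 1 := mul_inv_cancel₀ hl0
  let z : SL(2, F) := SL2.of l 0 0 l⁻¹ (by rw [hll]; ring)
  let w : SL(2, F) := SL2.of 0 (-1) 1 0 (by ring)
  have hzne : ∀ e : F, e ^ 2 = 1 → z 0 0 ≠ e := by
    rintro e he h
    exact hl1 (by rw [← he, ← h]; rfl)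
  refine index_pow_mem_subdegrees_PSL2 A ?_ w z ?_ ?_ ?_ ?_ ?_ ?_ α
  · rw [hA, SL2_neg_apply]
    simp
  · intro h
    exact hzne 1 (by ring) (by rw [h]; simp)
  · intro h
    exact hzne (-1) (by ring) (by rw [h, SL2_neg_apply]; simp)
  · rw [hA]
    simp [w]
  · intro a ha
    rw [hA] at ha
    have hdet := SL2_det a
    rw [ha, mul_zero, sub_zero] at hdet
    have ha0 : a 0 0 ≠ 0 := left_ne_zero_of_mul (hdet.trans_ne one_ne_zero)
    obtain ⟨-, -, w10, w11⟩ := SL2_inv_apply w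
    have h1 : w⁻¹ * a * w ∈ A ↔ a 0 1 = 0 := by
      rw [hA]
      simp only [SL2_mul_apply, w10, w11]
      simp [w]
    rw [h1]
    constructor
    · intro h
      left
      apply SL2_ext <;> simp only [SL2_mul_apply, h, ha] <;> simp [z, mul_comm]
    · intro h
      have h01 : a 0 1 * (l - l⁻¹) = 0 := by
        rcases h with h | h
        · have h2 := congrArg (fun g : SL(2, F) => g 0 1) h
          simp only [SL2_mul_apply] at h2
          simp only [SL2.of_zero_one, mul_zero, SL2.of_one_one, zero_add, SL2.of_zero_zero,
            zero_mul, add_zero, z] at h2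
          linear_combination -h2
        · have h2 := congrArg (fun g : SL(2, F) => g 0 1) h
          have h3 := congrArg (fun g : SL(2, F) => g 0 0) h
          simp only [SL2_mul_apply, SL2_neg_apply] at h2 h3
          simp only [SL2.of_zero_one, mul_zero, SL2.of_one_one, zero_add, SL2.of_zero_zero,
            zero_mul, add_zero, SL2.of_one_zero, z] at h2 h3
          -- A sign can only occur in characteristic two.
          have h4 : (2 : F) = 0 := by
            have h5 : 2 * (a 0 0 * l) = 0 := by linear_combination h3
            exact (mul_eq_zero.1 h5).resolve_right (mul_ne_zero ha0 hl0)
          linear_combination h2 - a 0 1 * l⁻¹ * h4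
      refine (mul_eq_zero.1 h01).resolve_right fun h2 => hl1 ?_
      linear_combination l * h2 + hll
  · intro x hx
    rw [hA]
    have h := hx (SL2.of 1 1 0 1 (by ring)) ((hA _).2 rfl)
    obtain ⟨-, -, x10, x11⟩ := SL2_inv_apply x
    rw [hA] at h
    simp only [SL2_mul_apply, x10, x11] at h
    simp only [SL2.of_zero_one, SL2.of_one_one, SL2.of_zero_zero, SL2.of_one_zero] at h
    exact pow_eq_zero_iff two_ne_zero |>.1 (by linear_combination -h)
  · refine hlm.imp_right fun ⟨h1, h2⟩ => ⟨h1, Or.inr ?_, Or.inr ?_⟩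
    · apply SL2_ext <;> simp only [SL2_mul_apply, SL2_neg_apply] <;> simp [w]
    · have h3 : l⁻¹ = -l := by
        field_simp
        linear_combination h2
      apply SL2_ext <;> simp only [SL2_mul_apply, SL2_neg_apply] <;> simp [w, z, h3]

end Borel

/-! ### Centralisers in `SL(2, F)` -/

section Centralizers

variable {F : Type*} [Field F]

theorem SL2_scalar_of_diag {g : SL(2, F)} (h01 : g 0 1 = 0) (h10 : g 1 0 = 0)
    (h : g 0 0 = g 1 1) : SL2.tr g ^ 2 = 4 := by
  have := SL2_det g
  rw [SL2.tr, ← h]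
  rw [h01, h10, ← h] at this
  linear_combination 4 * this

/-- The matrices commuting with a nonscalar `2 × 2` matrix `g` are the polynomials in `g`. -/
theorem exists_eq_of_commute {g b : SL(2, F)} (hg : SL2.tr g ^ 2 ≠ 4) (h : g * b = b * g) :
    ∃ u v : F, b 0 0 = u + v * g 0 0 ∧ b 0 1 = v * g 0 1 ∧ b 1 0 = v * g 1 0 ∧
      b 1 1 = u + v * g 1 1 := by
  have h00 := congrArg (fun g : SL(2, F) => g 0 0) h
  have h01 := congrArg (fun g : SL(2, F) => g 0 1) h
  have h10 := congrArg (fun g : SL(2, F) => g 1 0) h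
  simp only [SL2_mul_apply] at h00 h01 h10
  by_cases g10 : g 1 0 = 0
  · by_cases g01 : g 0 1 = 0
    · have hd : g 0 0 - g 1 1 ≠ 0 := fun h =>
        hg (SL2_scalar_of_diag g01 g10 (sub_eq_zero.1 h))
      rw [g01] at h01
      rw [g10] at h10
      have b01 : b 0 1 = 0 := by
        refine (mul_eq_zero.1 ?_).resolve_right hd
        linear_combination h01
      have b10 : b 1 0 = 0 := by
        refine (mul_eq_zero.1 ?_).resolve_right hd
        linear_combination -h10
      refine ⟨b 0 0 - (b 0 0 - b 1 1) / (g 0 0 - g 1 1) * g 0 0,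
        (b 0 0 - b 1 1) / (g 0 0 - g 1 1), by ring, ?_, ?_, ?_⟩
      · rw [b01, g01, mul_zero]
      · rw [b10, g10, mul_zero]
      · field_simp
        ring
    · refine ⟨b 0 0 - b 0 1 / g 0 1 * g 0 0, b 0 1 / g 0 1, by ring, ?_, ?_, ?_⟩
      · field_simp
      · field_simp
        linear_combination h00
      · field_simp
        linear_combination h01
  · refine ⟨b 0 0 - b 1 0 / g 1 0 * g 0 0, b 1 0 / g 1 0, by ring, ?_, ?_, ?_⟩
    · field_simp
      linear_combination -h00
    · field_simp
    · field_simp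
      linear_combination -h10

theorem commute_of_commute_of_commute {g b c : SL(2, F)} (hg : SL2.tr g ^ 2 ≠ 4)
    (hb : g * b = b * g) (hc : g * c = c * g) : b * c = c * b := by
  obtain ⟨u, v, h1, h2, h3, h4⟩ := exists_eq_of_commute hg hb
  obtain ⟨u', v', h1', h2', h3', h4'⟩ := exists_eq_of_commute hg hc
  apply SL2_ext <;> simp only [SL2_mul_apply, h1, h2, h3, h4, h1', h2', h3', h4'] <;> ring

theorem eq_or_eq_inv_of_commute {g h : SL(2, F)} (hg : SL2.tr g ^ 2 ≠ 4) (hc : g * h = h * g)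
    (htr : SL2.tr h = SL2.tr g) : h = g ∨ h = g⁻¹ := by
  obtain ⟨u, v, h1, h2, h3, h4⟩ := exists_eq_of_commute hg hc
  obtain ⟨g00, g01, g10, g11⟩ := SL2_inv_apply g
  have dg := SL2_det g
  have dh := SL2_det h
  simp only [h1, h2, h3, h4] at dh
  have ht : 2 * u = (1 - v) * (g 0 0 + g 1 1) := by
    simp only [SL2.tr, h1, h4] at htr
    linear_combination htr
  have hv : (1 - v ^ 2) * (SL2.tr g ^ 2 - 4) = 0 := by
    rw [SL2.tr]
    linear_combination 4 * dh - 4 * v ^ 2 * dg -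
      (2 * u + (1 + v) * (g 0 0 + g 1 1)) * ht
  have hv2 : v ^ 2 = 1 := by
    have := (mul_eq_zero.1 hv).resolve_right (sub_ne_zero.2 hg)
    linear_combination -this
  have hv3 : (v - 1) * (v + 1) = 0 := by linear_combination hv2
  have h2of : ∀ x : F, 2 * x = 0 → x = 0 ∨ (2 : F) = 0 := fun x hx =>
    (mul_eq_zero.1 hx).symm
  rcases mul_eq_zero.1 hv3 with hv4 | hv4
  · obtain rfl : v = 1 := sub_eq_zero.1 hv4
    have hu : u * (u + (g 0 0 + g 1 1)) = 0 := by linear_combination dh - dg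
    rcases h2of u (by linear_combination ht) with h0 | h0
    · left
      apply SL2_ext <;> simp only [h1, h2, h3, h4, h0] <;> ring
    · rcases mul_eq_zero.1 hu with hu | hu
      · left
        apply SL2_ext <;> simp only [h1, h2, h3, h4, hu] <;> ring
      · right
        apply SL2_ext <;> simp only [h1, h2, h3, h4, g00, g01, g10, g11]
        · linear_combination hu - g 1 1 * h0
        · linear_combination g 0 1 * h0
        · linear_combination g 1 0 * h0
        · linear_combination hu - g 0 0 * h0
  · obtain rfl : v = -1 := eq_neg_of_add_eq_zero_left hv4
    have hu : u * (u - (g 0 0 + g 1 1)) = 0 := by linear_combination dh - dg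
    rcases mul_eq_zero.1 hu with hu | hu
    · rcases h2of (g 0 0 + g 1 1) (by linear_combination -ht + 2 * hu) with h0 | h0
      · right
        apply SL2_ext <;> simp only [h1, h2, h3, h4, g00, g01, g10, g11]
        · linear_combination hu - h0
        · ring
        · ring
        · linear_combination hu - h0
      · left
        apply SL2_ext <;> simp only [h1, h2, h3, h4, hu]
        · linear_combination -g 0 0 * h0
        · linear_combination -g 0 1 * h0
        · linear_combination -g 1 0 * h0
        · linear_combination -g 1 1 * h0
    · right
      apply SL2_ext <;> simp only [h1, h2, h3, h4, g00, g01, g10, g11]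
      · linear_combination hu
      · ring
      · ring
      · linear_combination hu

/-- An element of `SL(2, F)` that inverts a nonscalar element has trace zero. -/
theorem tr_eq_zero_of_inverts {g a : SL(2, F)} (hg : SL2.tr g ^ 2 ≠ 4) (h : a * g = g⁻¹ * a) :
    SL2.tr a = 0 := by
  obtain ⟨g00, g01, g10, g11⟩ := SL2_inv_apply g
  have h00 := congrArg (fun g : SL(2, F) => g 0 0) h
  have h01 := congrArg (fun g : SL(2, F) => g 0 1) h
  have h10 := congrArg (fun g : SL(2, F) => g 1 0) h
  have h11 := congrArg (fun g : SL(2, F) => g 1 1) h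
  simp only [SL2_mul_apply, g00, g01, g10, g11] at h00 h01 h10 h11
  rw [SL2.tr]
  by_cases k10 : g 1 0 = 0
  · by_cases k01 : g 0 1 = 0
    · have hd : g 0 0 - g 1 1 ≠ 0 := fun h =>
        hg (SL2_scalar_of_diag k01 k10 (sub_eq_zero.1 h))
      rw [k01, k10] at h00 h11
      have a00 : a 0 0 = 0 := by
        refine (mul_eq_zero.1 ?_).resolve_right hd
        linear_combination h00
      have a11 : a 1 1 = 0 := by
        refine (mul_eq_zero.1 ?_).resolve_right hd
        linear_combination -h11
      rw [a00, a11, add_zero]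
    · refine (mul_eq_zero.1 ?_).resolve_right k01
      linear_combination h01
  · refine (mul_eq_zero.1 ?_).resolve_right k10
    linear_combination h10

theorem mul_self_eq_neg_one_of_tr (a : SL(2, F)) (ha : SL2.tr a = 0) : a * a = -1 := by
  have := SL2_det a
  have h11 : a 1 1 = -a 0 0 := eq_neg_of_add_eq_zero_right ha
  rw [h11] at this
  apply SL2_ext <;> simp only [SL2_mul_apply, SL2_neg_apply, h11] <;> simp <;>
    first | ring1 | linear_combination -this

end Centralizers

/-! ### Normalisers of tori in characteristic two -/

section TorusNormalizer

variable {F : Type*} [Field F]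

/-- The elements of `SL(2, F)` that centralise or invert `g` under conjugation. -/
def torusNormalizer (g : SL(2, F)) : Subgroup SL(2, F) where
  carrier := {x | x * g * x⁻¹ = g ∨ x * g * x⁻¹ = g⁻¹}
  one_mem' := by simp
  mul_mem' := by
    intro x y hx hy
    have h : x * y * g * (x * y)⁻¹ = x * (y * g * y⁻¹) * x⁻¹ := by group
    have h' : x * g⁻¹ * x⁻¹ = (x * g * x⁻¹)⁻¹ := by group
    change x * y * g * (x * y)⁻¹ = g ∨ x * y * g * (x * y)⁻¹ = g⁻¹
    rw [h]
    rcases hx with hx | hx <;> rcases hy with hy | hy <;> rw [hy] <;> simp [h', hx]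
  inv_mem' := by
    intro x hx
    change x⁻¹ * g * x⁻¹⁻¹ = g ∨ x⁻¹ * g * x⁻¹⁻¹ = g⁻¹
    rcases hx with hx | hx
    · left
      nth_rw 1 [← hx]
      group
    · right
      have h : x * g⁻¹ * x⁻¹ = g := by simpa [mul_assoc] using congrArg (·⁻¹) hx
      nth_rw 1 [← h]
      group

theorem mem_torusNormalizer_iff (g x : SL(2, F)) :
    x ∈ torusNormalizer g ↔ g * x = x * g ∨ x * g = g⁻¹ * x := by
  change (x * g * x⁻¹ = g ∨ x * g * x⁻¹ = g⁻¹) ↔ _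
  rw [mul_inv_eq_iff_eq_mul, mul_inv_eq_iff_eq_mul, eq_comm]

theorem two_mul_index_torusNormalizer [Finite F] (g : SL(2, F)) (hg : SL2.tr g ^ 2 ≠ 4) :
    2 * (torusNormalizer g).index = Nat.card {h // IsConj g h} := by
  have hginv : g ≠ g⁻¹ := by
    intro h
    obtain ⟨g00, g01, g10, g11⟩ := SL2_inv_apply g
    have h00 := congrArg (fun g : SL(2, F) => g 0 0) h
    have h01 := congrArg (fun g : SL(2, F) => g 0 1) h
    have h10 := congrArg (fun g : SL(2, F) => g 1 0) h
    simp only [g00, g01, g10] at h00 h01 h10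
    have hdet := SL2_det g
    apply hg
    rw [SL2.tr]
    by_cases h2 : (2 : F) = 0
    · linear_combination (g 0 0 - g 1 1) * h00 + (2 * g 0 0 * g 1 1 - 2) * h2
    · have k01 : g 0 1 = 0 := (mul_eq_zero.1 (by linear_combination h01 :
        2 * g 0 1 = 0)).resolve_left h2
      rw [k01] at hdet
      linear_combination (g 0 0 - g 1 1) * h00 + 4 * hdet
  choose c hc using fun h : {h // IsConj g h} => isConj_iff.1 h.2
  have hmk : ∀ x : SL(2, F), IsConj g (x * g * x⁻¹) := fun x => isConj_iff.2 ⟨x, rfl⟩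
  let f : {h // IsConj g h} → SL(2, F) ⧸ torusNormalizer g := fun h => (c h : SL(2, F))
  have hf : ∀ (h : {h // IsConj g h}) (x : SL(2, F)),
      f h = (x : SL(2, F) ⧸ torusNormalizer g) ↔ h.1 = x * g * x⁻¹ ∨ h.1 = x * g⁻¹ * x⁻¹ := by
    intro h x
    rw [eq_comm, QuotientGroup.eq]
    change (x⁻¹ * c h * g * (x⁻¹ * c h)⁻¹ = g ∨ x⁻¹ * c h * g * (x⁻¹ * c h)⁻¹ = g⁻¹) ↔ _
    have h1 : x⁻¹ * c h * g * (x⁻¹ * c h)⁻¹ = x⁻¹ * (c h * g * (c h)⁻¹) * x := by group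
    rw [h1, hc, mul_assoc x⁻¹, inv_mul_eq_iff_eq_mul, inv_mul_eq_iff_eq_mul,
      eq_mul_inv_iff_mul_eq (b := x * g), eq_mul_inv_iff_mul_eq (b := x * g⁻¹)]
  symm
  refine Nat.card_eq_mul_of_fiber f 2 fun y => ?_
  induction y using QuotientGroup.induction_on with
  | H x =>
    have hinv : IsConj g (x * g⁻¹ * x⁻¹) :=
      ((isConj_iff_tr_eq _ _ hg).2 (SL2.tr_inv g)).trans (isConj_iff.2 ⟨x, rfl⟩)
    rw [Nat.card_eq_two_iff]
    refine ⟨⟨⟨x * g * x⁻¹, hmk x⟩, (hf _ _).2 (Or.inl rfl)⟩,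
      ⟨⟨x * g⁻¹ * x⁻¹, hinv⟩, (hf _ _).2 (Or.inr rfl)⟩, ?_, ?_⟩
    · intro h
      have h1 : x * g * x⁻¹ = x * g⁻¹ * x⁻¹ := congrArg (fun t => t.1.1) h
      exact hginv (mul_left_cancel (mul_right_cancel h1))
    · ext ⟨h, hh⟩
      simpa [Subtype.ext_iff] using (hf h x).1 hh

variable {m : ℕ} [NeZero m]

/-- In characteristic two, let `A` be the normaliser of a nonsplit torus, `a ∈ A` an involution and
`y ∉ A` another involution commuting with `a`. Then `A ∩ A ^ y = {1, a} = C_A(y)`. -/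
theorem torusNormalizer_index_pow_mem_subdegrees [Finite F] (h2 : (2 : F) = 0)
    (hq : 4 ≤ Nat.card F) (α : GPoints m PSL(2, F)) (hm : 2 ≤ m) :
    (Nat.card F * (Nat.card F - 1) / 2) ^ m ∈ subdegrees (GTW m PSL(2, F)) α := by
  have hchar : CharP F 2 := CharTwo.of_one_ne_zero_of_two_eq_zero one_ne_zero h2
  have hneg : ∀ x : F, -x = x := CharTwo.neg_eq
  have hnegSL : ∀ x : SL(2, F), -x = x := fun x => by
    ext i j
    rw [SL2_neg_apply, hneg]
  obtain ⟨τ, hτ, h⟩ := exists_nonsplit_tr_of_even h2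
  obtain ⟨g, rfl⟩ := exists_SL2_tr_eq τ
  have hg := ne_four_of_nonsplit (fun _ => hτ) h
  have hindex := two_mul_index_torusNormalizer g hg
  rw [card_conjClass_of_tr g hg, card_tr_eq, card_eigenvalues_of_nonsplit _ h, zero_mul,
    add_zero] at hindex
  rw [← hindex, Nat.mul_div_cancel_left _ two_pos]
  set A := torusNormalizer g with hA
  have sq_of_inverts : ∀ b : SL(2, F), b * g = g⁻¹ * b → SL2.tr b = 0 ∧ b * b = 1 := by
    intro b hb
    have h1 := tr_eq_zero_of_inverts hg hb
    exact ⟨h1, by rw [mul_self_eq_neg_one_of_tr b h1, hnegSL]⟩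
  have not_both : ∀ b : SL(2, F), g * b = b * g → SL2.tr b = 0 → b = 1 := by
    intro b hb hb0
    obtain ⟨u, v, h1, h2', h3, h4⟩ := exists_eq_of_commute hg hb
    have hv : v = 0 := by
      refine (mul_eq_zero.1 ?_).resolve_right hτ
      rw [SL2.tr] at hb0 ⊢
      linear_combination hb0 - h1 - h4 - u * h2
    have hdet := SL2_det b
    simp only [h1, h2', h3, h4, hv] at hdet
    have hu : (u - 1) ^ 2 = 0 := by linear_combination hdet + (1 - u) * h2
    have hu1 : u = 1 := sub_eq_zero.1 (pow_eq_zero_iff two_ne_zero |>.1 hu)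
    apply SL2_ext <;> simp [h1, h2', h3, h4, hv, hu1]
  -- An element that conjugates `g` into its own centraliser normalises the torus.
  have mem_of_conj : ∀ x : SL(2, F), g * (x⁻¹ * g * x) = x⁻¹ * g * x * g → x ∈ A := by
    intro x hx
    have h1 : SL2.tr (x⁻¹ * g * x) = SL2.tr g := by
      have := SL2.tr_conj x⁻¹ g
      rwa [inv_inv] at this
    rw [← inv_mem_iff, hA]
    change x⁻¹ * g * x⁻¹⁻¹ = g ∨ x⁻¹ * g * x⁻¹⁻¹ = g⁻¹
    rw [inv_inv]
    exact eq_or_eq_inv_of_commute hg hx h1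
  obtain ⟨a, ha⟩ := isConj_iff.1 ((isConj_iff_tr_eq g g⁻¹ hg).2 (SL2.tr_inv g))
  rw [mul_inv_eq_iff_eq_mul] at ha
  obtain ⟨htra, haa⟩ := sq_of_inverts a ha
  have haA : a ∈ A := (mem_torusNormalizer_iff g a).2 (Or.inr ha)
  have ha1 : a ≠ 1 := by
    rintro rfl
    have h1 := (sq_of_inverts g (by simpa using congrArg (· * g) ha)).1
    exact hτ h1
  have hag : ∀ b : SL(2, F), b * g = g⁻¹ * b → g * (a * b) = a * b * g := by
    intro b hb
    have h1 : g * a = a * g⁻¹ := by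
      rw [eq_mul_inv_iff_mul_eq, mul_assoc, ha, ← mul_assoc, mul_inv_cancel, one_mul]
    rw [← mul_assoc, h1, mul_assoc, ← hb, mul_assoc]
  have comm_a : ∀ b ∈ A, a * b = b * a → b = 1 ∨ b = a := by
    have main : ∀ b : SL(2, F), g * b = b * g → a * b = b * a → b = 1 := by
      intro b hb hab
      refine not_both b hb ?_
      obtain ⟨u, v, h1, -, -, h4⟩ := exists_eq_of_commute hg hb
      by_contra hne
      -- Otherwise `a` commutes with a generator of the torus.
      have hb4 : SL2.tr b ^ 2 ≠ 4 := fun h => hne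
        (pow_eq_zero_iff two_ne_zero |>.1 (by linear_combination h + 2 * h2))
      have h5 := commute_of_commute_of_commute hb4 hb.symm hab.symm
      have h6 : SL2.tr a = 0 := htra
      exact ha1 (not_both a h5 h6)
    intro b hb hab
    rcases (mem_torusNormalizer_iff g b).1 hb with h1 | h1
    · exact Or.inl (main b h1 hab)
    · right
      have h3 := main (a * b) (hag b h1) (by rw [mul_assoc a b a, ← hab])
      rw [← mul_left_cancel_iff (a := a), h3, haa]
  obtain ⟨t, ht0, ht1⟩ : ∃ t : F, t ≠ 0 ∧ t ≠ 1 := by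
    classical
    have := Fintype.ofFinite F
    obtain ⟨t, ht⟩ := Finset.exists_mem_notMem_of_card_lt_card
      (s := {0, 1}) (t := (Finset.univ : Finset F)) (lt_of_le_of_lt Finset.card_le_two (by
        rw [Finset.card_univ, ← Nat.card_eq_fintype_card]
        omega))
    simp only [Finset.mem_insert, Finset.mem_singleton, not_or] at ht
    exact ⟨t, ht.2⟩
  have hdeta := SL2_det a
  have htra' : a 0 0 + a 1 1 = 0 := htra
  let y : SL(2, F) := SL2.of (1 + t * (a 0 0 + 1)) (t * a 0 1) (t * a 1 0) (1 + t * (a 1 1 + 1))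
    (by linear_combination t ^ 2 * hdeta + (t + t ^ 2) * htra' + (t ^ 2 + t) * h2)
  have hyy : y * y = 1 := by
    have h1 : SL2.tr y = 0 := by
      simp only [SL2.tr, y, SL2.of_zero_zero, SL2.of_one_one]
      linear_combination t * htra' + (1 + t) * h2
    rw [mul_self_eq_neg_one_of_tr y h1, hnegSL]
  have hya : a * y = y * a := by
    apply SL2_ext <;> simp only [SL2_mul_apply, y, SL2.of_zero_zero, SL2.of_zero_one,
      SL2.of_one_zero, SL2.of_one_one] <;> ring
  have hyinv : y⁻¹ = y := inv_eq_of_mul_eq_one_left hyy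
  have haoff : a 0 1 ≠ 0 ∨ a 1 0 ≠ 0 := by
    by_contra hcon
    push Not at hcon
    apply ha1
    have h00 : (a 0 0 - 1) ^ 2 = 0 := by
      rw [hcon.1] at hdeta
      linear_combination -hdeta + a 0 0 * htra' - a 0 0 * h2
    have h00' : a 0 0 = 1 := sub_eq_zero.1 (pow_eq_zero_iff two_ne_zero |>.1 h00)
    have h11 : a 1 1 = 1 := by linear_combination htra' - h00' - h2
    apply SL2_ext <;> simp [hcon.1, hcon.2, h00', h11]
  have hyA : y ∉ A := by
    intro hyA
    have key : ∀ s : F, t ≠ s → ¬ (t * a 0 1 = s * a 0 1 ∧ t * a 1 0 = s * a 1 0) := by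
      rintro s hs ⟨h1, h2⟩
      rcases haoff with h3 | h3
      · exact hs (mul_right_cancel₀ h3 h1)
      · exact hs (mul_right_cancel₀ h3 h2)
    rcases comm_a y hyA hya with h1 | h1
    · refine key 0 ht0 ⟨?_, ?_⟩
      · simpa [y] using congrArg (fun g : SL(2, F) => g 0 1) h1
      · simpa [y] using congrArg (fun g : SL(2, F) => g 1 0) h1
    · refine key 1 ht1 ⟨?_, ?_⟩
      · simpa [y] using congrArg (fun g : SL(2, F) => g 0 1) h1
      · simpa [y] using congrArg (fun g : SL(2, F) => g 1 0) h1
  have hy1 : y ≠ 1 := fun h => hyA (h ▸ A.one_mem)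
  -- The intersection of `A` and its conjugate by `y` is centralised by `y`.
  have hcomm : ∀ b ∈ A, y⁻¹ * b * y ∈ A → b * y = y * b := by
    have main : ∀ b : SL(2, F), g * b = b * g → y⁻¹ * b * y ∈ A → b * y = y * b := by
      intro b hb hyb
      by_cases hb0 : SL2.tr b = 0
      · rw [not_both b hb hb0, one_mul, mul_one]
      have htr : SL2.tr (y⁻¹ * b * y) = SL2.tr b := by
        have := SL2.tr_conj y⁻¹ b
        rwa [inv_inv] at this
      rcases (mem_torusNormalizer_iff g _).1 hyb with h1 | h1
      · exfalso
        have hb4 : SL2.tr b ^ 2 ≠ 4 := fun h => hb0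
          (pow_eq_zero_iff two_ne_zero |>.1 (by linear_combination h + 2 * h2))
        -- `g` commutes with `b ^ y`, so `b` commutes with `g ^ y`, as does `g`.
        have h3 : b * (y⁻¹ * g * y) = y⁻¹ * g * y * b := by
          have h4 := congrArg (fun x => y * x * y⁻¹) h1
          simp only [hyinv] at h4 ⊢
          calc b * (y * g * y) = y * (y * b * y * g) * y := by
                simp only [← mul_assoc]
                rw [hyy, one_mul]
            _ = y * g * y * b := by
                rw [← h4]
                simp only [mul_assoc]
                rw [hyy, mul_one]
        exact hyA (mem_of_conj y (commute_of_commute_of_commute hb4 hb.symm h3))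
      · exact absurd (htr.symm.trans (sq_of_inverts _ h1).1) hb0
    intro b hb hyb
    rcases (mem_torusNormalizer_iff g b).1 hb with h1 | h1
    · exact main b h1 hyb
    · have h3 := main (a * b) (hag b h1) (by
        have h4 : y⁻¹ * (a * b) * y = a * (y⁻¹ * b * y) := by
          rw [hyinv, ← mul_assoc, ← hya, mul_assoc, mul_assoc, mul_assoc]
        rw [h4]
        exact A.mul_mem haA hyb)
      have h5 : a * (b * y) = a * (y * b) := by
        rw [← mul_assoc, h3, ← mul_assoc, ← mul_assoc, hya]
      exact mul_left_cancel h5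
  refine index_pow_mem_subdegrees_PSL2 A ?_ y y hy1 ?_ hyA ?_ ?_ ?_ α
  · rw [hnegSL]
    exact A.one_mem
  · rwa [hnegSL]
  · intro b hb
    constructor
    · exact fun h => Or.inl (hcomm b hb h)
    · intro h1
      have h3 : b * y = y * b := by rwa [hnegSL, or_self_iff] at h1
      rw [mul_assoc, h3, inv_mul_cancel_left]
      exact hb
  · intro x hx
    have h1 := hx g ((mem_torusNormalizer_iff g g).2 (Or.inl rfl))
    rcases (mem_torusNormalizer_iff g _).1 h1 with h3 | h3
    · exact mem_of_conj x h3
    · exfalso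
      have h4 := (sq_of_inverts _ h3).1
      have := SL2.tr_conj x⁻¹ g
      rw [inv_inv] at this
      exact hτ (this.symm.trans h4)
  · rcases hm.lt_or_eq with h | h
    · exact Or.inl h
    · exact Or.inr ⟨h.symm, Or.inl hyy, Or.inl rfl⟩

end TorusNormalizer

/-! ### Unit quaternions -/

section UnitQuaternions

/-- The quaternions `w + x i + y j + z k` of norm one over a field. They form a group, isomorphic
to `SL(2, F)` over a finite field of odd characteristic. -/
@[ext]
structure UnitQuat (F : Type*) [Field F] where
  /-- The coefficient of `1`. -/
  w : F
  /-- The coefficient of `i`. -/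
  x : F
  /-- The coefficient of `j`. -/
  y : F
  /-- The coefficient of `k`. -/
  z : F
  norm_eq : w ^ 2 + x ^ 2 + y ^ 2 + z ^ 2 = 1

namespace UnitQuat

variable {F : Type*} [Field F]

instance : Mul (UnitQuat F) where
  mul p q := ⟨p.w * q.w - p.x * q.x - p.y * q.y - p.z * q.z,
    p.w * q.x + p.x * q.w + p.y * q.z - p.z * q.y,
    p.w * q.y - p.x * q.z + p.y * q.w + p.z * q.x,
    p.w * q.z + p.x * q.y - p.y * q.x + p.z * q.w, by
    linear_combination (q.w ^ 2 + q.x ^ 2 + q.y ^ 2 + q.z ^ 2) * p.norm_eq + q.norm_eq⟩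

instance : One (UnitQuat F) := ⟨⟨1, 0, 0, 0, by ring⟩⟩

instance : Inv (UnitQuat F) := ⟨fun p => ⟨p.w, -p.x, -p.y, -p.z, by
  linear_combination p.norm_eq⟩⟩

instance : Neg (UnitQuat F) := ⟨fun p => ⟨-p.w, -p.x, -p.y, -p.z, by
  linear_combination p.norm_eq⟩⟩

@[simp] theorem mul_w (p q : UnitQuat F) :
    (p * q).w = p.w * q.w - p.x * q.x - p.y * q.y - p.z * q.z := rfl
@[simp] theorem mul_x (p q : UnitQuat F) :
    (p * q).x = p.w * q.x + p.x * q.w + p.y * q.z - p.z * q.y := rfl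
@[simp] theorem mul_y (p q : UnitQuat F) :
    (p * q).y = p.w * q.y - p.x * q.z + p.y * q.w + p.z * q.x := rfl
@[simp] theorem mul_z (p q : UnitQuat F) :
    (p * q).z = p.w * q.z + p.x * q.y - p.y * q.x + p.z * q.w := rfl
@[simp] theorem one_w : (1 : UnitQuat F).w = 1 := rfl
@[simp] theorem one_x : (1 : UnitQuat F).x = 0 := rfl
@[simp] theorem one_y : (1 : UnitQuat F).y = 0 := rfl
@[simp] theorem one_z : (1 : UnitQuat F).z = 0 := rfl
@[simp] theorem inv_w (p : UnitQuat F) : p⁻¹.w = p.w := rfl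
@[simp] theorem inv_x (p : UnitQuat F) : p⁻¹.x = -p.x := rfl
@[simp] theorem inv_y (p : UnitQuat F) : p⁻¹.y = -p.y := rfl
@[simp] theorem inv_z (p : UnitQuat F) : p⁻¹.z = -p.z := rfl
@[simp] theorem neg_w (p : UnitQuat F) : (-p).w = -p.w := rfl
@[simp] theorem neg_x (p : UnitQuat F) : (-p).x = -p.x := rfl
@[simp] theorem neg_y (p : UnitQuat F) : (-p).y = -p.y := rfl
@[simp] theorem neg_z (p : UnitQuat F) : (-p).z = -p.z := rfl

instance : Group (UnitQuat F) := Group.ofLeftAxioms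
  (fun p q r => by ext <;> simp <;> ring)
  (fun p => by ext <;> simp)
  (fun p => by
    ext <;> simp
    · linear_combination p.norm_eq
    · ring
    · ring
    · ring)

instance : HasDistribNeg (UnitQuat F) where
  neg_neg p := by ext <;> simp
  neg_mul p q := by ext <;> simp <;> ring
  mul_neg p q := by ext <;> simp <;> ring

/-- The matrix of a quaternion for a solution of `a ^ 2 + b ^ 2 = -1`: the units `i`, `j` are
`!![a, b; b, -a]` and `!![0, 1; -1, 0]`. -/
def toSL2 (a b : F) (hab : a ^ 2 + b ^ 2 = -1) : UnitQuat F →* SL(2, F) where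
  toFun p := SL2.of (p.w + p.x * a - p.z * b) (p.x * b + p.y + p.z * a) (p.x * b - p.y + p.z * a)
    (p.w - p.x * a + p.z * b) (by
      linear_combination p.norm_eq - (p.x ^ 2 + p.z ^ 2) * hab)
  map_one' := by apply SL2_ext <;> simp
  map_mul' p q := by
    apply SL2_ext <;> simp only [SL2_mul_apply, SL2.of_zero_zero, SL2.of_zero_one,
      SL2.of_one_zero, SL2.of_one_one, mul_w, mul_x, mul_y, mul_z]
    · linear_combination (-p.x * q.x - p.z * q.z) * hab
    · linear_combination (p.z * q.x - p.x * q.z) * hab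
    · linear_combination (p.x * q.z - p.z * q.x) * hab
    · linear_combination (-p.x * q.x - p.z * q.z) * hab

theorem toSL2_bijective (h2 : (2 : F) ≠ 0) (a b : F) (hab : a ^ 2 + b ^ 2 = -1) :
    Function.Bijective (toSL2 a b hab) := by
  constructor
  · intro p q h
    have h00 : p.w + p.x * a - p.z * b = q.w + q.x * a - q.z * b :=
      congrArg (fun g : SL(2, F) => g 0 0) h
    have h01 : p.x * b + p.y + p.z * a = q.x * b + q.y + q.z * a :=
      congrArg (fun g : SL(2, F) => g 0 1) h
    have h10 : p.x * b - p.y + p.z * a = q.x * b - q.y + q.z * a :=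
      congrArg (fun g : SL(2, F) => g 1 0) h
    have h11 : p.w - p.x * a + p.z * b = q.w - q.x * a + q.z * b :=
      congrArg (fun g : SL(2, F) => g 1 1) h
    ext <;> apply mul_left_cancel₀ h2
    · linear_combination h00 + h11
    · linear_combination -a * (h00 - h11) - b * (h01 + h10) + 2 * (p.x - q.x) * hab
    · linear_combination h01 - h10
    · linear_combination b * (h00 - h11) - a * (h01 + h10) + 2 * (p.z - q.z) * hab
  · intro g
    have hdet := SL2_det g
    refine ⟨⟨(g 0 0 + g 1 1) / 2, -(a * (g 0 0 - g 1 1) + b * (g 0 1 + g 1 0)) / 2,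
      (g 0 1 - g 1 0) / 2, (b * (g 0 0 - g 1 1) - a * (g 0 1 + g 1 0)) / 2, ?_⟩, ?_⟩
    · field_simp
      linear_combination 4 * hdet + ((g 0 0 - g 1 1) ^ 2 + (g 0 1 + g 1 0) ^ 2) * hab
    · apply SL2_ext <;> simp [toSL2] <;> field_simp
      · linear_combination -(g 0 0 - g 1 1) * hab
      · linear_combination -(g 0 1 + g 1 0) * hab
      · linear_combination -(g 0 1 + g 1 0) * hab
      · linear_combination (g 0 0 - g 1 1) * hab

theorem toSL2_neg (a b : F) (hab : a ^ 2 + b ^ 2 = -1) (p : UnitQuat F) :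
    toSL2 a b hab (-p) = -toSL2 a b hab p := by
  apply SL2_ext <;> rw [SL2_neg_apply] <;> simp [toSL2] <;> ring

/-- As `-1` is a sum of two squares, the quaternion algebra is split. -/
theorem exists_mulEquiv_SL2 (F : Type*) [Field F] [Finite F] (h2 : (2 : F) ≠ 0) :
    ∃ e : UnitQuat F ≃* SL(2, F), ∀ p, e (-p) = -e p := by
  obtain ⟨a, b, hab⟩ : ∃ a b : F, a ^ 2 + b ^ 2 = -1 := by
    obtain ⟨a, b, hab⟩ := exists_binary_form_eq (1 : F) 0 1 (-1) (by
      intro h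
      have h4 : (2 : F) * 2 = 0 := by linear_combination -h
      simp [h2] at h4)
    exact ⟨a, b, by linear_combination hab⟩
  exact ⟨MulEquiv.ofBijective (toSL2 a b hab) (toSL2_bijective h2 a b hab), toSL2_neg a b hab⟩

/-- The unit quaternions form a double cover of `PSL(2, F)` in odd characteristic. -/
theorem exists_cover_PSL2 (F : Type*) [Field F] [Finite F] (h2 : (2 : F) ≠ 0) :
    ∃ π : UnitQuat F →* PSL(2, F), Function.Surjective π ∧
      ∀ p q, π p = π q ↔ p = q ∨ p = -q := by
  obtain ⟨e, he⟩ := exists_mulEquiv_SL2 F h2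
  refine ⟨toPSL2.comp e.toMonoidHom, toPSL2_surjective.comp e.surjective, fun p q => ?_⟩
  change toPSL2 (e p) = toPSL2 (e q) ↔ _
  rw [toPSL2_eq_iff, ← he, e.injective.eq_iff, e.injective.eq_iff]

theorem card_SL2_eq_two_mul [Finite F] (h2 : (2 : F) ≠ 0) :
    Nat.card SL(2, F) = 2 * Nat.card PSL(2, F) := by
  refine Nat.card_eq_mul_of_fiber toPSL2 2 fun y => ?_
  obtain ⟨g, rfl⟩ := toPSL2_surjective y
  rw [Nat.card_eq_two_iff]
  refine ⟨⟨g, rfl⟩, ⟨-g, (toPSL2_eq_iff _ _).2 (Or.inr rfl)⟩, ?_, ?_⟩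
  · intro h
    exact SL2_ne_neg h2 g (congrArg Subtype.val h)
  · ext ⟨h, hh⟩
    simpa [Subtype.ext_iff] using (toPSL2_eq_iff h g).1 hh

theorem index_eq_card_div [Finite F] (h2 : (2 : F) ≠ 0) (A : Subgroup (UnitQuat F)) (n : ℕ)
    (hA : Nat.card A = 2 * n) (hn : n ≠ 0) : A.index = Nat.card PSL(2, F) / n := by
  obtain ⟨e, -⟩ := exists_mulEquiv_SL2 F h2
  have h := A.card_mul_index
  rw [Nat.card_congr e.toEquiv, hA, card_SL2_eq_two_mul h2, mul_assoc] at h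
  have h' := Nat.eq_of_mul_eq_mul_left two_pos h
  rw [← h', Nat.mul_div_cancel_left _ (Nat.pos_of_ne_zero hn)]

end UnitQuat

end UnitQuaternions

/-! ### The binary octahedral group -/

section Octahedral

/-- The orbit-stabiliser theorem for the action of a subgroup by conjugation. -/
theorem card_eq_card_centralizer_mul {U : Type*} [Group U] [Finite U] (A : Subgroup U) (X : Set U)
    (g : U) (hX : ∀ u ∈ A, u * g * u⁻¹ ∈ X) (htrans : ∀ x ∈ X, ∃ u ∈ A, u * g * u⁻¹ = x) :
    Nat.card A = Nat.card (A ⊓ Subgroup.centralizer {g} : Subgroup U) * Nat.card X := by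
  refine Nat.card_eq_mul_of_fiber (fun u : A => (⟨u * g * (u : U)⁻¹, hX u u.2⟩ : X)) _ ?_
  rintro ⟨x, hx⟩
  obtain ⟨c, hc, rfl⟩ := htrans x hx
  refine Nat.card_congr ⟨fun u => ⟨c⁻¹ * u.1.1, A.mul_mem (A.inv_mem hc) u.1.2, ?_⟩,
    fun u => ⟨⟨c * u.1, A.mul_mem hc u.2.1⟩, ?_⟩, fun u => ?_, fun u => ?_⟩
  · have h : u.1.1 * g * (u.1.1)⁻¹ = c * g * c⁻¹ := congrArg Subtype.val u.2
    refine Subgroup.mem_centralizer_singleton_iff.2 ?_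
    rw [mul_inv_eq_iff_eq_mul] at h
    rw [mul_assoc, h]
    group
  · have h := Subgroup.mem_centralizer_singleton_iff.1 u.2.2
    refine Subtype.ext ?_
    change c * u.1 * g * (c * u.1)⁻¹ = c * g * c⁻¹
    rw [mul_assoc c, h]
    group
  · simp
  · simp

namespace UnitQuat

variable {F : Type*} [Field F]

instance [Finite F] : Finite (UnitQuat F) :=
  Finite.of_injective (fun p => (p.w, p.x, p.y, p.z)) fun p q h => by
    simp only [Prod.mk.injEq] at h
    exact UnitQuat.ext h.1 h.2.1 h.2.2.1 h.2.2.2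

/-- The quaternion `i`. -/
def qi : UnitQuat F := ⟨0, 1, 0, 0, by ring⟩
/-- The quaternion `j`. -/
def qj : UnitQuat F := ⟨0, 0, 1, 0, by ring⟩
/-- The quaternion `k`. -/
def qk : UnitQuat F := ⟨0, 0, 0, 1, by ring⟩

/-- The quaternion `(1 + i + j + k) / 2`, which permutes `i`, `j`, `k` cyclically. -/
def omega (h2 : (2 : F) ≠ 0) : UnitQuat F := ⟨2⁻¹, 2⁻¹, 2⁻¹, 2⁻¹, by field_simp; norm_num⟩

@[simp] theorem qi_w : (qi : UnitQuat F).w = 0 := rfl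
@[simp] theorem qi_x : (qi : UnitQuat F).x = 1 := rfl
@[simp] theorem qi_y : (qi : UnitQuat F).y = 0 := rfl
@[simp] theorem qi_z : (qi : UnitQuat F).z = 0 := rfl
@[simp] theorem qj_w : (qj : UnitQuat F).w = 0 := rfl
@[simp] theorem qj_x : (qj : UnitQuat F).x = 0 := rfl
@[simp] theorem qj_y : (qj : UnitQuat F).y = 1 := rfl
@[simp] theorem qj_z : (qj : UnitQuat F).z = 0 := rfl
@[simp] theorem qk_w : (qk : UnitQuat F).w = 0 := rfl
@[simp] theorem qk_x : (qk : UnitQuat F).x = 0 := rfl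
@[simp] theorem qk_y : (qk : UnitQuat F).y = 0 := rfl
@[simp] theorem qk_z : (qk : UnitQuat F).z = 1 := rfl
@[simp] theorem omega_w (h2 : (2 : F) ≠ 0) : (omega h2).w = 2⁻¹ := rfl
@[simp] theorem omega_x (h2 : (2 : F) ≠ 0) : (omega h2).x = 2⁻¹ := rfl
@[simp] theorem omega_y (h2 : (2 : F) ≠ 0) : (omega h2).y = 2⁻¹ := rfl
@[simp] theorem omega_z (h2 : (2 : F) ≠ 0) : (omega h2).z = 2⁻¹ := rfl

/-- The vertices `±i, ±j, ±k` of an octahedron. -/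
def octahedron (F : Type*) [Field F] : Set (UnitQuat F) := {qi, -qi, qj, -qj, qk, -qk}

theorem card_octahedron (h2 : (2 : F) ≠ 0) : Nat.card (octahedron F) = 6 := by
  have h1 : (1 : F) ≠ -1 := fun h => h2 (by linear_combination h)
  rw [Nat.card_coe_set_eq, octahedron, Set.ncard_insert_of_notMem, Set.ncard_insert_of_notMem,
    Set.ncard_insert_of_notMem, Set.ncard_insert_of_notMem, Set.ncard_pair] <;>
  simp [UnitQuat.ext_iff, h1]

theorem mem_octahedron {p : UnitQuat F} :
    p ∈ octahedron F ↔ p = qi ∨ p = -qi ∨ p = qj ∨ p = -qj ∨ p = qk ∨ p = -qk := Iff.rfl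

theorem neg_mem_octahedron {p : UnitQuat F} (hp : p ∈ octahedron F) : -p ∈ octahedron F := by
  rw [mem_octahedron] at *
  rcases hp with rfl | rfl | rfl | rfl | rfl | rfl <;> simp

/-- The binary octahedral group: the stabiliser of an octahedron. -/
def octahedralGroup (F : Type*) [Field F] : Subgroup (UnitQuat F) :=
  Subgroup.normalizer (octahedron F)

theorem mem_octahedralGroup [Finite F] {u : UnitQuat F} (hi : u * qi * u⁻¹ ∈ octahedron F)
    (hj : u * qj * u⁻¹ ∈ octahedron F) (hk : u * qk * u⁻¹ ∈ octahedron F) :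
    u ∈ octahedralGroup F := by
  refine Subgroup.mem_normalizer_fintype fun p hp => ?_
  have hneg : ∀ q : UnitQuat F, u * -q * u⁻¹ = -(u * q * u⁻¹) := fun q => by
    rw [mul_neg, neg_mul]
  rcases hp with rfl | rfl | rfl | rfl | rfl | rfl
  · exact hi
  · rw [hneg]; exact neg_mem_octahedron hi
  · exact hj
  · rw [hneg]; exact neg_mem_octahedron hj
  · exact hk
  · rw [hneg]; exact neg_mem_octahedron hk

theorem conj_mem_octahedron {u p : UnitQuat F} (hu : u ∈ octahedralGroup F)
    (hp : p ∈ octahedron F) : u * p * u⁻¹ ∈ octahedron F :=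
  (Subgroup.mem_set_normalizer_iff.1 hu p).1 hp

theorem qi_mem : (qi : UnitQuat F) ∈ octahedron F := Or.inl rfl
theorem qj_mem : (qj : UnitQuat F) ∈ octahedron F := by simp [mem_octahedron]
theorem qk_mem : (qk : UnitQuat F) ∈ octahedron F := by simp [mem_octahedron]

theorem conj_qi : (qi : UnitQuat F) * qi * qi⁻¹ = qi ∧ (qi : UnitQuat F) * qj * qi⁻¹ = -qj ∧
    (qi : UnitQuat F) * qk * qi⁻¹ = -qk := by
  refine ⟨?_, ?_, ?_⟩ <;> ext <;> simp

theorem conj_qj : (qj : UnitQuat F) * qi * qj⁻¹ = -qi ∧ (qj : UnitQuat F) * qj * qj⁻¹ = qj ∧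
    (qj : UnitQuat F) * qk * qj⁻¹ = -qk := by
  refine ⟨?_, ?_, ?_⟩ <;> ext <;> simp

theorem conj_omega (h2 : (2 : F) ≠ 0) : omega h2 * qi * (omega h2)⁻¹ = qj ∧
    omega h2 * qj * (omega h2)⁻¹ = qk ∧ omega h2 * qk * (omega h2)⁻¹ = qi := by
  refine ⟨?_, ?_, ?_⟩ <;> rw [mul_inv_eq_iff_eq_mul] <;> ext <;> simp

theorem qi_mem_octahedralGroup [Finite F] : (qi : UnitQuat F) ∈ octahedralGroup F := by
  obtain ⟨h1, h2, h3⟩ := conj_qi (F := F)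
  refine mem_octahedralGroup ?_ ?_ ?_
  · rw [h1]; exact qi_mem
  · rw [h2]; exact neg_mem_octahedron qj_mem
  · rw [h3]; exact neg_mem_octahedron qk_mem

theorem qj_mem_octahedralGroup [Finite F] : (qj : UnitQuat F) ∈ octahedralGroup F := by
  obtain ⟨h1, h2, h3⟩ := conj_qj (F := F)
  refine mem_octahedralGroup ?_ ?_ ?_
  · rw [h1]; exact neg_mem_octahedron qi_mem
  · rw [h2]; exact qj_mem
  · rw [h3]; exact neg_mem_octahedron qk_mem

theorem omega_mem_octahedralGroup [Finite F] (h2 : (2 : F) ≠ 0) :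
    omega h2 ∈ octahedralGroup F := by
  obtain ⟨h3, h4, h5⟩ := conj_omega h2
  refine mem_octahedralGroup ?_ ?_ ?_
  · rw [h3]; exact qj_mem
  · rw [h4]; exact qk_mem
  · rw [h5]; exact qi_mem

theorem conj_mul (u v p : UnitQuat F) : u * v * p * (u * v)⁻¹ = u * (v * p * v⁻¹) * u⁻¹ := by
  group

theorem commute_qi_iff (h2 : (2 : F) ≠ 0) (u : UnitQuat F) :
    u * qi = qi * u ↔ u.y = 0 ∧ u.z = 0 := by
  constructor
  · intro h
    have hy := congrArg UnitQuat.y h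
    have hz := congrArg UnitQuat.z h
    simp only [mul_y, mul_z, qi_w, qi_x, qi_y, qi_z] at hy hz
    constructor <;> apply mul_left_cancel₀ h2
    · linear_combination -hz
    · linear_combination hy
  · rintro ⟨hy, hz⟩
    ext <;> simp [hy, hz]

theorem commute_qj_iff (h2 : (2 : F) ≠ 0) (u : UnitQuat F) :
    u * qj = qj * u ↔ u.x = 0 ∧ u.z = 0 := by
  constructor
  · intro h
    have hx := congrArg UnitQuat.x h
    have hz := congrArg UnitQuat.z h
    simp only [mul_x, mul_z, qj_w, qj_x, qj_y, qj_z] at hx hz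
    constructor <;> apply mul_left_cancel₀ h2
    · linear_combination hz
    · linear_combination -hx
  · rintro ⟨hx, hz⟩
    ext <;> simp [hx, hz]

theorem commute_qk_iff (h2 : (2 : F) ≠ 0) (u : UnitQuat F) :
    u * qk = qk * u ↔ u.x = 0 ∧ u.y = 0 := by
  constructor
  · intro h
    have hx := congrArg UnitQuat.x h
    have hy := congrArg UnitQuat.y h
    simp only [mul_x, mul_y, qk_w, qk_x, qk_y, qk_z] at hx hy
    constructor <;> apply mul_left_cancel₀ h2
    · linear_combination -hy
    · linear_combination hx
  · rintro ⟨hx, hy⟩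
    ext <;> simp [hx, hy]

theorem one_ne_neg_one (h2 : (2 : F) ≠ 0) : (1 : UnitQuat F) ≠ -1 := fun h => h2 (by
  have := congrArg UnitQuat.w h
  simp only [one_w, neg_w] at this
  linear_combination this)

theorem eq_one_or_neg_one {u : UnitQuat F} (hx : u.x = 0) (hy : u.y = 0) (hz : u.z = 0) :
    u = 1 ∨ u = -1 := by
  have hn := u.norm_eq
  rw [hx, hy, hz] at hn
  have hw : u.w ^ 2 = 1 := by linear_combination hn
  rcases sq_eq_one_iff.1 hw with hw | hw
  · left; ext <;> simp [hx, hy, hz, hw]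
  · right; ext <;> simp [hx, hy, hz, hw]

theorem card_eq_two_of_scalars (h2 : (2 : F) ≠ 0) (A : Subgroup (UnitQuat F)) (hA : -1 ∈ A)
    (h : ∀ u ∈ A, u = 1 ∨ u = -1) : Nat.card A = 2 := by
  rw [Nat.card_eq_two_iff]
  refine ⟨1, ⟨-1, hA⟩, fun h3 => one_ne_neg_one h2 (congrArg Subtype.val h3), ?_⟩
  ext ⟨u, hu⟩
  simpa [Subtype.ext_iff] using h u hu

theorem neg_one_mem_normalizer (X : Set (UnitQuat F)) : -1 ∈ Subgroup.normalizer X := by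
  rw [Subgroup.mem_set_normalizer_iff]
  intro p
  have h : -1 * p * (-1 : UnitQuat F)⁻¹ = p := by
    rw [mul_inv_eq_iff_eq_mul]
    simp
  rw [h]

theorem neg_one_mem_centralizer (p : UnitQuat F) : -1 ∈ Subgroup.centralizer {p} := by
  rw [Subgroup.mem_centralizer_singleton_iff]
  simp

/-- The binary octahedral group is transitive on the six vertices, the stabiliser of `i` is transitive
on the four vertices that remain besides `-i`, and only `± 1` fixes both `i` and `j`. -/
theorem card_octahedralGroup [Finite F] (h2 : (2 : F) ≠ 0) (s : F) (hs : 2 * s ^ 2 = 1) :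
    Nat.card (octahedralGroup F) = 2 * 24 := by
  have h1 : (1 : F) ≠ -1 := fun h => h2 (by linear_combination h)
  obtain ⟨o1, o2, o3⟩ := conj_omega h2
  obtain ⟨i1, i2, i3⟩ := conj_qi (F := F)
  obtain ⟨j1, j2, j3⟩ := conj_qj (F := F)
  have hi := qi_mem_octahedralGroup (F := F)
  have hj := qj_mem_octahedralGroup (F := F)
  have ho := omega_mem_octahedralGroup h2
  let r : UnitQuat F := ⟨s, s, 0, 0, by linear_combination hs⟩
  have r1 : r * qi * r⁻¹ = qi := by rw [mul_inv_eq_iff_eq_mul]; ext <;> simp [r]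
  have r2 : r * qj * r⁻¹ = qk := by rw [mul_inv_eq_iff_eq_mul]; ext <;> simp [r]
  have r3 : r * qk * r⁻¹ = -qj := by rw [mul_inv_eq_iff_eq_mul]; ext <;> simp [r]
  have hr : r ∈ octahedralGroup F := mem_octahedralGroup (by rw [r1]; exact qi_mem)
    (by rw [r2]; exact qk_mem) (by rw [r3]; exact neg_mem_octahedron qj_mem)
  rw [card_eq_card_centralizer_mul (octahedralGroup F) (octahedron F) qi
    (fun u hu => conj_mem_octahedron hu qi_mem), card_octahedron h2,
    card_eq_card_centralizer_mul _ {qj, -qj, qk, -qk} qj]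
  · have h4 : Nat.card ({qj, -qj, qk, -qk} : Set (UnitQuat F)) = 4 := by
      rw [Nat.card_coe_set_eq, Set.ncard_insert_of_notMem, Set.ncard_insert_of_notMem,
        Set.ncard_pair] <;>
      simp [UnitQuat.ext_iff, h1]
    rw [h4, card_eq_two_of_scalars h2]
    · exact ⟨⟨neg_one_mem_normalizer _, neg_one_mem_centralizer _⟩, neg_one_mem_centralizer _⟩
    · rintro u ⟨⟨-, hui⟩, huj⟩
      obtain ⟨hy, hz⟩ := (commute_qi_iff h2 u).1 (Subgroup.mem_centralizer_singleton_iff.1 hui)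
      obtain ⟨hx, -⟩ := (commute_qj_iff h2 u).1 (Subgroup.mem_centralizer_singleton_iff.1 huj)
      exact eq_one_or_neg_one hx hy hz
  · rintro u ⟨hu, hui⟩
    replace hui := Subgroup.mem_centralizer_singleton_iff.1 hui
    have hne : ∀ p : UnitQuat F, u * p = p * u → u * qj * u⁻¹ = p → qj = p := by
      intro p hp h
      rw [mul_inv_eq_iff_eq_mul, ← hp] at h
      exact mul_left_cancel h
    rcases conj_mem_octahedron hu qj_mem with h | h | h | h | h | h
    · have := congrArg UnitQuat.x (hne _ hui h)
      simp at this
    · have := congrArg UnitQuat.x (hne _ (by rw [mul_neg, neg_mul, hui]) h)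
      simp at this
    all_goals simp [h]
  · rintro x (rfl | rfl | rfl | rfl)
    · exact ⟨1, Subgroup.one_mem _, by simp⟩
    · exact ⟨qi, ⟨hi, Subgroup.mem_centralizer_singleton_iff.2 rfl⟩, i2⟩
    · exact ⟨r, ⟨hr, Subgroup.mem_centralizer_singleton_iff.2 (mul_inv_eq_iff_eq_mul.1 r1)⟩, r2⟩
    · refine ⟨qi * r, ⟨Subgroup.mul_mem _ hi hr, Subgroup.mul_mem _
        (Subgroup.mem_centralizer_singleton_iff.2 rfl)
        (Subgroup.mem_centralizer_singleton_iff.2 (mul_inv_eq_iff_eq_mul.1 r1))⟩, ?_⟩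
      rw [conj_mul, r2, i3]
  · rintro x (rfl | rfl | rfl | rfl | rfl | rfl)
    · exact ⟨1, Subgroup.one_mem _, by simp⟩
    · exact ⟨qj, hj, j1⟩
    · exact ⟨omega h2, ho, o1⟩
    · exact ⟨qi * omega h2, Subgroup.mul_mem _ hi ho, by rw [conj_mul, o1, i2]⟩
    · exact ⟨omega h2 * omega h2, Subgroup.mul_mem _ ho ho, by rw [conj_mul, o1, o2]⟩
    · exact ⟨qi * (omega h2 * omega h2), Subgroup.mul_mem _ hi (Subgroup.mul_mem _ ho ho),
        by rw [conj_mul, conj_mul, o1, o2, i3]⟩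

end UnitQuat

end Octahedral

/-! ### The subdegree of the octahedral group -/

section OctahedralSubdegree

namespace UnitQuat

variable {F : Type*} [Field F]

/-- Two unit quaternions that induce the same rotation agree up to sign. -/
theorem eq_or_eq_neg_of_conj_eq (h2 : (2 : F) ≠ 0) {u c : UnitQuat F}
    (hi : u * qi * u⁻¹ = c * qi * c⁻¹) (hj : u * qj * u⁻¹ = c * qj * c⁻¹) :
    u = c ∨ u = -c := by
  have key : ∀ p : UnitQuat F, u * p * u⁻¹ = c * p * c⁻¹ → c⁻¹ * u * p = p * (c⁻¹ * u) := by
    intro p h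
    rw [mul_inv_eq_iff_eq_mul] at h
    rw [mul_assoc, h]
    group
  obtain ⟨hy, hz⟩ := (commute_qi_iff h2 _).1 (key _ hi)
  obtain ⟨hx, -⟩ := (commute_qj_iff h2 _).1 (key _ hj)
  rcases eq_one_or_neg_one hx hy hz with h | h
  · left
    rwa [inv_mul_eq_one, eq_comm] at h
  · right
    rw [inv_mul_eq_iff_eq_mul] at h
    rw [h, mul_neg, mul_one]

/-- Conjugation is linear on quaternions of real part zero. -/
theorem conj_coords (u p : UnitQuat F) (hp : p.w = 0) :
    (u * p * u⁻¹).w = 0 ∧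
    (u * p * u⁻¹).x = p.x * (u * qi * u⁻¹).x + p.y * (u * qj * u⁻¹).x
      + p.z * (u * qk * u⁻¹).x ∧
    (u * p * u⁻¹).y = p.x * (u * qi * u⁻¹).y + p.y * (u * qj * u⁻¹).y
      + p.z * (u * qk * u⁻¹).y ∧
    (u * p * u⁻¹).z = p.x * (u * qi * u⁻¹).z + p.y * (u * qj * u⁻¹).z
      + p.z * (u * qk * u⁻¹).z := by
  refine ⟨?_, ?_, ?_, ?_⟩ <;> simp [hp] <;> ring

/-- The square of an element of order eight of the binary octahedral group is a vertex of the
octahedron: the rotation it induces has trace `4 s ^ 2 - 1 = 1`, so it preserves an axis. -/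
theorem mul_self_mem_octahedron (h2 : (2 : F) ≠ 0) {s : F} (hs : 2 * s ^ 2 = 1) {t : UnitQuat F}
    (ht : t ∈ octahedralGroup F) (hw : t.w = s) : t * t ∈ octahedron F := by
  have hs0 : s ≠ 0 := by
    rintro rfl
    simp at hs
  have hn := t.norm_eq
  have hanti : ∀ {p : UnitQuat F}, p.w = 0 → t * p * t⁻¹ = -p → False := by
    intro p hp h
    rw [mul_inv_eq_iff_eq_mul] at h
    have hx := congrArg UnitQuat.x h
    have hy := congrArg UnitQuat.y h
    have hz := congrArg UnitQuat.z h
    simp only [mul_x, mul_y, mul_z, neg_x, neg_y, neg_z, neg_w, hp, hw] at hx hy hz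
    have hpx : 2 * (s * p.x) = 0 := by linear_combination hx
    have hpy : 2 * (s * p.y) = 0 := by linear_combination hy
    have hpz : 2 * (s * p.z) = 0 := by linear_combination hz
    simp only [mul_eq_zero, h2, hs0, false_or] at hpx hpy hpz
    have := p.norm_eq
    simp [hp, hpx, hpy, hpz] at this
  have hsq : ∀ c : F, s ^ 2 + c ^ 2 = 1 → c = s ∨ c = -s := fun c hc => by
    rw [← sq_eq_sq_iff_eq_or_eq_neg]
    linear_combination hc - hs
  have htrace : (t * qi * t⁻¹).x + (t * qj * t⁻¹).y + (t * qk * t⁻¹).z = 1 := by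
    simp [hw]
    linear_combination 2 * hs - hn + (s + t.w) * hw
  have hi := conj_mem_octahedron ht qi_mem
  have hj := conj_mem_octahedron ht qj_mem
  have hk := conj_mem_octahedron ht qk_mem
  by_cases h1 : t * qi * t⁻¹ = qi
  · obtain ⟨hy, hz⟩ := (commute_qi_iff h2 t).1 (mul_inv_eq_iff_eq_mul.1 h1)
    rw [hw, hy, hz] at hn
    rcases hsq t.x (by linear_combination hn) with hx | hx
    · left; ext <;> simp [hw, hx, hy, hz]; linear_combination hs
    · right; left; ext <;> simp [hw, hx, hy, hz]; linear_combination -hs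
  by_cases h3 : t * qj * t⁻¹ = qj
  · obtain ⟨hx, hz⟩ := (commute_qj_iff h2 t).1 (mul_inv_eq_iff_eq_mul.1 h3)
    rw [hw, hx, hz] at hn
    rcases hsq t.y (by linear_combination hn) with hy | hy
    · right; right; left; ext <;> simp [hw, hx, hy, hz]; linear_combination hs
    · right; right; right; left; ext <;> simp [hw, hx, hy, hz]; linear_combination -hs
  by_cases h4 : t * qk * t⁻¹ = qk
  · obtain ⟨hx, hy⟩ := (commute_qk_iff h2 t).1 (mul_inv_eq_iff_eq_mul.1 h4)
    rw [hw, hx, hy] at hn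
    rcases hsq t.z (by linear_combination hn) with hz | hz
    · right; right; right; right; left; ext <;> simp [hw, hx, hy, hz]; linear_combination hs
    · right; right; right; right; right; ext <;> simp [hw, hx, hy, hz]; linear_combination -hs
  have hi' : (t * qi * t⁻¹).x = 0 := by
    rcases hi with h | h | h | h | h | h
    · exact absurd h h1
    · exact (hanti rfl h).elim
    all_goals rw [h]; simp
  have hj' : (t * qj * t⁻¹).y = 0 := by
    rcases hj with h | h | h | h | h | h
    · rw [h]; simp
    · rw [h]; simp
    · exact absurd h h3
    · exact (hanti rfl h).elim
    all_goals rw [h]; simp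
  have hk' : (t * qk * t⁻¹).z = 0 := by
    rcases hk with h | h | h | h | h | h
    · rw [h]; simp
    · rw [h]; simp
    · rw [h]; simp
    · rw [h]; simp
    · exact absurd h h4
    · exact (hanti rfl h).elim
  rw [hi', hj', hk'] at htrace
  simp at htrace

/-- The binary octahedral group is self-normalising: its elements with real part `s` are permuted
by its normaliser, and hence so are their squares, which are the vertices of the octahedron. -/
theorem mem_octahedralGroup_of_conj [Finite F] (h2 : (2 : F) ≠ 0) {s : F} (hs : 2 * s ^ 2 = 1)
    {x : UnitQuat F} (hx : ∀ a ∈ octahedralGroup F, x⁻¹ * a * x ∈ octahedralGroup F) :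
    x ∈ octahedralGroup F := by
  have key : ∀ r p : UnitQuat F, r ∈ octahedralGroup F → r.w = s → r * r = p →
      x⁻¹ * p * x⁻¹⁻¹ ∈ octahedron F := by
    rintro r _ hr hw rfl
    have h := mul_self_mem_octahedron h2 hs (hx r hr) (by
      rw [← hw]
      simp
      linear_combination r.w * x.norm_eq)
    have h' : x⁻¹ * r * x * (x⁻¹ * r * x) = x⁻¹ * (r * r) * x⁻¹⁻¹ := by group
    rwa [h'] at h
  rw [← Subgroup.inv_mem_iff]
  refine mem_octahedralGroup (key ⟨s, s, 0, 0, by linear_combination hs⟩ _ ?_ rfl ?_)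
    (key ⟨s, 0, s, 0, by linear_combination hs⟩ _ ?_ rfl ?_)
    (key ⟨s, 0, 0, s, by linear_combination hs⟩ _ ?_ rfl ?_)
  · have h1 : ∀ r : UnitQuat F, r = ⟨s, s, 0, 0, by linear_combination hs⟩ →
        r * qi * r⁻¹ = qi ∧ r * qj * r⁻¹ = qk ∧ r * qk * r⁻¹ = -qj := by
      rintro r rfl
      refine ⟨?_, ?_, ?_⟩ <;> rw [mul_inv_eq_iff_eq_mul] <;> ext <;> simp
    obtain ⟨e1, e2, e3⟩ := h1 _ rfl
    exact mem_octahedralGroup (by simp [e1, mem_octahedron]) (by simp [e2, mem_octahedron])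
      (by simp [e3, mem_octahedron])
  · ext <;> simp
    linear_combination hs
  · have h1 : ∀ r : UnitQuat F, r = ⟨s, 0, s, 0, by linear_combination hs⟩ →
        r * qi * r⁻¹ = -qk ∧ r * qj * r⁻¹ = qj ∧ r * qk * r⁻¹ = qi := by
      rintro r rfl
      refine ⟨?_, ?_, ?_⟩ <;> rw [mul_inv_eq_iff_eq_mul] <;> ext <;> simp
    obtain ⟨e1, e2, e3⟩ := h1 _ rfl
    exact mem_octahedralGroup (by simp [e1, mem_octahedron]) (by simp [e2, mem_octahedron])
      (by simp [e3, mem_octahedron])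
  · ext <;> simp
    linear_combination hs
  · have h1 : ∀ r : UnitQuat F, r = ⟨s, 0, 0, s, by linear_combination hs⟩ →
        r * qi * r⁻¹ = qj ∧ r * qj * r⁻¹ = -qi ∧ r * qk * r⁻¹ = qk := by
      rintro r rfl
      refine ⟨?_, ?_, ?_⟩ <;> rw [mul_inv_eq_iff_eq_mul] <;> ext <;> simp
    obtain ⟨e1, e2, e3⟩ := h1 _ rfl
    exact mem_octahedralGroup (by simp [e1, mem_octahedron]) (by simp [e2, mem_octahedron])
      (by simp [e3, mem_octahedron])
  · ext <;> simp
    linear_combination hs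

/-- The sum of two vertices of the octahedron has a zero coordinate. -/
theorem octahedron_add_coord {p q : UnitQuat F} (hp : p ∈ octahedron F) (hq : q ∈ octahedron F) :
    p.x + q.x = 0 ∨ p.y + q.y = 0 ∨ p.z + q.z = 0 := by
  rcases hp with rfl | rfl | rfl | rfl | rfl | rfl <;>
  rcases hq with rfl | rfl | rfl | rfl | rfl | rfl <;> simp

theorem octahedron_coord {p : UnitQuat F} (hp : p ∈ octahedron F) : p.y = 0 ∨ p.z = 0 := by
  rcases hp with rfl | rfl | rfl | rfl | rfl | rfl <;> simp

/-- Two vertices of the octahedron whose sum is `± (i + j)`. -/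
theorem octahedron_pair_of_add (h2 : (2 : F) ≠ 0) {p q : UnitQuat F} {e : F} (he : e ≠ 0)
    (hp : p ∈ octahedron F) (hq : q ∈ octahedron F) (hx : p.x + q.x = e) (hy : p.y + q.y = e) :
    (p = qi ∧ q = qj) ∨ (p = qj ∧ q = qi) ∨ (p = -qi ∧ q = -qj) ∨ (p = -qj ∧ q = -qi) := by
  rcases hp with rfl | rfl | rfl | rfl | rfl | rfl <;>
  rcases hq with rfl | rfl | rfl | rfl | rfl | rfl <;>
  simp only [qi_x, qi_y, qj_x, qj_y, qk_x, qk_y, neg_x, neg_y] at hx hy <;>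
  first | (exfalso; grind) | simp

/-- Two vertices of the octahedron whose difference is `± (i - j)`. -/
theorem octahedron_pair_of_sub (h2 : (2 : F) ≠ 0) {p q : UnitQuat F} {e : F} (he : e ≠ 0)
    (hp : p ∈ octahedron F) (hq : q ∈ octahedron F) (hx : p.x - q.x = e) (hy : q.y - p.y = e) :
    (p = qi ∧ q = qj) ∨ (p = qj ∧ q = qi) ∨ (p = -qi ∧ q = -qj) ∨ (p = -qj ∧ q = -qi) := by
  rcases hp with rfl | rfl | rfl | rfl | rfl | rfl <;>
  rcases hq with rfl | rfl | rfl | rfl | rfl | rfl <;>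
  simp only [qi_x, qi_y, qj_x, qj_y, qk_x, qk_y, neg_x, neg_y] at hx hy <;>
  first | (exfalso; grind) | simp

theorem commute_or_anticommute_iff_conj (a z : UnitQuat F) :
    (a * z = z * a ∨ a * z = -(z * a)) ↔ (a * z * a⁻¹ = z ∨ a * z * a⁻¹ = -z) := by
  rw [mul_inv_eq_iff_eq_mul, mul_inv_eq_iff_eq_mul, neg_mul]

set_option maxHeartbeats 1000000 in
/-- The binary octahedral group is self-normalising, and meets its conjugate by the half turn
`x₀ = (i + j) / 2 + s k` in the elements that commute or anticommute with `z = s (i - j)`. -/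
theorem octahedral_index_pow_mem_subdegrees [Finite F] (h2 : (2 : F) ≠ 0) {s : F}
    (hs : 2 * s ^ 2 = 1) {m : ℕ} [NeZero m] (hm : 2 ≤ m) (α : GPoints m PSL(2, F)) :
    (Nat.card PSL(2, F) / 24) ^ m ∈ subdegrees (GTW m PSL(2, F)) α := by
  obtain ⟨π, hsurj, hπ⟩ := exists_cover_PSL2 F h2
  have hs0 : s ≠ 0 := by
    rintro rfl
    simp at hs
  have h2i : (2 : F) * 2⁻¹ = 1 := mul_inv_cancel₀ h2
  obtain ⟨h, hh⟩ : ∃ h : F, 2 * h = 1 := ⟨2⁻¹, h2i⟩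
  have h0 : h ≠ 0 := by
    rintro rfl
    simp at hh
  have hhs : 2 * h ^ 2 + s ^ 2 = 1 := by
    apply mul_left_cancel₀ h2
    linear_combination (2 * h + 1) * hh + hs
  have hsh : s ^ 2 = h := by
    apply mul_left_cancel₀ h2
    linear_combination hs - hh
  obtain ⟨z, hz⟩ : ∃ z : UnitQuat F, z = ⟨0, s, -s, 0, by linear_combination hs⟩ := ⟨_, rfl⟩
  obtain ⟨v, hv⟩ : ∃ v : UnitQuat F, v = ⟨0, s, s, 0, by linear_combination hs⟩ := ⟨_, rfl⟩
  obtain ⟨x₀, hx₀⟩ : ∃ x : UnitQuat F, x = ⟨0, h, h, s, by linear_combination hhs⟩ := ⟨_, rfl⟩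
  have hneg := neg_one_mem_normalizer (octahedron F)
  have hvi : v * qi * v⁻¹ = qj := by rw [mul_inv_eq_iff_eq_mul]; ext <;> simp [hv]
  have hvj : v * qj * v⁻¹ = qi := by rw [mul_inv_eq_iff_eq_mul]; ext <;> simp [hv]
  have hvk : v * qk * v⁻¹ = -qk := by rw [mul_inv_eq_iff_eq_mul]; ext <;> simp [hv]
  have hzi : z * qi * z⁻¹ = -qj := by rw [mul_inv_eq_iff_eq_mul]; ext <;> simp [hz]
  have hzj : z * qj * z⁻¹ = -qi := by rw [mul_inv_eq_iff_eq_mul]; ext <;> simp [hz]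
  have hzk : z * qk * z⁻¹ = -qk := by rw [mul_inv_eq_iff_eq_mul]; ext <;> simp [hz]
  have hki : (qk : UnitQuat F) * qi * qk⁻¹ = -qi := by rw [mul_inv_eq_iff_eq_mul]; ext <;> simp
  have hkj : (qk : UnitQuat F) * qj * qk⁻¹ = -qj := by rw [mul_inv_eq_iff_eq_mul]; ext <;> simp
  have hkk : (qk : UnitQuat F) * qk * qk⁻¹ = qk := by rw [mul_inv_eq_iff_eq_mul]
  have hvA : v ∈ octahedralGroup F := mem_octahedralGroup (by simp [hvi, mem_octahedron])
    (by simp [hvj, mem_octahedron]) (by simp [hvk, mem_octahedron])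
  have hzA : z ∈ octahedralGroup F := mem_octahedralGroup (by simp [hzi, mem_octahedron])
    (by simp [hzj, mem_octahedron]) (by simp [hzk, mem_octahedron])
  have hkA : qk ∈ octahedralGroup F := mem_octahedralGroup (by simp [hki, mem_octahedron])
    (by simp [hkj, mem_octahedron]) (by simp [hkk, mem_octahedron])
  -- the conjugates of the vertices `i`, `j`, `k` by `x₀`
  have hxi : (x₀ * qi * x₀⁻¹).x = -s ^ 2 ∧ (x₀ * qi * x₀⁻¹).y = h ∧ (x₀ * qi * x₀⁻¹).z = s := by
    refine ⟨?_, ?_, ?_⟩ <;> simp [hx₀]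
    · ring
    · linear_combination h * hh
    · linear_combination s * hh
  have hxj : (x₀ * qj * x₀⁻¹).x = h ∧ (x₀ * qj * x₀⁻¹).y = -s ^ 2 ∧ (x₀ * qj * x₀⁻¹).z = s := by
    refine ⟨?_, ?_, ?_⟩ <;> simp [hx₀]
    · linear_combination h * hh
    · ring
    · linear_combination s * hh
  have hxk : x₀ * qk * x₀⁻¹ = v := by
    rw [mul_inv_eq_iff_eq_mul]
    ext <;> simp [hx₀, hv]
    · linear_combination s * hh
    · linear_combination -hsh
    · linear_combination -hsh
  have hxv : x₀⁻¹ * qk * x₀ = v := by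
    rw [mul_assoc, inv_mul_eq_iff_eq_mul]
    ext <;> simp [hx₀, hv]
    · linear_combination s * hh
    · linear_combination -hsh
    · linear_combination -hsh
  have hxz : x₀⁻¹ * z * x₀ = -z := by
    rw [mul_assoc, inv_mul_eq_iff_eq_mul]
    ext <;> simp [hx₀, hz]
    ring
  rw [← index_eq_card_div h2 (octahedralGroup F) 24 (card_octahedralGroup h2 s hs) (by norm_num)]
  refine index_pow_mem_subdegrees_of_cover π hsurj hπ (octahedralGroup F) hneg x₀ z ?_ ?_ ?_ ?_
    (fun x hx => mem_octahedralGroup_of_conj h2 hs hx) ?_ α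
  · intro h
    have := congrArg UnitQuat.x h
    simp [hz, hs0] at this
  · intro h
    have := congrArg UnitQuat.x h
    simp [hz, hs0] at this
  · intro hA
    have h1 := octahedron_coord (conj_mem_octahedron hA qi_mem)
    rw [hxi.2.1, hxi.2.2] at h1
    exact h1.elim h0 hs0
  · intro a ha
    have hP := conj_mem_octahedron ha qi_mem
    have hQ := conj_mem_octahedron ha qj_mem
    rw [commute_or_anticommute_iff_conj]
    constructor
    · -- `x₀` interchanges the axes of `k` and `v = s (i + j)`. As `a v a⁻¹` is a multiple of the sum
      -- of two vertices, it has a zero coordinate, and so lies on the axis of `v`: the images of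
      -- the axes of `i` and `j` under `x₀` have no zero coordinate.
      intro hax
      obtain ⟨-, cx, cy, cz⟩ := conj_coords a v (by rw [hv])
      have hzero : (a * v * a⁻¹).x = 0 ∨ (a * v * a⁻¹).y = 0 ∨ (a * v * a⁻¹).z = 0 := by
        rw [cx, cy, cz, hv]
        simp only [zero_mul, add_zero, ← mul_add, mul_eq_zero, hs0, false_or]
        exact octahedron_add_coord hP hQ
      have hconj : ∀ o : UnitQuat F, x₀⁻¹ * a * x₀ * qk * (x₀⁻¹ * a * x₀)⁻¹ = o →
          a * v * a⁻¹ = x₀ * o * x₀⁻¹ := by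
        rintro o rfl
        rw [← hxk]
        group
      have hfin : ∀ e : F, e ≠ 0 → (a * v * a⁻¹).x = e * s → (a * v * a⁻¹).y = e * s →
          a * z * a⁻¹ = z ∨ a * z * a⁻¹ = -z := by
        intro e he hx hy
        obtain ⟨dw, dx, dy, dz⟩ := conj_coords a z (by rw [hz])
        have hcase := octahedron_pair_of_add h2 he hP hQ
          (mul_left_cancel₀ hs0 (by rw [cx, hv] at hx; linear_combination hx))
          (mul_left_cancel₀ hs0 (by rw [cy, hv] at hy; linear_combination hy))
        rcases hcase with ⟨hp, hq⟩ | ⟨hp, hq⟩ | ⟨hp, hq⟩ | ⟨hp, hq⟩ <;> rw [hp, hq] at dx dy dz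
        · left; ext <;> simp only [dw, dx, dy, dz] <;> simp [hz]
        · right; ext <;> simp only [dw, dx, dy, dz] <;> simp [hz]
        · right; ext <;> simp only [dw, dx, dy, dz] <;> simp [hz]
        · left; ext <;> simp only [dw, dx, dy, dz] <;> simp [hz]
      rcases mem_octahedron.1 (conj_mem_octahedron hax qk_mem) with ho | ho | ho | ho | ho | ho <;>
        have ho := hconj _ ho
      · rw [ho, hxi.1, hxi.2.1, hxi.2.2] at hzero
        simp [h0, hs0] at hzero
      · rw [ho, mul_neg, neg_mul, neg_x, neg_y, neg_z, hxi.1, hxi.2.1, hxi.2.2] at hzero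
        simp [h0, hs0] at hzero
      · rw [ho, hxj.1, hxj.2.1, hxj.2.2] at hzero
        simp [h0, hs0] at hzero
      · rw [ho, mul_neg, neg_mul, neg_x, neg_y, neg_z, hxj.1, hxj.2.1, hxj.2.2] at hzero
        simp [h0, hs0] at hzero
      · rw [hxk] at ho
        exact hfin 1 one_ne_zero (by rw [ho]; simp [hv]) (by rw [ho]; simp [hv])
      · rw [mul_neg, neg_mul, hxk] at ho
        exact hfin (-1) (by simp) (by rw [ho]; simp [hv]) (by rw [ho]; simp [hv])
    · -- up to sign, `a` is one of the half turns `v`, `k`, `z` or trivial, and `x₀` normalises the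
      -- group that they form
      intro haz
      have hcase : (a * qi * a⁻¹ = qi ∧ a * qj * a⁻¹ = qj) ∨
          (a * qi * a⁻¹ = qj ∧ a * qj * a⁻¹ = qi) ∨ (a * qi * a⁻¹ = -qi ∧ a * qj * a⁻¹ = -qj) ∨
          (a * qi * a⁻¹ = -qj ∧ a * qj * a⁻¹ = -qi) := by
        obtain ⟨-, dx, dy, -⟩ := conj_coords a z (by rw [hz])
        obtain ⟨e, he, hx, hy⟩ : ∃ e : F, e ≠ 0 ∧ (a * z * a⁻¹).x = e * s ∧
            (a * z * a⁻¹).y = -(e * s) := by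
          rcases haz with h | h
          · exact ⟨1, one_ne_zero, by rw [h]; simp [hz], by rw [h]; simp [hz]⟩
          · exact ⟨-1, by simp, by rw [h]; simp [hz], by rw [h]; simp [hz]⟩
        refine octahedron_pair_of_sub h2 he hP hQ
          (mul_left_cancel₀ hs0 (by rw [dx, hz] at hx; linear_combination hx))
          (mul_left_cancel₀ hs0 (by rw [dy, hz] at hy; linear_combination -hy))
      have hfin : ∀ c : UnitQuat F, x₀⁻¹ * c * x₀ ∈ octahedralGroup F → (a = c ∨ a = -c) →
          x₀⁻¹ * a * x₀ ∈ octahedralGroup F := by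
        rintro c hc (rfl | rfl)
        · exact hc
        · have h := Subgroup.mul_mem _ hneg hc
          rwa [neg_one_mul, ← neg_mul, ← mul_neg] at h
      rcases hcase with ⟨hp, hq⟩ | ⟨hp, hq⟩ | ⟨hp, hq⟩ | ⟨hp, hq⟩
      · exact hfin 1 (by simp) (eq_or_eq_neg_of_conj_eq h2 (by simp [hp]) (by simp [hq]))
      · refine hfin v ?_ (eq_or_eq_neg_of_conj_eq h2 (by rw [hp, hvi]) (by rw [hq, hvj]))
        rw [← hxk, show x₀⁻¹ * (x₀ * qk * x₀⁻¹) * x₀ = qk by group]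
        exact hkA
      · refine hfin qk ?_ (eq_or_eq_neg_of_conj_eq h2 (by rw [hp, hki]) (by rw [hq, hkj]))
        rw [hxv]
        exact hvA
      · refine hfin z ?_ (eq_or_eq_neg_of_conj_eq h2 (by rw [hp, hzi]) (by rw [hq, hzj]))
        rw [hxz, ← neg_one_mul]
        exact Subgroup.mul_mem _ hneg hzA
  · have hcases : 3 ≤ m ∨ m = 2 := by omega
    refine hcases.imp id fun hm => ⟨hm, Or.inr ?_, Or.inr ?_⟩
    · ext <;> simp [hx₀]
      · linear_combination -hhs
      · ring
      · ring
    · ext <;> simp [hx₀, hz]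
      ring

end UnitQuat

end OctahedralSubdegree

/-! ### Groups with a self-centralising involution -/

section SelfCentralizingInvolution

open Subgroup in
/-- A finite group with an involution `a` whose centraliser is `{1, a}` has an abelian subgroup of
index two and odd order, inverted by `a`: by Burnside's transfer theorem the Sylow `2`-subgroup
`{1, a}` has a normal complement, and `a` acts on it without fixed points. -/
theorem exists_complement_of_centralizer_eq {G : Type*} [Group G] [Finite G] {a : G} (ha : a ≠ 1)
    (ha2 : a * a = 1) (hC : ∀ u, u * a = a * u → u = 1 ∨ u = a) :
    ∃ O : Subgroup G, (∀ r ∈ O, a * r * a = r⁻¹) ∧ (∀ r ∈ O, ∀ s ∈ O, r * s = s * r) ∧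
      (∀ g, g ∈ O ∨ g * a ∈ O) ∧ (∀ r ∈ O, r * r = 1 → r = 1) := by
  have hinv : a⁻¹ = a := inv_eq_of_mul_eq_one_left ha2
  have : Fact (Nat.Prime 2) := ⟨Nat.prime_two⟩
  have hz : IsPGroup 2 (zpowers a) := by
    refine IsPGroup.of_card (n := 1) ?_
    rw [Nat.card_zpowers, pow_one]
    exact orderOf_eq_prime (by rw [sq, ha2]) ha
  obtain ⟨P, hP⟩ := hz.exists_le_sylow
  have haP : a ∈ (P : Subgroup G) := hP (mem_zpowers a)
  have : Nontrivial P := ⟨⟨1, one_mem _⟩, ⟨a, haP⟩, fun h => ha (congrArg Subtype.val h).symm⟩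
  -- a central element of the Sylow subgroup is `1` or `a`, so `a` is central
  have hPa : ∀ g ∈ P, g = 1 ∨ g = a := by
    have := P.2.center_nontrivial
    obtain ⟨⟨⟨c, hcP⟩, hc⟩, hc1⟩ := exists_ne (1 : Subgroup.center P)
    have hcc : ∀ g ∈ P, g * c = c * g := fun g hg =>
      congrArg Subtype.val (Subgroup.mem_center_iff.1 hc ⟨g, hg⟩)
    rcases hC c (hcc a haP).symm with rfl | rfl
    · exact absurd rfl hc1
    · exact fun g hg => hC g (hcc g hg)
  have hN : normalizer (P : Set G) ≤ centralizer (P : Set G) := by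
    intro g hg
    have hga : g * a * g⁻¹ = a := by
      refine (hPa _ ((mem_set_normalizer_iff.1 hg a).1 haP)).resolve_left fun h => ha ?_
      rwa [mul_inv_eq_one, mul_eq_left] at h
    refine mem_centralizer_iff.2 fun h hh => ?_
    rcases hPa h hh with rfl | rfl
    · simp
    · exact (mul_inv_eq_iff_eq_mul.1 hga).symm
  have hcompl := MonoidHom.ker_transferSylow_isComplement' P hN
  have hodd := MonoidHom.not_dvd_card_ker_transferSylow P hN
  set O := (MonoidHom.transferSylow P hN).ker with hO
  have h2 : ∀ r ∈ O, r * r = 1 → r = 1 := by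
    intro r hr h
    by_contra hne
    refine hodd ?_
    rw [← orderOf_eq_prime (p := 2) (x := (⟨r, hr⟩ : O)) (Subtype.ext (by simpa [sq] using h))
      fun h => hne (congrArg Subtype.val h)]
    exact orderOf_dvd_natCard _
  have hfree : MonoidHom.FixedPointFree (MulAut.conjNormal a : MulAut O) := by
    rintro ⟨r, hr⟩ h
    have h' : a * r * a⁻¹ = r := by simpa [Subtype.ext_iff] using h
    rw [mul_inv_eq_iff_eq_mul] at h'
    rcases hC r h'.symm with rfl | rfl
    · rfl
    · exact absurd (h2 r hr ha2) ha
  have hinvol : Function.Involutive (MulAut.conjNormal a : MulAut O) := by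
    rintro ⟨r, hr⟩
    refine Subtype.ext ?_
    simp only [MulAut.conjNormal_apply, hinv]
    rw [show a * (a * r * a) * a = (a * a) * r * (a * a) by group, ha2, one_mul, mul_one]
  refine ⟨O, fun r hr => ?_, fun r hr s hs => ?_, fun g => ?_, h2⟩
  · have h := congrFun (hfree.coe_eq_inv_of_involutive hinvol) ⟨r, hr⟩
    have h' := congrArg Subtype.val h
    simpa [hinv] using h'
  · exact congrArg Subtype.val (hfree.commute_all_of_involutive hinvol ⟨r, hr⟩ ⟨s, hs⟩).eq
  · obtain ⟨⟨o, p⟩, h⟩ := hcompl.2 g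
    have h : (o : G) * p = g := h
    rcases hPa p p.2 with hp | hp
    · left
      rw [← h, hp, mul_one]
      exact o.2
    · right
      rw [← h, hp, mul_assoc, ha2, mul_one]
      exact o.2

/-- Let the centralisers of the elements `s` with `s ^ 2 ≠ 1` be abelian, and let an involution
`y ∉ A` centralise an involution `a ∈ A`, where the intersection of `A` with its conjugate by `y`
contains no element commuting with `a` other than `1` and `a`. Then `y` or `y a` centralises this
intersection. -/
theorem exists_conj_mem_iff_commute {T : Type*} [Group T] [Finite T]
    (hab : ∀ s b c : T, s * s ≠ 1 → s * b = b * s → s * c = c * s → b * c = c * b)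
    (A : Subgroup T) {a y : T} (haA : a ∈ A) (ha : a ≠ 1) (ha2 : a * a = 1) (hy2 : y * y = 1)
    (hya : y * a = a * y)
    (hC : ∀ u ∈ A, u * a = a * u → y * u * y ∈ A → u = 1 ∨ u = a) :
    ∃ x, (x = y ∨ x = y * a) ∧ ∀ b ∈ A, x⁻¹ * b * x ∈ A ↔ b * x = x * b := by
  have hyinv : y⁻¹ = y := inv_eq_of_mul_eq_one_left hy2
  have hainv : a⁻¹ = a := inv_eq_of_mul_eq_one_left ha2
  have hyy : ∀ b, y * (y * b * y) * y = b := fun b => by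
    rw [show y * (y * b * y) * y = (y * y) * b * (y * y) by group, hy2, one_mul, mul_one]
  have hyay : y * a * y = a := by rw [hya, mul_assoc, hy2, mul_one]
  let σ : T →* T := (MulAut.conj y).toMonoidHom
  have hσ : ∀ b, σ b = y * b * y := fun b => by simp [σ, hyinv]
  let B : Subgroup T := A ⊓ A.comap σ
  have hB : ∀ b, b ∈ B ↔ b ∈ A ∧ y * b * y ∈ A := fun b => by
    rw [Subgroup.mem_inf, Subgroup.mem_comap, hσ]
  have haB : a ∈ B := (hB a).2 ⟨haA, by rwa [hyay]⟩
  have hBσ : ∀ b ∈ B, σ b ∈ B := fun b hb => by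
    rw [hB] at *
    rw [hσ, hyy]
    exact hb.symm
  obtain ⟨O, hinv, hcomm, hcov, hodd⟩ := exists_complement_of_centralizer_eq (G := B)
    (a := ⟨a, haB⟩) (fun h => ha (congrArg Subtype.val h)) (Subtype.ext ha2) (by
      rintro ⟨u, hu⟩ h
      simpa [Subtype.ext_iff] using
        hC u ((hB u).1 hu).1 (congrArg Subtype.val h) ((hB u).1 hu).2)
  let τ : B →* B := (σ.comp B.subtype).codRestrict B fun b => hBσ b b.2
  have hτ : ∀ b : B, ((τ b : B) : T) = y * b * y := fun b => hσ b
  have ha1 : (⟨a, haB⟩ : B) ≠ 1 := fun h => ha (congrArg Subtype.val h)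
  have ha2' : (⟨a, haB⟩ : B) * ⟨a, haB⟩ = 1 := Subtype.ext ha2
  have hτa : τ ⟨a, haB⟩ = ⟨a, haB⟩ := Subtype.ext ((hτ _).trans hyay)
  have hττ : ∀ b, τ (τ b) = b := fun b => Subtype.ext (by rw [hτ, hτ, hyy])
  -- conjugation by `y` preserves the complement `O`
  have hOτ : ∀ r ∈ O, τ r ∈ O := by
    intro r hr
    refine (hcov (τ r)).resolve_right fun h => ?_
    have h1 := hinv _ h
    have h3 : τ r * τ r = 1 := by
      rw [mul_inv_rev, inv_eq_of_mul_eq_one_left ha2', mul_assoc, mul_assoc, ha2', mul_one] at h1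
      exact mul_eq_one_iff_eq_inv.2 (mul_left_cancel h1)
    have h4 : r = 1 := hodd r hr (by
      have := congrArg τ h3
      rwa [map_mul, hττ, map_one] at this)
    rw [h4, map_one, one_mul] at h
    exact ha1 (hodd _ h ha2')
  have hmain : ∃ x, (x = y ∨ x = y * a) ∧ ∀ r ∈ O, (r : T) * x = x * r := by
    by_cases hr : ∃ r ∈ O, r * τ r ≠ 1
    · obtain ⟨r, hr, hne⟩ := hr
      refine ⟨y, Or.inl rfl, fun t ht => ?_⟩
      have hs := O.mul_mem hr (hOτ r hr)
      refine hab (r * τ r : B) t y (fun h => hne (hodd _ hs (Subtype.ext h)))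
        (congrArg Subtype.val (hcomm _ hs t ht)) ?_
      have h1 : τ (r * τ r) = r * τ r := by
        rw [map_mul, hττ]
        exact hcomm _ (hOτ r hr) _ hr
      have h2 := (hτ _).symm.trans (congrArg Subtype.val h1)
      conv_lhs => rw [← h2, mul_assoc, hy2, mul_one]
    · push Not at hr
      refine ⟨y * a, Or.inr rfl, fun t ht => ?_⟩
      have h1 : (t : T) * (τ t : B) = 1 := congrArg Subtype.val (hr t ht)
      have h2 : a * t * a = (t : T)⁻¹ := congrArg Subtype.val (hinv t ht)
      rw [hτ, mul_eq_one_iff_inv_eq, ← h2] at h1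
      calc (t : T) * (y * a) = y * (y * t * y) * a := by
            rw [show y * (y * (t : T) * y) * a = (y * y) * t * (y * a) by group, hy2, one_mul]
        _ = y * a * t := by
            rw [← h1, show y * (a * (t : T) * a) * a = y * a * t * (a * a) by group, ha2, mul_one]
  obtain ⟨x, hx, hxO⟩ := hmain
  have hxa : a * x = x * a := by
    rcases hx with rfl | rfl
    · exact hya.symm
    · rw [← mul_assoc, ← hya]
  refine ⟨x, hx, fun b hb => ⟨fun h => ?_, fun h => ?_⟩⟩
  · have hbB : b ∈ B := by
      refine (hB b).2 ⟨hb, ?_⟩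
      rcases hx with rfl | rfl
      · rwa [hyinv] at h
      · have := A.mul_mem (A.mul_mem haA h) haA
        rwa [mul_inv_rev, hyinv, hainv, show a * (a * y * b * (y * a)) * a =
          (a * a) * (y * b * y) * (a * a) by group, ha2, one_mul, mul_one] at this
    rcases hcov ⟨b, hbB⟩ with h1 | h1
    · exact hxO _ h1
    · have h2 : b * a * x = x * (b * a) := hxO _ h1
      rw [mul_assoc, hxa, ← mul_assoc, ← mul_assoc] at h2
      exact mul_right_cancel h2
  · rw [mul_assoc, h, inv_mul_cancel_left]
    exact hb

end SelfCentralizingInvolution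

/-! ### The binary icosahedral group -/

section Icosahedral

namespace UnitQuat

variable {F : Type*} [Field F]

theorem commute_iff (h2 : (2 : F) ≠ 0) (p q : UnitQuat F) : p * q = q * p ↔
    p.y * q.z = p.z * q.y ∧ p.z * q.x = p.x * q.z ∧ p.x * q.y = p.y * q.x := by
  constructor
  · intro h
    have hx := congrArg UnitQuat.x h
    have hy := congrArg UnitQuat.y h
    have hz := congrArg UnitQuat.z h
    simp only [mul_x, mul_y, mul_z] at hx hy hz
    refine ⟨?_, ?_, ?_⟩ <;> apply mul_left_cancel₀ h2
    · linear_combination hx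
    · linear_combination hy
    · linear_combination hz
  · rintro ⟨hx, hy, hz⟩
    ext <;> simp only [mul_w, mul_x, mul_y, mul_z]
    · ring
    · linear_combination 2 * hx
    · linear_combination 2 * hy
    · linear_combination 2 * hz

/-- The centraliser of a quaternion with nonzero imaginary part is abelian. -/
theorem commute_of_commute (h2 : (2 : F) ≠ 0) {g b c : UnitQuat F}
    (hg : g.x ≠ 0 ∨ g.y ≠ 0 ∨ g.z ≠ 0) (hb : g * b = b * g) (hc : g * c = c * g) :
    b * c = c * b := by
  rw [commute_iff h2] at *
  obtain ⟨b1, b2, b3⟩ := hb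
  obtain ⟨c1, c2, c3⟩ := hc
  rcases hg with hg | hg | hg
  · refine ⟨?_, ?_, ?_⟩ <;> apply mul_left_cancel₀ hg <;> grind
  · refine ⟨?_, ?_, ?_⟩ <;> apply mul_left_cancel₀ hg <;> grind
  · refine ⟨?_, ?_, ?_⟩ <;> apply mul_left_cancel₀ hg <;> grind

/-- The vertices of an icosahedron with centre the origin, shifted to the real part `φ / 2`;
here `φ` is a root of `φ ^ 2 = φ + 1` and `h = 1 / 2`. They are the elements with real part
`φ / 2` of the binary icosahedral group. -/
def icosahedron (h φ : F) : Set (UnitQuat F) :=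
  {p | p.w = h * φ ∧ (
    (p.x ^ 2 = h ^ 2 ∧ p.y ^ 2 = (h * (φ - 1)) ^ 2 ∧ p.z = 0) ∨
    (p.y ^ 2 = h ^ 2 ∧ p.z ^ 2 = (h * (φ - 1)) ^ 2 ∧ p.x = 0) ∨
    (p.z ^ 2 = h ^ 2 ∧ p.x ^ 2 = (h * (φ - 1)) ^ 2 ∧ p.y = 0))}

/-- The binary icosahedral group: the stabiliser of an icosahedron. -/
def icosahedralGroup (h φ : F) : Subgroup (UnitQuat F) :=
  Subgroup.normalizer (icosahedron h φ)

variable {h φ : F}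

theorem conj_mem_icosahedron {u p : UnitQuat F} (hu : u ∈ icosahedralGroup h φ)
    (hp : p ∈ icosahedron h φ) : u * p * u⁻¹ ∈ icosahedron h φ :=
  (Subgroup.mem_set_normalizer_iff.1 hu p).1 hp

theorem conj_w (u p : UnitQuat F) : (u * p * u⁻¹).w = p.w := by
  simp
  linear_combination p.w * u.norm_eq

theorem conj_qi_coords (p : UnitQuat F) : (qi * p * qi⁻¹).x = p.x ∧ (qi * p * qi⁻¹).y = -p.y ∧
    (qi * p * qi⁻¹).z = -p.z := by
  refine ⟨?_, ?_, ?_⟩ <;> simp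

theorem conj_qj_coords (p : UnitQuat F) : (qj * p * qj⁻¹).x = -p.x ∧ (qj * p * qj⁻¹).y = p.y ∧
    (qj * p * qj⁻¹).z = -p.z := by
  refine ⟨?_, ?_, ?_⟩ <;> simp

theorem conj_omega_coords (h2 : (2 : F) ≠ 0) (p : UnitQuat F) :
    (omega h2 * p * (omega h2)⁻¹).x = p.z ∧ (omega h2 * p * (omega h2)⁻¹).y = p.x ∧
    (omega h2 * p * (omega h2)⁻¹).z = p.y := by
  have h : (2 : F) * 2⁻¹ = 1 := mul_inv_cancel₀ h2
  refine ⟨?_, ?_, ?_⟩ <;> simp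
  · linear_combination (2 * 2⁻¹ + 1) * p.z * h
  · linear_combination (2 * 2⁻¹ + 1) * p.x * h
  · linear_combination (2 * 2⁻¹ + 1) * p.y * h

theorem qi_mem_icosahedralGroup [Finite F] : qi ∈ icosahedralGroup h φ := by
  refine Subgroup.mem_normalizer_fintype fun p ⟨hw, hp⟩ => ⟨(conj_w _ _).trans hw, ?_⟩
  obtain ⟨hx, hy, hz⟩ := conj_qi_coords p
  rw [hx, hy, hz]
  simpa using hp

theorem qj_mem_icosahedralGroup [Finite F] : qj ∈ icosahedralGroup h φ := by
  refine Subgroup.mem_normalizer_fintype fun p ⟨hw, hp⟩ => ⟨(conj_w _ _).trans hw, ?_⟩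
  obtain ⟨hx, hy, hz⟩ := conj_qj_coords p
  rw [hx, hy, hz]
  simpa using hp

theorem omega_mem_icosahedralGroup [Finite F] (h2 : (2 : F) ≠ 0) :
    omega h2 ∈ icosahedralGroup h φ := by
  refine Subgroup.mem_normalizer_fintype fun p ⟨hw, hp⟩ => ⟨(conj_w _ _).trans hw, ?_⟩
  obtain ⟨hx, hy, hz⟩ := conj_omega_coords h2 p
  rw [hx, hy, hz]
  tauto

theorem vertex_norm (hh : 2 * h = 1) (hφ : φ ^ 2 = φ + 1) :
    (h * φ) ^ 2 + h ^ 2 + (h * (φ - 1)) ^ 2 + 0 ^ 2 = 1 := by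
  linear_combination (2 * h + 1) * hh + 2 * h ^ 2 * hφ

/-- The vertex `(φ + i + (φ - 1) j) / 2` of the icosahedron. -/
def vertex (hh : 2 * h = 1) (hφ : φ ^ 2 = φ + 1) : UnitQuat F :=
  ⟨h * φ, h, h * (φ - 1), 0, vertex_norm hh hφ⟩

theorem vertex_mem (hh : 2 * h = 1) (hφ : φ ^ 2 = φ + 1) :
    vertex hh hφ ∈ icosahedron h φ := by
  refine ⟨rfl, Or.inl ⟨rfl, rfl, rfl⟩⟩

theorem conj_vertex_coords (hh : 2 * h = 1) (hφ : φ ^ 2 = φ + 1) (p : UnitQuat F) :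
    (vertex hh hφ * p * (vertex hh hφ)⁻¹).x = h * (φ * p.x + (φ - 1) * p.y + p.z) ∧
    (vertex hh hφ * p * (vertex hh hφ)⁻¹).y = h * ((φ - 1) * p.x + p.y - φ * p.z) ∧
    (vertex hh hφ * p * (vertex hh hφ)⁻¹).z = h * (-p.x + φ * p.y + (φ - 1) * p.z) := by
  refine ⟨?_, ?_, ?_⟩ <;> simp [vertex] <;> grind

theorem vertex_mem_icosahedralGroup [Finite F] (hh : 2 * h = 1) (hφ : φ ^ 2 = φ + 1) :
    vertex hh hφ ∈ icosahedralGroup h φ := by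
  refine Subgroup.mem_normalizer_fintype fun p ⟨hw, hp⟩ => ⟨(conj_w _ _).trans hw, ?_⟩
  obtain ⟨hx, hy, hz⟩ := conj_vertex_coords hh hφ p
  rw [hx, hy, hz]
  clear hx hy hz hw
  simp only [sq_eq_sq_iff_eq_or_eq_neg] at hp
  rcases hp with ⟨hx | hx, hy | hy, hz⟩ | ⟨hy | hy, hz | hz, hx⟩ | ⟨hz | hz, hx | hx, hy⟩ <;>
  rw [hx, hy, hz]
  · left; refine ⟨?_, ?_, ?_⟩ <;> grind
  · right; right; refine ⟨?_, ?_, ?_⟩ <;> grind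
  · right; right; refine ⟨?_, ?_, ?_⟩ <;> grind
  · left; refine ⟨?_, ?_, ?_⟩ <;> grind
  · right; right; refine ⟨?_, ?_, ?_⟩ <;> grind
  · right; left; refine ⟨?_, ?_, ?_⟩ <;> grind
  · right; left; refine ⟨?_, ?_, ?_⟩ <;> grind
  · right; right; refine ⟨?_, ?_, ?_⟩ <;> grind
  · left; refine ⟨?_, ?_, ?_⟩ <;> grind
  · right; left; refine ⟨?_, ?_, ?_⟩ <;> grind
  · right; left; refine ⟨?_, ?_, ?_⟩ <;> grind
  · left; refine ⟨?_, ?_, ?_⟩ <;> grind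

/-- The binary icosahedral group is transitive on the vertices of the icosahedron. -/
theorem exists_conj_vertex_eq [Finite F] (h2 : (2 : F) ≠ 0) (hh : 2 * h = 1) (hφ : φ ^ 2 = φ + 1)
    {p : UnitQuat F} (hp : p ∈ icosahedron h φ) :
    ∃ u ∈ icosahedralGroup h φ, u * vertex hh hφ * u⁻¹ = p := by
  have hi : (qi : UnitQuat F) ∈ icosahedralGroup h φ := qi_mem_icosahedralGroup
  have hj : (qj : UnitQuat F) ∈ icosahedralGroup h φ := qj_mem_icosahedralGroup
  have ho : omega h2 ∈ icosahedralGroup h φ := omega_mem_icosahedralGroup h2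
  -- a vertex with vanishing `z` is the image of the given one under `1`, `i`, `j` or `i j`
  have key : ∀ p : UnitQuat F, p.w = h * φ → p.x ^ 2 = h ^ 2 → p.y ^ 2 = (h * (φ - 1)) ^ 2 →
      p.z = 0 → ∃ u ∈ icosahedralGroup h φ, u * vertex hh hφ * u⁻¹ = p := by
    intro p hw hx hy hz
    obtain ⟨ix, iy, iz⟩ := conj_qi_coords (vertex hh hφ)
    obtain ⟨jx, jy, jz⟩ := conj_qj_coords (vertex hh hφ)
    have iw := conj_w qi (vertex hh hφ)
    have jw := conj_w qj (vertex hh hφ)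
    rw [sq_eq_sq_iff_eq_or_eq_neg] at hx hy
    rcases hx with hx | hx <;> rcases hy with hy | hy
    · refine ⟨1, Subgroup.one_mem _, ?_⟩
      rw [one_mul, inv_one, mul_one]
      ext <;> simp only [hw, hx, hy, hz, vertex]
    · refine ⟨qi, hi, ?_⟩
      ext <;> simp only [hw, hx, hy, hz, ix, iy, iz, iw] <;> simp [vertex]
    · refine ⟨qj, hj, ?_⟩
      ext <;> simp only [hw, hx, hy, hz, jx, jy, jz, jw] <;> simp [vertex]
    · obtain ⟨kx, ky, kz⟩ := conj_qi_coords (qj * vertex hh hφ * qj⁻¹)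
      have kw := conj_w qi (qj * vertex hh hφ * qj⁻¹)
      refine ⟨qi * qj, Subgroup.mul_mem _ hi hj, ?_⟩
      rw [conj_mul]
      ext <;> simp only [hw, hx, hy, hz, jx, jy, jz, jw, kx, ky, kz, kw] <;> simp [vertex]
  have hrot : ∀ p : UnitQuat F, (∃ u ∈ icosahedralGroup h φ, u * vertex hh hφ * u⁻¹ =
      omega h2 * p * (omega h2)⁻¹) → ∃ u ∈ icosahedralGroup h φ, u * vertex hh hφ * u⁻¹ = p := by
    rintro p ⟨u, hu, h⟩
    refine ⟨(omega h2)⁻¹ * u, Subgroup.mul_mem _ (Subgroup.inv_mem _ ho) hu, ?_⟩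
    rw [conj_mul, h]
    group
  obtain ⟨hw, hp | hp | hp⟩ := hp
  · exact key p hw hp.1 hp.2.1 hp.2.2
  · obtain ⟨ox, oy, oz⟩ := conj_omega_coords h2 p
    obtain ⟨ox', oy', oz'⟩ := conj_omega_coords h2 (omega h2 * p * (omega h2)⁻¹)
    refine hrot _ (hrot _ (key _ ?_ ?_ ?_ ?_))
    · rw [conj_w, conj_w, hw]
    · rw [ox', oz, hp.1]
    · rw [oy', ox, hp.2.1]
    · rw [oz', oy, hp.2.2]
  · obtain ⟨ox, oy, oz⟩ := conj_omega_coords h2 p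
    refine hrot _ (key _ ?_ ?_ ?_ ?_)
    · rw [conj_w, hw]
    · rw [ox, hp.1]
    · rw [oy, hp.2.1]
    · rw [oz, hp.2.2]

end UnitQuat

end Icosahedral

/-! ### The order of the binary icosahedral group -/

section IcosahedralOrder

namespace UnitQuat

variable {F : Type*} [Field F] {h φ : F}

theorem half_ne_zero (hh : 2 * h = 1) : h ≠ 0 := by
  rintro rfl
  simp at hh

theorem sub_one_ne_zero (hφ : φ ^ 2 = φ + 1) : φ - 1 ≠ 0 := fun hz => by
  have : φ * (φ - 1) = 1 := by linear_combination hφ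
  simp [hz] at this

/-- A set of unit quaternions with fixed real part, in terms of the imaginary parts. -/
theorem card_eq_card_imaginary {w : F} {P : F → F → F → Prop}
    (hP : ∀ x y z, P x y z → w ^ 2 + x ^ 2 + y ^ 2 + z ^ 2 = 1) :
    Nat.card {p : UnitQuat F | p.w = w ∧ P p.x p.y p.z} =
      Nat.card {v : F × F × F | P v.1 v.2.1 v.2.2} :=
  Nat.card_congr
    { toFun := fun p => ⟨(p.1.x, p.1.y, p.1.z), p.2.2⟩
      invFun := fun v => ⟨⟨w, v.1.1, v.1.2.1, v.1.2.2, hP _ _ _ v.2⟩, rfl, v.2⟩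
      left_inv := fun p => Subtype.ext (UnitQuat.ext p.2.1.symm rfl rfl rfl)
      right_inv := fun _ => rfl }

theorem icosahedron_norm (hh : 2 * h = 1) (hφ : φ ^ 2 = φ + 1) (x y z : F) (hP :
    (x ^ 2 = h ^ 2 ∧ y ^ 2 = (h * (φ - 1)) ^ 2 ∧ z = 0) ∨
    (y ^ 2 = h ^ 2 ∧ z ^ 2 = (h * (φ - 1)) ^ 2 ∧ x = 0) ∨
    (z ^ 2 = h ^ 2 ∧ x ^ 2 = (h * (φ - 1)) ^ 2 ∧ y = 0)) :
    (h * φ) ^ 2 + x ^ 2 + y ^ 2 + z ^ 2 = 1 := by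
  have hn := vertex_norm hh hφ
  rcases hP with ⟨h1, h2, h3⟩ | ⟨h1, h2, h3⟩ | ⟨h1, h2, h3⟩ <;> rw [h1, h2, h3] <;>
    linear_combination hn

theorem card_icosahedron [Finite F] (hh : 2 * h = 1) (hφ : φ ^ 2 = φ + 1) :
    Nat.card (icosahedron h φ) = 12 := by
  have ha0 : h ≠ 0 := half_ne_zero hh
  have hb0 : h * (φ - 1) ≠ 0 := mul_ne_zero ha0 (sub_one_ne_zero hφ)
  have ha : h ≠ -h := fun e => one_ne_zero (by linear_combination e - hh : (1 : F) = 0)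
  have hb : h * (φ - 1) ≠ -(h * (φ - 1)) := fun e => sub_one_ne_zero hφ (by
    linear_combination e - (φ - 1) * hh)
  refine (card_eq_card_imaginary (icosahedron_norm hh hφ)).trans ?_
  generalize h * (φ - 1) = b at *
  have hset : {v : F × F × F | (v.1 ^ 2 = h ^ 2 ∧ v.2.1 ^ 2 = b ^ 2 ∧ v.2.2 = 0) ∨
      (v.2.1 ^ 2 = h ^ 2 ∧ v.2.2 ^ 2 = b ^ 2 ∧ v.1 = 0) ∨
      (v.2.2 ^ 2 = h ^ 2 ∧ v.1 ^ 2 = b ^ 2 ∧ v.2.1 = 0)} =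
      ({h, -h} : Set F) ×ˢ (({b, -b} : Set F) ×ˢ ({0} : Set F)) ∪
      (({0} : Set F) ×ˢ (({h, -h} : Set F) ×ˢ ({b, -b} : Set F)) ∪
      ({b, -b} : Set F) ×ˢ (({0} : Set F) ×ˢ ({h, -h} : Set F))) := by
    ext ⟨x, y, z⟩
    simp only [sq_eq_sq_iff_eq_or_eq_neg, Set.mem_ofPred_eq, Set.mem_union, Set.mem_prod,
      Set.mem_insert_iff, Set.mem_singleton_iff]
    exact or_congr Iff.rfl (or_congr ⟨fun ⟨a, b, c⟩ => ⟨c, a, b⟩, fun ⟨a, b, c⟩ => ⟨b, c, a⟩⟩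
      ⟨fun ⟨a, b, c⟩ => ⟨b, c, a⟩, fun ⟨a, b, c⟩ => ⟨c, a, b⟩⟩)
  rw [hset, Nat.card_coe_set_eq, Set.ncard_union_eq, Set.ncard_union_eq]
  · simp only [Set.ncard_prod, Set.ncard_pair ha, Set.ncard_pair hb, Set.ncard_singleton]
  · rw [Set.disjoint_left]
    rintro ⟨x, y, z⟩ ⟨h1, h2, h3⟩ ⟨h4, h5, h6⟩
    simp only [Set.mem_insert_iff, Set.mem_singleton_iff] at *
    grind
  · rw [Set.disjoint_left]
    rintro ⟨x, y, z⟩ ⟨h1, h2, h3⟩ (⟨h4, h5, h6⟩ | ⟨h4, h5, h6⟩) <;>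
    simp only [Set.mem_insert_iff, Set.mem_singleton_iff] at * <;>
    grind

/-- The five neighbours of the vertex `(φ + i + (φ - 1) j) / 2`. -/
def neighbours (h φ : F) : Set (UnitQuat F) :=
  {p | p ∈ icosahedron h φ ∧ p.x + (φ - 1) * p.y = h * (φ - 1)}

theorem neighbours_cases (hh : 2 * h = 1) (hφ : φ ^ 2 = φ + 1) {p : UnitQuat F}
    (hp : p ∈ neighbours h φ) :
    (p.x = h ∧ p.y = -(h * (φ - 1)) ∧ p.z = 0) ∨ (p.x = h * (φ - 1) ∧ p.y = 0 ∧ p.z = -h) ∨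
    (p.x = 0 ∧ p.y = h ∧ p.z = -(h * (φ - 1))) ∨ (p.x = 0 ∧ p.y = h ∧ p.z = h * (φ - 1)) ∨
    (p.x = h * (φ - 1) ∧ p.y = 0 ∧ p.z = h) := by
  obtain ⟨⟨-, hp⟩, he⟩ := hp
  have hn := sub_one_ne_zero hφ
  simp only [sq_eq_sq_iff_eq_or_eq_neg] at hp
  rcases hp with ⟨hx | hx, hy | hy, hz⟩ | ⟨hy | hy, hz | hz, hx⟩ | ⟨hz | hz, hx | hx, hy⟩ <;>
  rw [hx, hy, hz] <;> rw [hx, hy] at he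
  · exfalso; grind
  · simp
  · exfalso; grind
  · exfalso; grind
  · simp
  · simp
  · exfalso; grind
  · exfalso; grind
  · simp
  · exfalso; grind
  · simp
  · exfalso; grind

theorem card_neighbours (hh : 2 * h = 1) (hφ : φ ^ 2 = φ + 1) :
    Nat.card (neighbours h φ) = 5 := by
  have ha0 : h ≠ 0 := half_ne_zero hh
  have hb0 : h * (φ - 1) ≠ 0 := mul_ne_zero ha0 (sub_one_ne_zero hφ)
  have ha : -h ≠ h := fun e => one_ne_zero (by linear_combination -e - hh : (1 : F) = 0)
  have hb : -(h * (φ - 1)) ≠ h * (φ - 1) := fun e => sub_one_ne_zero hφ (by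
    linear_combination -e - (φ - 1) * hh)
  have hn := vertex_norm hh hφ
  let E : Set (F × F × F) := {(h, -(h * (φ - 1)), 0), (h * (φ - 1), 0, -h),
    (0, h, -(h * (φ - 1))), (0, h, h * (φ - 1)), (h * (φ - 1), 0, h)}
  have hE : ∀ x y z, (x, y, z) ∈ E ↔ (x = h ∧ y = -(h * (φ - 1)) ∧ z = 0) ∨
      (x = h * (φ - 1) ∧ y = 0 ∧ z = -h) ∨ (x = 0 ∧ y = h ∧ z = -(h * (φ - 1))) ∨
      (x = 0 ∧ y = h ∧ z = h * (φ - 1)) ∨ (x = h * (φ - 1) ∧ y = 0 ∧ z = h) := fun x y z => by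
    simp only [E, Set.mem_insert_iff, Set.mem_singleton_iff, Prod.mk.injEq]
  have hset : neighbours h φ = {p | p.w = h * φ ∧ (p.x, p.y, p.z) ∈ E} := by
    ext p
    constructor
    · intro hp
      refine ⟨hp.1.1, ?_⟩
      exact (hE _ _ _).2 (neighbours_cases hh hφ hp)
    · rintro ⟨hw, hp⟩
      rcases (hE _ _ _).1 hp with ⟨hx, hy, hz⟩ | ⟨hx, hy, hz⟩ | ⟨hx, hy, hz⟩ | ⟨hx, hy, hz⟩ | ⟨hx, hy, hz⟩
      all_goals
        refine ⟨⟨hw, ?_⟩, ?_⟩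
        · simp [hx, hy, hz]
        · rw [hx, hy]
          first | ring1 | linear_combination -h * hφ
  rw [hset]
  refine (card_eq_card_imaginary (P := fun x y z => (x, y, z) ∈ E) fun x y z hp => ?_).trans ?_
  · rcases (hE _ _ _).1 hp with ⟨rfl, rfl, rfl⟩ | ⟨rfl, rfl, rfl⟩ | ⟨rfl, rfl, rfl⟩ |
      ⟨rfl, rfl, rfl⟩ | ⟨rfl, rfl, rfl⟩ <;> linear_combination hn
  · change Nat.card E = 5
    unfold E
    generalize h * (φ - 1) = b at *
    rw [Nat.card_coe_set_eq, Set.ncard_insert_of_notMem, Set.ncard_insert_of_notMem,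
      Set.ncard_insert_of_notMem, Set.ncard_pair] <;>
    simp [ha0, hb0, ha, hb]

/-- The order of the binary icosahedral group: it is transitive on the twelve vertices, the
stabiliser of a vertex is transitive on the five neighbours, and only `± 1` fixes two
neighbours. -/
theorem card_icosahedralGroup [Finite F] (h2 : (2 : F) ≠ 0) (hh : 2 * h = 1)
    (hφ : φ ^ 2 = φ + 1) : Nat.card (icosahedralGroup h φ) = 2 * 60 := by
  have hg := vertex_mem_icosahedralGroup hh hφ
  have ha0 : h ≠ 0 := half_ne_zero hh
  have hb0 : φ - 1 ≠ 0 := sub_one_ne_zero hφ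
  obtain ⟨g, hgdef⟩ : ∃ g, g = vertex hh hφ := ⟨_, rfl⟩
  let p : UnitQuat F := ⟨h * φ, h, -(h * (φ - 1)), 0, by
    linear_combination vertex_norm hh hφ⟩
  have hp : p ∈ icosahedron h φ := ⟨rfl, Or.inl ⟨rfl, neg_sq _, rfl⟩⟩
  rw [card_eq_card_centralizer_mul (icosahedralGroup h φ) (icosahedron h φ) g,
    card_icosahedron hh hφ, card_eq_card_centralizer_mul _ (neighbours h φ) p,
    card_neighbours hh hφ, card_eq_two_of_scalars h2]
  · exact ⟨⟨neg_one_mem_normalizer _, neg_one_mem_centralizer _⟩, neg_one_mem_centralizer _⟩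
  · rintro u ⟨⟨-, hug⟩, hup⟩
    have hug := Subgroup.mem_centralizer_singleton_iff.1 hug
    have hup := Subgroup.mem_centralizer_singleton_iff.1 hup
    rw [commute_iff h2] at hug hup
    simp only [hgdef, vertex, p] at hug hup
    have hz : u.z = 0 := by
      apply mul_left_cancel₀ ha0
      linear_combination hug.2.1
    have hy : u.y = 0 := by
      apply mul_left_cancel₀ ha0
      linear_combination -h * (hug.2.2 + hup.2.2) - h * u.y * hh
    have hx : u.x = 0 := by
      apply mul_left_cancel₀ (mul_ne_zero ha0 hb0)
      rw [hy] at hug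
      linear_combination hug.2.2
    exact eq_one_or_neg_one hx hy hz
  · rintro u ⟨hu, hug⟩
    have hug := Subgroup.mem_centralizer_singleton_iff.1 hug
    refine ⟨conj_mem_icosahedron hu hp, ?_⟩
    -- the real part of `g q` is the same for `q = p` and for its conjugate `q` by `u`
    have hw := conj_w u p
    have hre : (g * (u * p * u⁻¹)).w = (g * p).w := by
      rw [show g * (u * p * u⁻¹) = u * (g * p) * u⁻¹ by
        rw [← mul_assoc, ← mul_assoc, ← mul_assoc, hug], conj_w]
    generalize u * p * u⁻¹ = q at *
    rw [mul_w, mul_w, hw, hgdef] at hre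
    simp only [vertex] at hre
    apply mul_left_cancel₀ ha0
    simp only [p] at hre
    linear_combination -hre - h ^ 2 * hφ
  · let R : UnitQuat F → Prop := fun q => ∃ u ∈ icosahedralGroup h φ ⊓ Subgroup.centralizer {g},
      u * p * u⁻¹ = q
    have hgC : g ∈ icosahedralGroup h φ ⊓ Subgroup.centralizer {g} :=
      ⟨hgdef ▸ hg, Subgroup.mem_centralizer_singleton_iff.2 rfl⟩
    have hstep : ∀ q, R q → R (g * q * g⁻¹) := by
      rintro q ⟨u, hu, rfl⟩
      exact ⟨g * u, Subgroup.mul_mem _ hgC hu, conj_mul g u p⟩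
    have hR0 : R p := ⟨1, Subgroup.one_mem _, by simp⟩
    have hpw : p.w = h * φ := rfl
    have hpx : p.x = h := rfl
    have hpy : p.y = -(h * (φ - 1)) := rfl
    have hpz : p.z = 0 := rfl
    have hcoord : ∀ q : UnitQuat F, (g * q * g⁻¹).x = h * (φ * q.x + (φ - 1) * q.y + q.z) ∧
        (g * q * g⁻¹).y = h * ((φ - 1) * q.x + q.y - φ * q.z) ∧
        (g * q * g⁻¹).z = h * (-q.x + φ * q.y + (φ - 1) * q.z) := fun q => by
      rw [hgdef]
      exact conj_vertex_coords hh hφ q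
    -- conjugation by `g` permutes the neighbours cyclically
    obtain ⟨x1, y1, z1⟩ := hcoord p
    obtain ⟨x2, y2, z2⟩ := hcoord (g * p * g⁻¹)
    obtain ⟨x3, y3, z3⟩ := hcoord (g * (g * p * g⁻¹) * g⁻¹)
    obtain ⟨x4, y4, z4⟩ := hcoord (g * (g * (g * p * g⁻¹) * g⁻¹) * g⁻¹)
    have hR1 := hstep _ hR0
    have hR2 := hstep _ hR1
    have hR3 := hstep _ hR2
    have hR4 := hstep _ hR3
    have w1 := conj_w g p
    have w2 := conj_w g (g * p * g⁻¹)
    have w3 := conj_w g (g * (g * p * g⁻¹) * g⁻¹)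
    have w4 := conj_w g (g * (g * (g * p * g⁻¹) * g⁻¹) * g⁻¹)
    generalize g * (g * (g * (g * p * g⁻¹) * g⁻¹) * g⁻¹) * g⁻¹ = p4 at *
    generalize g * (g * (g * p * g⁻¹) * g⁻¹) * g⁻¹ = p3 at *
    generalize g * (g * p * g⁻¹) * g⁻¹ = p2 at *
    generalize g * p * g⁻¹ = p1 at *
    clear_value p
    clear hstep hcoord hg hgC
    rw [hpw] at w1
    rw [w1] at w2
    rw [w2] at w3
    rw [w3] at w4
    rw [hpx, hpy, hpz] at x1 y1 z1
    replace x1 : p1.x = h * (φ - 1) := by rw [x1]; grind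
    replace y1 : p1.y = 0 := by rw [y1]; grind
    replace z1 : p1.z = -h := by
      rw [z1]
      linear_combination -h ^ 2 * hφ - h * hh
    rw [x1, y1, z1] at x2 y2 z2
    replace x2 : p2.x = 0 := by rw [x2]; grind
    replace y2 : p2.y = h := by rw [y2]; grind
    replace z2 : p2.z = -(h * (φ - 1)) := by rw [z2]; grind
    rw [x2, y2, z2] at x3 y3 z3
    replace x3 : p3.x = 0 := by rw [x3]; grind
    replace y3 : p3.y = h := by rw [y3]; grind
    replace z3 : p3.z = h * (φ - 1) := by rw [z3]; grind
    rw [x3, y3, z3] at x4 y4 z4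
    replace x4 : p4.x = h * (φ - 1) := by
      rw [x4]
      linear_combination h * (φ - 1) * hh
    replace y4 : p4.y = 0 := by rw [y4]; grind
    replace z4 : p4.z = h := by
      rw [z4]
      linear_combination h ^ 2 * hφ + h * hh
    intro q hq
    have hqw := hq.1.1
    rcases neighbours_cases hh hφ hq with ⟨hx, hy, hz⟩ | ⟨hx, hy, hz⟩ | ⟨hx, hy, hz⟩ |
      ⟨hx, hy, hz⟩ | ⟨hx, hy, hz⟩
    · rwa [show q = p from UnitQuat.ext (by rw [hqw, hpw]) (by rw [hx, hpx]) (by rw [hy, hpy])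
        (by rw [hz, hpz])]
    · rwa [show q = p1 from UnitQuat.ext (by rw [hqw, w1]) (by rw [hx, x1]) (by rw [hy, y1])
        (by rw [hz, z1])]
    · rwa [show q = p2 from UnitQuat.ext (by rw [hqw, w2]) (by rw [hx, x2]) (by rw [hy, y2])
        (by rw [hz, z2])]
    · rwa [show q = p3 from UnitQuat.ext (by rw [hqw, w3]) (by rw [hx, x3]) (by rw [hy, y3])
        (by rw [hz, z3])]
    · rwa [show q = p4 from UnitQuat.ext (by rw [hqw, w4]) (by rw [hx, x4]) (by rw [hy, y4])
        (by rw [hz, z4])]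
  · intro u hu
    exact conj_mem_icosahedron hu (hgdef ▸ vertex_mem hh hφ)
  · intro x hx
    rw [hgdef]
    exact exists_conj_vertex_eq h2 hh hφ hx

end UnitQuat

end IcosahedralOrder

/-! ### The subdegree of the icosahedral group -/

section IcosahedralSubdegree

namespace UnitQuat

variable {F : Type*} [Field F] {h φ : F}

theorem anticommute_qi (h2 : (2 : F) ≠ 0) {u : UnitQuat F} (hu : u * qi = -(qi * u)) :
    u.w = 0 ∧ u.x = 0 := by
  have hw := congrArg UnitQuat.w hu
  have hx := congrArg UnitQuat.x hu
  simp only [mul_w, mul_x, neg_w, neg_x, qi_w, qi_x, qi_y, qi_z] at hw hx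
  constructor <;> apply mul_left_cancel₀ h2
  · linear_combination hx
  · linear_combination -hw

/-- In the icosahedral rotation group, the centraliser of the half turn about the axis `i` consists
of the half turns about the axes `i`, `j`, `k` and the identity. -/
theorem coord_of_commute_qi [Finite F] (h2 : (2 : F) ≠ 0) (hh : 2 * h = 1) (hφ : φ ^ 2 = φ + 1)
    {u : UnitQuat F} (hu : u ∈ icosahedralGroup h φ) (hc : u * qi = qi * u) :
    u.w = 0 ∨ u.x = 0 := by
  obtain ⟨hy, hz⟩ := (commute_qi_iff h2 u).1 hc
  have hb := sub_one_ne_zero hφ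
  have h0 := half_ne_zero hh
  have hn := u.norm_eq
  rw [hy, hz] at hn
  obtain ⟨-, hq⟩ := conj_mem_icosahedron hu (vertex_mem hh hφ)
  have hqx : (u * vertex hh hφ * u⁻¹).x = h := by
    simp [vertex, hy, hz]
    linear_combination h * hn
  have hqz : (u * vertex hh hφ * u⁻¹).z = (φ - 1) * (u.w * u.x) := by
    simp [vertex, hy, hz]
    linear_combination (φ - 1) * (u.w * u.x) * hh
  rw [hqx, hqz] at hq
  rcases hq with ⟨-, -, hq⟩ | ⟨-, -, hq⟩ | ⟨-, hq, -⟩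
  · simpa [hb] using hq
  · exact absurd hq h0
  · exfalso
    have h1 : φ * (2 - φ) = 0 := by
      apply mul_left_cancel₀ (pow_ne_zero 2 h0)
      linear_combination hq
    have h3 : φ = 1 := by linear_combination h1 + hφ
    exact hb (by rw [h3, sub_self])

/-- An element of the binary icosahedral group that anticommutes with `i` is `± j` or `± k`. -/
theorem coord_of_anticommute_qi [Finite F] (h2 : (2 : F) ≠ 0) (hh : 2 * h = 1)
    (hφ : φ ^ 2 = φ + 1) {u : UnitQuat F} (hu : u ∈ icosahedralGroup h φ)
    (hc : u * qi = -(qi * u)) : u.y = 0 ∨ u.z = 0 := by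
  obtain ⟨hw, hx⟩ := anticommute_qi h2 hc
  have h1 := coord_of_commute_qi h2 hh hφ (Subgroup.mul_mem _ hu qj_mem_icosahedralGroup)
    ((commute_qi_iff h2 _).2 (by simp [hw, hx]))
  simpa [hw, hx] using h1

theorem inv_mem_icosahedron {p : UnitQuat F} (hp : p ∈ icosahedron h φ) :
    p⁻¹ ∈ icosahedron h φ := by
  obtain ⟨hw, hp⟩ := hp
  refine ⟨hw, ?_⟩
  simpa using hp

/-- Commuting unit quaternions with the same real part are equal or inverse, unless their imaginary
parts have norm zero. -/
theorem eq_or_eq_inv_of_commute (h2 : (2 : F) ≠ 0) {p q : UnitQuat F} (hpq : p * q = q * p)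
    (hw : p.w = q.w) (hn : q.w ^ 2 ≠ 1) : p = q ∨ p = q⁻¹ := by
  obtain ⟨h1, h3, h4⟩ := (commute_iff h2 p q).1 hpq
  have hp := p.norm_eq
  have hq := q.norm_eq
  rw [hw] at hp
  have hd : 1 - q.w ^ 2 ≠ 0 := fun e => hn (by linear_combination -e)
  obtain ⟨s, hs⟩ : ∃ s, s = p.x * q.x + p.y * q.y + p.z * q.z := ⟨_, rfl⟩
  have hsq : s ^ 2 = (1 - q.w ^ 2) ^ 2 := by
    rw [hs]
    linear_combination (p.x ^ 2 + p.y ^ 2 + p.z ^ 2) * hq + (1 - q.w ^ 2) * hp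
      - (p.y * q.z - p.z * q.y) * h1 - (p.z * q.x - p.x * q.z) * h3
      - (p.x * q.y - p.y * q.x) * h4
  have hx : (1 - q.w ^ 2) * p.x = s * q.x := by
    rw [hs]
    linear_combination -p.x * hq - q.z * h3 + q.y * h4
  have hy : (1 - q.w ^ 2) * p.y = s * q.y := by
    rw [hs]
    linear_combination -p.y * hq + q.z * h1 - q.x * h4
  have hz : (1 - q.w ^ 2) * p.z = s * q.z := by
    rw [hs]
    linear_combination -p.z * hq - q.y * h1 + q.x * h3
  rcases sq_eq_sq_iff_eq_or_eq_neg.1 hsq with h | h <;> rw [h] at hx hy hz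
  · exact Or.inl (UnitQuat.ext hw (mul_left_cancel₀ hd hx) (mul_left_cancel₀ hd hy)
      (mul_left_cancel₀ hd hz))
  · right
    refine UnitQuat.ext hw ?_ ?_ ?_ <;> apply mul_left_cancel₀ hd
    · rw [hx, inv_x]; ring
    · rw [hy, inv_y]; ring
    · rw [hz, inv_z]; ring

/-- `φ / 2` is the cosine of a tenth of a full turn. -/
theorem pow_five_of_real_part (hh : 2 * h = 1) (hφ : φ ^ 2 = φ + 1) {t : UnitQuat F}
    (ht : t.w = h * φ) : t ^ 5 = -1 := by
  have hn := t.norm_eq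
  have h3 : t * t * t = -(t * t)⁻¹ := by
    have hv : t.x ^ 2 + t.y ^ 2 + t.z ^ 2 = 1 - (h * φ) ^ 2 := by
      rw [ht] at hn
      linear_combination hn
    have hw : (t * t).w = h * (φ - 1) := by
      simp only [mul_w, ht]
      linear_combination -hv + 2 * h ^ 2 * hφ + (h * φ + h + 1) * hh
    have hx : (t * t).x = φ * t.x := by
      simp only [mul_x, ht]
      linear_combination φ * t.x * hh
    have hy : (t * t).y = φ * t.y := by
      simp only [mul_y, ht]
      linear_combination φ * t.y * hh
    have hz : (t * t).z = φ * t.z := by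
      simp only [mul_z, ht]
      linear_combination φ * t.z * hh
    generalize t * t = r at *
    ext
    · rw [mul_w, neg_w, inv_w, hw, hx, hy, hz, ht]
      linear_combination -φ * hv + h ^ 2 * (φ + 2) * hφ + (h * (φ + 1) + φ) * hh
    · rw [mul_x, neg_x, inv_x, hw, hx, hy, hz, ht]
      linear_combination h * t.x * hφ + φ * t.x * hh
    · rw [mul_y, neg_y, inv_y, hw, hx, hy, hz, ht]
      linear_combination h * t.y * hφ + φ * t.y * hh
    · rw [mul_z, neg_z, inv_z, hw, hx, hy, hz, ht]
      linear_combination h * t.z * hφ + φ * t.z * hh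
  rw [show t ^ 5 = t * t * t * (t * t) by simp only [pow_succ, pow_zero, one_mul, mul_assoc],
    h3, neg_mul, inv_mul_cancel]

theorem real_part_sq_ne_one (h5 : (5 : F) ≠ 0) (hh : 2 * h = 1) (hφ : φ ^ 2 = φ + 1) :
    (h * φ) ^ 2 ≠ 1 := fun e => h5 (by
  have : 3 - φ = 0 := by linear_combination hφ - 4 * e + φ ^ 2 * (2 * h + 1) * hh
  linear_combination (2 + φ) * this + hφ)

/-- An element of the binary icosahedral group with real part `φ / 2` is a vertex: it induces a
permutation of order five of the twelve vertices, so it commutes with one of them. -/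
theorem mem_icosahedron_of_real_part [Finite F] (h2 : (2 : F) ≠ 0) (h5 : (5 : F) ≠ 0)
    (hh : 2 * h = 1) (hφ : φ ^ 2 = φ + 1) {t : UnitQuat F} (ht : t ∈ icosahedralGroup h φ)
    (htw : t.w = h * φ) : t ∈ icosahedron h φ := by
  have : Fintype (icosahedron h φ) := Fintype.ofFinite _
  have : Fact (Nat.Prime 5) := ⟨by norm_num⟩
  let σ : Equiv.Perm (icosahedron h φ) := (MulAut.conj t).toEquiv.subtypeEquiv fun p =>
    Subgroup.mem_set_normalizer_iff.1 ht p
  have hσ : ∀ (n : ℕ) (p : icosahedron h φ), (((σ ^ n) p : icosahedron h φ) : UnitQuat F) =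
      t ^ n * p * (t ^ n)⁻¹ := by
    intro n
    induction n with
    | zero => simp
    | succ n ih =>
      intro p
      rw [pow_succ', Equiv.Perm.mul_apply]
      change t * ((σ ^ n) p : icosahedron h φ) * t⁻¹ = _
      rw [ih, pow_succ' t, conj_mul]
  have hσ5 : σ ^ 5 ^ 1 = 1 := by
    ext1 p
    refine Subtype.ext ?_
    rw [hσ, pow_one, pow_five_of_real_part hh hφ htw, mul_inv_eq_iff_eq_mul]
    simp
  have hcard : ¬ 5 ∣ Fintype.card (icosahedron h φ) := by
    rw [← Nat.card_eq_fintype_card, card_icosahedron hh hφ]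
    norm_num
  obtain ⟨⟨p, hp⟩, hfix⟩ := Equiv.Perm.exists_fixed_point_of_prime hcard hσ5
  have hfix : t * p * t⁻¹ = p := congrArg Subtype.val hfix
  rcases eq_or_eq_inv_of_commute h2 (mul_inv_eq_iff_eq_mul.1 hfix) (htw.trans hp.1.symm) (by
    rw [hp.1]
    exact real_part_sq_ne_one h5 hh hφ) with rfl | rfl
  · exact hp
  · exact inv_mem_icosahedron hp

theorem icosahedron_subset [Finite F] (h2 : (2 : F) ≠ 0) (hh : 2 * h = 1) (hφ : φ ^ 2 = φ + 1)
    {p : UnitQuat F} (hp : p ∈ icosahedron h φ) : p ∈ icosahedralGroup h φ := by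
  obtain ⟨u, hu, rfl⟩ := exists_conj_vertex_eq h2 hh hφ hp
  exact Subgroup.mul_mem _ (Subgroup.mul_mem _ hu (vertex_mem_icosahedralGroup hh hφ))
    (Subgroup.inv_mem _ hu)

/-- The binary icosahedral group is self-normalising: its elements with real part `φ / 2`, which are
the vertices of the icosahedron, are permuted by its normaliser. -/
theorem mem_icosahedralGroup_of_conj [Finite F] (h2 : (2 : F) ≠ 0) (h5 : (5 : F) ≠ 0)
    (hh : 2 * h = 1) (hφ : φ ^ 2 = φ + 1) {x : UnitQuat F}
    (hx : ∀ a ∈ icosahedralGroup h φ, x⁻¹ * a * x ∈ icosahedralGroup h φ) :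
    x ∈ icosahedralGroup h φ := by
  rw [← Subgroup.inv_mem_iff]
  refine Subgroup.mem_normalizer_fintype fun p hp => ?_
  have h1 := hx p (icosahedron_subset h2 hh hφ hp)
  rw [← inv_inv x, inv_inv x⁻¹] at h1
  exact mem_icosahedron_of_real_part h2 h5 hh hφ (by simpa using h1) ((conj_w _ _).trans hp.1)

/-- In the group `T` of unit quaternions up to sign, the centralisers of the nontrivial elements that
are not involutions are abelian. -/
theorem commute_of_commute_of_cover {T : Type*} [Group T] (h2 : (2 : F) ≠ 0) {π : UnitQuat F →* T}
    (hsurj : Function.Surjective π) (hπ : ∀ p q, π p = π q ↔ p = q ∨ p = -q) (s b c : T)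
    (hs : s * s ≠ 1) (hb : s * b = b * s) (hc : s * c = c * s) : b * c = c * b := by
  obtain ⟨s, rfl⟩ := hsurj s
  obtain ⟨b, rfl⟩ := hsurj b
  obtain ⟨c, rfl⟩ := hsurj c
  rw [← map_mul, ← map_one π, Ne, hπ] at hs
  -- a quaternion conjugate to its negative has real part zero and square `-1`
  have key : ∀ d, π s * π d = π d * π s → s * d = d * s := by
    intro d hd
    rw [← map_mul, ← map_mul, hπ] at hd
    refine hd.resolve_right fun hd => hs (Or.inr ?_)
    have hw : s.w = 0 := by
      have h1 := conj_w d⁻¹ s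
      rw [inv_inv, mul_assoc, hd, mul_neg, inv_mul_cancel_left, neg_w] at h1
      apply mul_left_cancel₀ h2
      linear_combination -h1
    have hn := s.norm_eq
    rw [hw] at hn
    ext <;> simp [hw]
    · linear_combination -hn
    · ring
    · ring
    · ring
  have hb := key b hb
  have hc := key c hc
  rw [← map_mul, ← map_mul, commute_of_commute h2 ?_ hb hc]
  by_contra! hcon
  refine hs (Or.inl ?_)
  rcases eq_one_or_neg_one hcon.1 hcon.2.1 hcon.2.2 with h | h <;> simp [h]

/-- The icosahedral group `A ≅ Alt(5)` is self-normalising. A half turn `y = β j + γ k` in general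
position commutes with the half turn `i ∈ A`, and `i` is the only nontrivial element of
`A ∩ A ^ y` that commutes with `i`. So `exists_conj_mem_iff_commute` applies. -/
theorem icosahedral_index_pow_mem_subdegrees_of_half_turn [Finite F] (h2 : (2 : F) ≠ 0)
    (h5 : (5 : F) ≠ 0) (hh : 2 * h = 1) (hφ : φ ^ 2 = φ + 1) {β γ : F} (hβγ : β ^ 2 + γ ^ 2 = 1)
    (hβ : β ≠ 0) (hγ : γ ≠ 0) (hne : β ^ 2 ≠ γ ^ 2) {m : ℕ} [NeZero m] (hm : 2 ≤ m)
    (α : GPoints m PSL(2, F)) :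
    (Nat.card PSL(2, F) / 60) ^ m ∈ subdegrees (GTW m PSL(2, F)) α := by
  obtain ⟨π, hsurj, hπ⟩ := exists_cover_PSL2 F h2
  have : Finite PSL(2, F) := Finite.of_surjective _ hsurj
  have hneg : -1 ∈ icosahedralGroup h φ := neg_one_mem_normalizer _
  have hmem := mem_map_iff_of_cover hπ hneg
  obtain ⟨y, hy⟩ : ∃ y : UnitQuat F, y = ⟨0, 0, β, γ, by linear_combination hβγ⟩ := ⟨_, rfl⟩
  have hyi : y * qi = -(qi * y) := by ext <;> simp [hy]
  have hyA : y ∉ icosahedralGroup h φ := fun hyA => by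
    have := coord_of_anticommute_qi h2 hh hφ hyA hyi
    simp [hy, hβ, hγ] at this
  have hyinv : y⁻¹ = -y := by ext <;> simp [hy]
  have hy2 : y * y = -1 := by
    rw [← neg_inj, ← mul_neg, ← hyinv, mul_inv_cancel, neg_neg]
  have hi2 : (qi : UnitQuat F) * qi = -1 := by ext <;> simp
  have hπneg : ∀ p, π (-p) = π p := fun p => (hπ _ _).2 (Or.inr rfl)
  have hπy2 : π y * π y = 1 := by rw [← map_mul, hy2, hπneg, map_one]
  have hπi2 : π qi * π qi = 1 := by rw [← map_mul, hi2, hπneg, map_one]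
  have hπyi : π y * π qi = π qi * π y := by rw [← map_mul, ← map_mul, hyi, hπneg]
  obtain ⟨x, hx, hxA⟩ := exists_conj_mem_iff_commute (commute_of_commute_of_cover h2 hsurj hπ)
    ((icosahedralGroup h φ).map π) (a := π qi) (y := π y)
    ((hmem _).2 qi_mem_icosahedralGroup) (by
      rw [← map_one π, Ne, hπ]
      rintro (h | h) <;> simpa using congrArg UnitQuat.x h) hπi2 hπy2 hπyi (by
      intro u hu huc hyu
      obtain ⟨u, rfl⟩ := hsurj u
      rw [hmem] at hu
      rw [← map_mul, ← map_mul, hmem] at hyu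
      rw [← map_mul, ← map_mul, hπ] at huc
      rcases huc with huc | huc
      · obtain ⟨hy, hz⟩ := (commute_qi_iff h2 u).1 huc
        rcases coord_of_commute_qi h2 hh hφ hu huc with hw | hx
        · right
          have hn := u.norm_eq
          rw [hw, hy, hz] at hn
          rw [hπ]
          rcases sq_eq_one_iff.1 (show u.x ^ 2 = 1 by linear_combination hn) with hx | hx
          · left; ext <;> simp [hw, hx, hy, hz]
          · right; ext <;> simp [hw, hx, hy, hz]
        · left
          rw [← map_one π, hπ]
          exact eq_one_or_neg_one hx hy hz
      · -- conjugation by `y` takes `j` and `k` off the three coordinate axes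
        exfalso
        obtain ⟨hw, hx⟩ := anticommute_qi h2 huc
        have hyu' : y * u * y * qi = -(qi * (y * u * y)) := by
          ext <;> simp [hy, hw, hx]
        have h1 := coord_of_anticommute_qi h2 hh hφ hyu hyu'
        have hn := u.norm_eq
        rcases coord_of_anticommute_qi h2 hh hφ hu huc with hy0 | hz0
        · have hz : u.z ≠ 0 := fun hz => by simp [hw, hx, hy0, hz] at hn
          have e1 : (y * u * y).y = -(2 * (β * γ * u.z)) := by simp [hy, hw, hx, hy0]; ring
          have e2 : (y * u * y).z = (β ^ 2 - γ ^ 2) * u.z := by simp [hy, hw, hx, hy0]; ring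
          rw [e1, e2] at h1
          simp [h2, hβ, hγ, hz, sub_ne_zero.2 hne] at h1
        · have hy0 : u.y ≠ 0 := fun hy0 => by simp [hw, hx, hy0, hz0] at hn
          have e1 : (y * u * y).y = (γ ^ 2 - β ^ 2) * u.y := by simp [hy, hw, hx, hz0]; ring
          have e2 : (y * u * y).z = -(2 * (β * γ * u.y)) := by simp [hy, hw, hx, hz0]; ring
          rw [e1, e2] at h1
          simp [h2, hβ, hγ, hy0, sub_ne_zero.2 hne.symm] at h1)
  have hxx : x * x = 1 := by
    rcases hx with rfl | rfl
    · exact hπy2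
    · rw [show π y * π qi * (π y * π qi) = π y * (π qi * π y) * π qi by group, ← hπyi,
        show π y * (π y * π qi) * π qi = (π y * π y) * (π qi * π qi) by group, hπy2, hπi2, one_mul]
  have hxnot : x ∉ (icosahedralGroup h φ).map π := by
    rcases hx with rfl | rfl
    · rwa [hmem]
    · rw [← map_mul, hmem, Subgroup.mul_mem_cancel_right _ qi_mem_icosahedralGroup]
      exact hyA
  rw [← index_eq_card_div h2 _ 60 (card_icosahedralGroup h2 hh hφ) (by norm_num),
    ← index_map_of_cover hsurj hπ hneg]
  refine index_pow_mem_subdegrees _ x x (fun h => hxnot (h ▸ Subgroup.one_mem _)) hxnot hxA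
    (fun u hu => ?_) ((Nat.lt_or_eq_of_le hm).imp id fun hm => ⟨hm.symm, hxx, rfl⟩) α
  obtain ⟨u, rfl⟩ := hsurj u
  rw [hmem]
  refine mem_icosahedralGroup_of_conj h2 h5 hh hφ fun a ha => ?_
  have := hu (π a) ((hmem a).2 ha)
  rwa [← map_inv, ← map_mul, ← map_mul, hmem] at this

/-- The stereographic parametrisation of the circle gives a point off the coordinate axes and
their bisectors; the at most nine bad parameters are the roots of a polynomial. -/
theorem exists_circle_point [Finite F] (h2 : (2 : F) ≠ 0) (hq : 10 ≤ Nat.card F) :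
    ∃ β γ : F, β ^ 2 + γ ^ 2 = 1 ∧ β ≠ 0 ∧ γ ≠ 0 ∧ β ^ 2 ≠ γ ^ 2 := by
  have := Fintype.ofFinite F
  obtain ⟨t, ht⟩ : ∃ t : F, t * (1 - t ^ 2) * (1 + t ^ 2) * ((1 - t ^ 2) ^ 2 - (2 * t) ^ 2) ≠ 0 := by
    let p : Polynomial F := Polynomial.X * ((1 - Polynomial.X ^ 2) * (1 + Polynomial.X ^ 2) *
      ((1 - Polynomial.X ^ 2) ^ 2 - (Polynomial.C 2 * Polynomial.X) ^ 2))
    have hdeg : p.natDegree ≤ 9 := by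
      simp only [p]
      compute_degree
    have hp : p ≠ 0 := by
      intro h
      have := congrArg (Polynomial.coeff · 1) h
      simp only [p, Polynomial.coeff_X_mul, Polynomial.coeff_zero_eq_eval_zero] at this
      simp at this
    obtain ⟨t, ht⟩ := Polynomial.exists_eval_ne_zero_of_natDegree_lt_card p hp (by
      rw [← Nat.cast_card]
      exact_mod_cast lt_of_le_of_lt hdeg (by omega))
    refine ⟨t, fun h => ht ?_⟩
    simp only [p, Polynomial.eval_mul, Polynomial.eval_X, Polynomial.eval_add, Polynomial.eval_one,
      Polynomial.eval_sub, Polynomial.eval_pow, Polynomial.eval_C]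
    linear_combination h
  simp only [mul_ne_zero_iff] at ht
  obtain ⟨⟨⟨h1, h3⟩, h4⟩, h5⟩ := ht
  refine ⟨(1 - t ^ 2) / (1 + t ^ 2), 2 * t / (1 + t ^ 2), ?_, div_ne_zero h3 h4,
    div_ne_zero (mul_ne_zero h2 h1) h4, ?_⟩
  · field_simp
    ring
  · rw [div_pow, div_pow, Ne, div_left_inj' (pow_ne_zero 2 h4), ← sub_eq_zero]
    exact h5

theorem icosahedral_index_pow_mem_subdegrees [Finite F] (h2 : (2 : F) ≠ 0) (h5 : (5 : F) ≠ 0)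
    (hq : 10 ≤ Nat.card F) (hφ : φ ^ 2 = φ + 1) {m : ℕ} [NeZero m] (hm : 2 ≤ m)
    (α : GPoints m PSL(2, F)) :
    (Nat.card PSL(2, F) / 60) ^ m ∈ subdegrees (GTW m PSL(2, F)) α := by
  obtain ⟨β, γ, h, hβ, hγ, hne⟩ := exists_circle_point h2 hq
  exact icosahedral_index_pow_mem_subdegrees_of_half_turn h2 h5 (mul_inv_cancel₀ h2) hφ h hβ hγ
    hne hm α

end UnitQuat

end IcosahedralSubdegree

/-! ### Patterns with three entries -/

section RareEntries

variable {m : ℕ} [NeZero m] {T : Type*} [Group T]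

/-- The tuple `(R, Q, Q, P, …, P)`. -/
def rarePattern {Ω : Type*} (P Q R : Ω) (i : Fin m) : Ω :=
  if i.val = 0 then R else if i.val ≤ 2 then Q else P

/-- For `m ≥ 6` the entries of `(ω, Q, Q, P, …, P)` are told apart by their multiplicities, so a
permutation of `Ω` carrying `(R, Q, Q, P, …, P)` to it, up to order, maps `P`, `Q`, `R` to
`P`, `Q`, `ω`. -/
theorem smul_eq_of_rarePattern {Ω : Type*} [MulAction T Ω] (hm : 6 ≤ m) {P Q R : Ω} (hPQ : P ≠ Q)
    (hPR : P ≠ R) (hQR : Q ≠ R) {x : T} {π : Equiv.Perm (Fin m)} {ω : Ω}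
    (h : Function.update (rarePattern P Q R) 0 ω = x • rarePattern P Q R ∘ π) :
    x • P = P ∧ x • Q = Q ∧ x • R = ω := by
  have hne0 : ∀ j : Fin m, j ≠ 0 → j.val ≠ 0 := fun j hj h => hj (Fin.ext h)
  have hb0 : ∀ j : Fin m, rarePattern P Q R j = R ↔ j = 0 := fun j => by
    rw [rarePattern]
    by_cases hj : j = 0
    · simp [hj]
    · have := hne0 j hj
      split_ifs <;> simp_all
  have hbQ : ∀ j : Fin m, rarePattern P Q R j = Q ↔ j.val = 1 ∨ j.val = 2 := fun j => by
    rw [rarePattern]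
    split_ifs with h1 h2
    · simp [hQR.symm, h1]
    · simp
      omega
    · simp [hPQ]
      omega
  have hbP : ∀ j : Fin m, rarePattern P Q R j = P ↔ 3 ≤ j.val := fun j => by
    rw [rarePattern]
    split_ifs with h1 h2
    · simp [hPR.symm, h1]
    · simp [hPQ.symm]
      omega
    · simp
      omega
  obtain ⟨c, hc⟩ : ∃ c : Fin m → Ω, c = Function.update (rarePattern P Q R) 0 ω := ⟨_, rfl⟩
  have hcx : ∀ j, c j = x • rarePattern P Q R (π j) := fun j => by
    rw [hc, h]
    rfl
  have hc0 : c 0 = ω := by simp [hc]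
  have hcj : ∀ j : Fin m, j ≠ 0 → c j = rarePattern P Q R j := fun j hj => by simp [hc, hj]
  have hlt : ∀ n < 6, n < m := fun n hn => hn.trans_le hm
  let e : ∀ n, n < 6 → Fin m := fun n hn => ⟨n, hlt n hn⟩
  have he0 : ∀ n (hn : n < 6), n ≠ 0 → e n hn ≠ 0 := fun n hn h0 h =>
    h0 (by simpa [e] using congrArg Fin.val h)
  -- the entry `R` occurs once, but `P` and `Q` occur at least twice besides the first position
  have hπ0 : π 0 = 0 := by
    by_contra hne
    have hj : π.symm 0 ≠ 0 := fun h => hne (π.symm_apply_eq.1 h).symm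
    have hR : c (π.symm 0) = x • R := by rw [hcx, Equiv.apply_symm_apply, (hb0 0).2 rfl]
    have huniq : ∀ j, c j = x • R → j = π.symm 0 := fun j hj => by
      rw [hcx, smul_left_cancel_iff, hb0] at hj
      rw [← hj, Equiv.symm_apply_apply]
    rw [hcj _ hj] at hR
    have hcase : rarePattern P Q R (π.symm 0) = P ∨ rarePattern P Q R (π.symm 0) = Q := by
      rw [hbP, hbQ]
      have := hne0 _ hj
      omega
    rcases hcase with h1 | h1
    · have h3 := huniq (e 3 (by norm_num)) (by
        rw [hcj _ (he0 3 (by norm_num) (by norm_num)), ← hR, h1, hbP])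
      have h4 := huniq (e 4 (by norm_num)) (by
        rw [hcj _ (he0 4 (by norm_num) (by norm_num)), ← hR, h1, hbP]; simp [e])
      have := congrArg Fin.val (h3.trans h4.symm)
      simp [e] at this
    · have h3 := huniq (e 1 (by norm_num)) (by
        rw [hcj _ (he0 1 (by norm_num) (by norm_num)), ← hR, h1, hbQ]; simp [e])
      have h4 := huniq (e 2 (by norm_num)) (by
        rw [hcj _ (he0 2 (by norm_num) (by norm_num)), ← hR, h1, hbQ]; simp [e])
      have := congrArg Fin.val (h3.trans h4.symm)
      simp [e] at this
  have hR : x • R = ω := by rw [← hc0, hcx, hπ0, (hb0 0).2 rfl]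
  have hsymm0 : ∀ j, j ≠ 0 → π.symm j ≠ 0 := fun j hj h => hj (by
    rw [← Equiv.apply_symm_apply π j, h, hπ0])
  have hmem : ∀ j : Fin m, j ≠ 0 → rarePattern P Q R j = P ∨ rarePattern P Q R j = Q := by
    intro j hj
    rw [hbP, hbQ]
    have := hne0 _ hj
    omega
  have hQ : x • Q = Q := by
    have h1 : c (π.symm (e 1 (by norm_num))) = x • Q := by
      rw [hcx, Equiv.apply_symm_apply, (hbQ _).2 (Or.inl rfl)]
    have hj := hsymm0 _ (he0 1 (by norm_num) (by norm_num))
    rw [hcj _ hj] at h1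
    rcases hmem _ hj with h2 | h2
    · exfalso
      rw [h2] at h1
      -- otherwise `π` maps three positions of `P` to the two positions of `Q`
      have hpos : ∀ n (hn : n < 6), 3 ≤ n → (π (e n hn)).val = 1 ∨ (π (e n hn)).val = 2 := by
        intro n hn h3
        rw [← hbQ, ← smul_left_cancel_iff x, ← hcx, hcj _ (he0 n hn (by omega)), ← h1]
        exact (hbP _).2 h3
      have hinj : ∀ a b (ha : a < 6) (hb : b < 6), (π (e a ha)).val = (π (e b hb)).val → a = b :=
        fun a b ha hb h => by simpa [e] using congrArg Fin.val (π.injective (Fin.ext h))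
      have h3 := hpos 3 (by norm_num) le_rfl
      have h4 := hpos 4 (by norm_num) (by norm_num)
      have h5 := hpos 5 (by norm_num) (by norm_num)
      have h34 := mt (hinj 3 4 (by norm_num) (by norm_num)) (by norm_num)
      have h35 := mt (hinj 3 5 (by norm_num) (by norm_num)) (by norm_num)
      have h45 := mt (hinj 4 5 (by norm_num) (by norm_num)) (by norm_num)
      omega
    · rw [← h1, h2]
  refine ⟨?_, hQ, hR⟩
  have h1 : c (π.symm (e 3 (by norm_num))) = x • P := by
    rw [hcx, Equiv.apply_symm_apply, (hbP _).2 le_rfl]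
  have hj := hsymm0 _ (he0 3 (by norm_num) (by norm_num))
  rw [hcj _ hj] at h1
  rcases hmem _ hj with h2 | h2
  · rw [← h1, h2]
  · rw [h2] at h1
    exact absurd (smul_left_cancel x (h1.symm.trans hQ.symm)) hPQ

/-- If `z` has exactly three fixed points `P`, `Q`, `R`, and commutes with all elements fixing these,
then `(R, Q, Q, P, …, P)` is a suitable tuple for `card_pow_mem_subdegrees_of_pattern`. -/
theorem card_pow_mem_subdegrees_of_three_points {Ω : Type*} [MulAction T Ω]
    [MulAction.IsPretransitive T Ω] (hm : 6 ≤ m) (ω₀ : Ω) {P Q R : Ω} (hPQ : P ≠ Q)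
    (hPR : P ≠ R) (hQR : Q ≠ R) (z : T) (hz : z ≠ 1)
    (hstab : ∀ x : T, x • P = P → x • Q = Q → x • R = R → x * z = z * x)
    (hfix : ∀ ω : Ω, z • ω = ω ↔ ω = P ∨ ω = Q ∨ ω = R)
    (hself : ∀ ω : Ω, (∀ a : T, a • ω₀ = ω₀ → a • ω = ω) → ω = ω₀) (α : GPoints m T) :
    Nat.card Ω ^ m ∈ subdegrees (GTW m T) α := by
  have hR0 : (rarePattern P Q R : Fin m → Ω) 0 = R := by simp [rarePattern]
  refine card_pow_mem_subdegrees_of_pattern ω₀ (rarePattern P Q R) z hz (fun x π h => ?_) 0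
    (fun x π ω h hx => ?_) hself α
  · obtain ⟨hP, hQ, hR⟩ := smul_eq_of_rarePattern (x := x) (π := π.symm) (ω := R) hm hPQ hPR hQR (by
      rw [Function.update_eq_self_iff.2 hR0.symm]
      funext i
      have := congrFun h (π.symm i)
      simp at this
      exact this.symm)
    exact hstab x hP hQ hR
  · obtain ⟨hP, hQ, hR⟩ := smul_eq_of_rarePattern hm hPQ hPR hQR h
    have h1 : z • ω = ω := by
      rw [← hR, ← mul_smul, ← hx, mul_smul, (hfix R).2 (Or.inr (Or.inr rfl))]
    rw [hR0]
    rcases (hfix ω).1 h1 with h | h | h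
    · exact absurd (smul_left_cancel x (hP.trans (h.symm.trans hR.symm))) hPR
    · exact absurd (smul_left_cancel x (hQ.trans (h.symm.trans hR.symm))) hQR
    · exact h

end RareEntries

/-! ### Simple groups with a subgroup of index six -/

section SixPoints

/-- Even permutations of six points that fix the same three points commute, as the alternating
group on the other three points has order three. -/
theorem commute_of_fix_three {Ω : Type*} [Fintype Ω] [DecidableEq Ω] (hΩ : Fintype.card Ω = 6)
    {P Q R : Ω} (hPQ : P ≠ Q) (hPR : P ≠ R) (hQR : Q ≠ R) {σ τ : Equiv.Perm Ω}
    (hσ : Equiv.Perm.sign σ = 1) (hτ : Equiv.Perm.sign τ = 1)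
    (hσ' : σ P = P ∧ σ Q = Q ∧ σ R = R) (hτ' : τ P = P ∧ τ Q = Q ∧ τ R = R) :
    σ * τ = τ * σ := by
  let p : Ω → Prop := fun ω => ω ∉ ({P, Q, R} : Finset Ω)
  have hp : ∀ ρ : Equiv.Perm Ω, ρ P = P ∧ ρ Q = Q ∧ ρ R = R → (∀ ω, p (ρ ω) ↔ p ω) ∧
      ∀ ω, ρ ω ≠ ω → p ω := by
    rintro ρ ⟨h1, h2, h3⟩
    have e1 : ∀ ω, ρ ω = P ↔ ω = P := fun ω => by rw [← h1, ρ.injective.eq_iff, h1]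
    have e2 : ∀ ω, ρ ω = Q ↔ ω = Q := fun ω => by rw [← h2, ρ.injective.eq_iff, h2]
    have e3 : ∀ ω, ρ ω = R ↔ ω = R := fun ω => by rw [← h3, ρ.injective.eq_iff, h3]
    refine ⟨fun ω => by simp [p, e1, e2, e3], fun ω hω hmem => hω ?_⟩
    simp only [Finset.mem_insert, Finset.mem_singleton] at hmem
    rcases hmem with rfl | rfl | rfl <;> assumption
  have hcard : Nat.card {ω // p ω} = 3 := by
    rw [Nat.card_eq_fintype_card, Fintype.card_subtype_compl, Fintype.card_coe, hΩ,
      Finset.card_eq_three.2 ⟨P, Q, R, hPQ, hPR, hQR, rfl⟩]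
  have : Nontrivial {ω // p ω} := by
    rw [← Finite.one_lt_card_iff_nontrivial, hcard]
    norm_num
  have hA : Nat.card (alternatingGroup {ω // p ω}) = 3 := by
    rw [nat_card_alternatingGroup, hcard]
    rfl
  have : Fact (Nat.Prime 3) := ⟨Nat.prime_three⟩
  have hcyc := isCyclic_of_prime_card hA
  obtain ⟨hσp, hσs⟩ := hp σ hσ'
  obtain ⟨hτp, hτs⟩ := hp τ hτ'
  have hcomm := (@IsCyclic.commGroup _ _ hcyc).mul_comm
    (⟨σ.subtypePerm hσp, by
      rw [Equiv.Perm.mem_alternatingGroup, Equiv.Perm.sign_subtypePerm _ _ hσs, hσ]⟩ :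
      alternatingGroup {ω // p ω})
    ⟨τ.subtypePerm hτp, by
      rw [Equiv.Perm.mem_alternatingGroup, Equiv.Perm.sign_subtypePerm _ _ hτs, hτ]⟩
  ext ω
  by_cases hω : p ω
  · have h1 := congrArg (fun ρ : alternatingGroup {ω // p ω} => ((ρ.1 ⟨ω, hω⟩ : {ω // p ω}) : Ω)) hcomm
    exact h1
  · have h1 : σ ω = ω := by
      by_contra h
      exact hω (hσs ω h)
    have h2 : τ ω = ω := by
      by_contra h
      exact hω (hτs ω h)
    rw [Equiv.Perm.mul_apply, Equiv.Perm.mul_apply, h1, h2, h1]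

/-- A simple nonabelian group acts by even permutations. -/
theorem sign_toPerm_eq_one {T Ω : Type*} [Group T] [IsSimpleGroup T] [Fintype Ω] [DecidableEq Ω]
    [MulAction T Ω] (hT : ∃ a b : T, a * b ≠ b * a) (x : T) :
    Equiv.Perm.sign (MulAction.toPermHom T Ω x) = 1 := by
  let f : T →* ℤˣ := Equiv.Perm.sign.comp (MulAction.toPermHom T Ω)
  rcases IsSimpleGroup.eq_bot_or_eq_top_of_normal f.ker inferInstance with h | h
  · obtain ⟨a, b, hab⟩ := hT
    refine absurd ((MonoidHom.ker_eq_bot_iff f).1 h ?_) hab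
    rw [map_mul, map_mul, mul_comm]
  · have hx : x ∈ f.ker := h ▸ Subgroup.mem_top x
    exact hx

/-- A self-normalising subgroup of index six of a simple nonabelian group, with an element `z` of
order three. On the six cosets `z` has three fixed points `P`, `Q`, `R`; the tuple
`(R, Q, Q, P, …, P)` is a suitable pattern. -/
theorem six_pow_mem_subdegrees {m : ℕ} [NeZero m] {T : Type*} [Group T] [IsSimpleGroup T]
    (hT : ∃ a b : T, a * b ≠ b * a) (A : Subgroup T) (hA : A.index = 6) {z : T} (hzA : z ∈ A)
    (hz : z ≠ 1) (hz3 : z ^ 3 = 1) (hself : ∀ x, (∀ a ∈ A, x⁻¹ * a * x ∈ A) → x ∈ A)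
    (hm : 6 ≤ m) (α : GPoints m T) : 6 ^ m ∈ subdegrees (GTW m T) α := by
  classical
  have hcard : Nat.card (T ⧸ A) = 6 := hA
  have : Finite (T ⧸ A) := Nat.finite_of_card_ne_zero (by rw [hcard]; norm_num)
  have := Fintype.ofFinite (T ⧸ A)
  have : Fact (Nat.Prime 3) := ⟨Nat.prime_three⟩
  let ρ := MulAction.toPermHom T (T ⧸ A)
  have hinj : Function.Injective ρ := by
    rw [← MonoidHom.ker_eq_bot_iff]
    refine (IsSimpleGroup.eq_bot_or_eq_top_of_normal ρ.ker inferInstance).resolve_right fun h => ?_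
    have hAtop : A = ⊤ := by
      rw [eq_top_iff]
      intro x _
      have hx : ρ x = 1 := by
        rw [← MonoidHom.mem_ker, h]
        exact Subgroup.mem_top x
      have h1 : x • ((1 : T) : T ⧸ A) = ((1 : T) : T ⧸ A) := congrArg (fun σ => σ ((1 : T) : T ⧸ A)) hx
      rw [MulAction.Quotient.smul_coe, smul_eq_mul, mul_one, eq_comm, QuotientGroup.eq] at h1
      simpa using h1
    rw [hAtop, Subgroup.index_top] at hA
    norm_num at hA
  have hfixset : (ρ z).supportᶜ.card = 3 := by
    have hmod := Equiv.Perm.card_compl_support_modEq (p := 3) (n := 1) (σ := ρ z) (by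
      rw [pow_one, ← map_pow, hz3, map_one])
    rw [← Nat.card_eq_fintype_card, hcard] at hmod
    have hpos : 0 < (ρ z).supportᶜ.card := by
      refine Finset.card_pos.2 ⟨((1 : T) : T ⧸ A), ?_⟩
      rw [Finset.mem_compl, Equiv.Perm.notMem_support]
      change z • ((1 : T) : T ⧸ A) = _
      rw [MulAction.Quotient.smul_coe, smul_eq_mul, mul_one, eq_comm, QuotientGroup.eq]
      simpa using hzA
    have hlt : (ρ z).supportᶜ.card ≠ 6 := by
      intro h
      rw [← hcard, Nat.card_eq_fintype_card, Finset.card_eq_iff_eq_univ,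
        Finset.compl_eq_univ_iff, Equiv.Perm.support_eq_empty_iff, ← map_one ρ] at h
      exact hz (hinj h)
    have hle : (ρ z).supportᶜ.card ≤ 6 := by
      rw [← hcard, Nat.card_eq_fintype_card]
      exact Finset.card_le_univ _
    have hmod : (ρ z).supportᶜ.card % 3 = 6 % 3 := hmod
    omega
  obtain ⟨P, Q, R, hPQ, hPR, hQR, hPQRset⟩ := Finset.card_eq_three.1 hfixset
  have hfix : ∀ ω : T ⧸ A, z • ω = ω ↔ ω = P ∨ ω = Q ∨ ω = R := by
    intro ω
    have h : ω ∈ (ρ z).supportᶜ ↔ z • ω = ω := by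
      rw [Finset.mem_compl, Equiv.Perm.notMem_support]
      rfl
    rw [← h, hPQRset]
    simp
  rw [← hcard]
  refine card_pow_mem_subdegrees_of_three_points hm ((1 : T) : T ⧸ A) hPQ hPR hQR z hz
    (fun x hP hQ hR => ?_) hfix (fun ω hω => ?_) α
  · refine hinj ?_
    rw [map_mul, map_mul]
    refine commute_of_fix_three (by rw [← Nat.card_eq_fintype_card, hcard]) hPQ hPR hQR
      (sign_toPerm_eq_one hT x) (sign_toPerm_eq_one hT z) ⟨hP, hQ, hR⟩
      ⟨(hfix P).2 (Or.inl rfl), (hfix Q).2 (Or.inr (Or.inl rfl)), (hfix R).2 (Or.inr (Or.inr rfl))⟩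
  · obtain ⟨x, rfl⟩ := QuotientGroup.mk_surjective ω
    rw [eq_comm, QuotientGroup.eq, inv_one, one_mul]
    refine hself x fun a ha => ?_
    have h := hω a (by
      rw [MulAction.Quotient.smul_coe, smul_eq_mul, mul_one, eq_comm, QuotientGroup.eq]
      simpa using ha)
    rw [MulAction.Quotient.smul_coe, smul_eq_mul, eq_comm, QuotientGroup.eq] at h
    rwa [← mul_assoc] at h

end SixPoints

/-! ### Golden ratios, and the field of nine elements -/

section NineElements

variable {F : Type*} [Field F] [Finite F]

theorem two_ne_zero_of_odd_card (h : Odd (Nat.card F)) : (2 : F) ≠ 0 := by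
  intro h2
  have := Fintype.ofFinite F
  have hchar : ringChar F = 2 := CharP.ringChar_of_prime_eq_zero Nat.prime_two (by exact_mod_cast h2)
  have h1 := FiniteField.even_card_of_char_two hchar
  rw [← Nat.card_eq_fintype_card] at h1
  rw [Nat.odd_iff] at h
  omega

/-- By quadratic reciprocity `5` is a square when `q` is congruent to `1` or `-1` modulo `5`. -/
theorem exists_golden_ratio (hodd : Odd (Nat.card F))
    (h : Nat.card F % 5 = 1 ∨ Nat.card F % 5 = 4) : ∃ φ : F, φ ^ 2 = φ + 1 := by
  have h2 := two_ne_zero_of_odd_card hodd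
  have := Fintype.ofFinite F
  have hchar : ringChar F ≠ 2 := fun h => h2 (by
    have : CharP F 2 := ringChar.of_eq h
    exact CharTwo.two_eq_zero)
  have : Fact (Nat.Prime 5) := ⟨by norm_num⟩
  have h5 : IsSquare ((5 : ℕ) : F) := by
    rw [FiniteField.isSquare_odd_prime_iff hchar (by norm_num : (5 : ℕ) ≠ 2),
      ← Nat.card_eq_fintype_card, Ne, quadraticChar_neg_one_iff_not_isSquare, not_not]
    have h4 : ((ZMod.χ₄ (Nat.card F : ZMod 4) : ℤ) : ZMod 5) = 1 ∨
        ((ZMod.χ₄ (Nat.card F : ZMod 4) : ℤ) : ZMod 5) = -1 := by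
      rw [ZMod.χ₄_nat_eq_if_mod_four, if_neg (by rw [Nat.odd_iff] at hodd; omega)]
      split_ifs <;> simp
    have h5 : (Nat.card F : ZMod 5) = 1 ∨ (Nat.card F : ZMod 5) = -1 := by
      rw [← ZMod.natCast_mod]
      rcases h with h | h <;> rw [h]
      · left; rfl
      · right; rfl
    have hsq : IsSquare (-1 : ZMod 5) := ⟨2, rfl⟩
    rcases h4 with h4 | h4 <;> rcases h5 with h5 | h5 <;> rw [h4, h5] <;> simp [hsq]
  obtain ⟨r, hr⟩ := h5
  have hr : r * r = 5 := by exact_mod_cast hr.symm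
  refine ⟨(1 + r) / 2, ?_⟩
  field_simp
  linear_combination hr

theorem card_SL2 : Nat.card SL(2, F) = Nat.card F * (Nat.card F - 1) * (Nat.card F + 1) := by
  obtain ⟨A, hA, hindex⟩ := exists_borel F
  have e : A ≃ Fˣ × F :=
    { toFun := fun g => (⟨g.1 0 0, g.1 1 1, by
          have h := SL2_det g.1
          rw [(hA g).1 g.2] at h
          linear_combination h, by
          have h := SL2_det g.1
          rw [(hA g).1 g.2] at h
          linear_combination h⟩, g.1 0 1)
      invFun := fun p => ⟨SL2.of (p.1 : F) p.2 0 ((p.1⁻¹ : Fˣ) : F) (by simp), by simp [hA]⟩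
      left_inv := fun g => Subtype.ext (by
        have := (hA g).1 g.2
        apply SL2_ext <;> simp [this])
      right_inv := fun p => by
        ext <;> simp }
  rw [← A.card_mul_index, hindex, Nat.card_congr e, Nat.card_prod, Nat.card_units]
  ring

/-- For `|F| = 9` the icosahedral subgroup of `PSL(2, F) ≅ Alt(6)` has index six. If `m = 3`, the
functions of one coordinate have an orbit of size `3 * 72 = 6 ^ 3`. -/
theorem six_pow_mem_subdegrees_of_card_eq_nine (hF : Nat.card F = 9) {m : ℕ} [NeZero m]
    (hm : m = 3 ∨ 6 ≤ m) (α : GPoints m PSL(2, F)) :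
    (Nat.card PSL(2, F) / 60) ^ m ∈ subdegrees (GTW m PSL(2, F)) α := by
  have hodd : Odd (Nat.card F) := by rw [hF]; decide
  have h2 := two_ne_zero_of_odd_card hodd
  have h9 : (9 : F) = 0 := by
    have := Fintype.ofFinite F
    have h := FiniteField.cast_card_eq_zero F
    rw [← Nat.card_eq_fintype_card, hF] at h
    exact_mod_cast h
  have h5 : (5 : F) ≠ 0 := fun h5 => one_ne_zero (by linear_combination 2 * h5 - h9 : (1 : F) = 0)
  obtain ⟨φ, hφ⟩ := exists_golden_ratio hodd (by rw [hF]; decide)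
  have hcard : Nat.card PSL(2, F) / 60 = 6 := by
    have h := card_SL2 (F := F)
    rw [UnitQuat.card_SL2_eq_two_mul h2, hF] at h
    omega
  -- the class of an element without eigenvalues that is not an involution has size `72`
  obtain ⟨τ, hτ, hns⟩ := exists_nonsplit_tr_of_odd h2 (by rw [hF]; norm_num)
  obtain ⟨g, rfl⟩ := exists_SL2_tr_eq τ
  have hclass := card_conjClass_toPSL2_of_nonsplit g (Or.inr hτ)
    (ne_four_of_nonsplit (fun _ => hτ) hns) hns
  rw [hF] at hclass
  obtain ⟨x, hx⟩ : ∃ x, x * toPSL2 g ≠ toPSL2 g * x := by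
    by_contra! hcon
    have hone : Nat.card {b // IsConj (toPSL2 g) b} = 1 := by
      rw [Nat.card_eq_one_iff_unique]
      refine ⟨⟨?_⟩, ⟨⟨_, IsConj.refl _⟩⟩⟩
      have key : ∀ b : {b // IsConj (toPSL2 g) b}, b.1 = toPSL2 g := by
        rintro ⟨b, hb⟩
        obtain ⟨c, rfl⟩ := isConj_iff.1 hb
        change c * toPSL2 g * c⁻¹ = _
        rw [hcon, mul_inv_cancel_right]
      exact fun b c => Subtype.ext ((key b).trans (key c).symm)
    rw [hone] at hclass
    norm_num at hclass
  rcases hm with rfl | hm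
  · have h := mul_card_conjClass_mem_subdegrees _ x hx α
    rw [hclass] at h
    rw [hcard]
    exact h
  · have := Matrix.ProjectiveSpecialLinearGroup.rank_two_simple (F := F) (by rw [hF]; norm_num)
    obtain ⟨π, hsurj, hπ⟩ := UnitQuat.exists_cover_PSL2 F h2
    have hh : 2 * (2 : F)⁻¹ = 1 := mul_inv_cancel₀ h2
    have hneg : -1 ∈ UnitQuat.icosahedralGroup (2 : F)⁻¹ φ := UnitQuat.neg_one_mem_normalizer _
    have hmem := mem_map_iff_of_cover hπ hneg
    rw [hcard]
    refine six_pow_mem_subdegrees ⟨_, _, hx⟩ ((UnitQuat.icosahedralGroup (2 : F)⁻¹ φ).map π) ?_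
      ((hmem (UnitQuat.omega h2)).2 (UnitQuat.omega_mem_icosahedralGroup h2)) ?_ ?_
      (fun u hu => ?_) hm α
    · rw [index_map_of_cover hsurj hπ hneg, UnitQuat.index_eq_card_div h2 _ 60
        (UnitQuat.card_icosahedralGroup h2 hh hφ) (by norm_num), hcard]
    · rw [← map_one π, Ne, hπ]
      rintro (h | h)
      · have := congrArg UnitQuat.x h
        simp [h2] at this
      · have := congrArg UnitQuat.x h
        simp [h2] at this
    · rw [← map_pow, ← map_one π, hπ]
      right
      ext <;> simp [pow_succ]
      · linear_combination -(4 * (2 : F)⁻¹ ^ 2 + 2 * (2 : F)⁻¹ + 1) * hh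
      · ring
      · ring
      · ring
    · obtain ⟨u, rfl⟩ := hsurj u
      rw [hmem]
      refine UnitQuat.mem_icosahedralGroup_of_conj h2 h5 hh hφ fun a ha => ?_
      have := hu (π a) ((hmem a).2 ha)
      rwa [← map_inv, ← map_mul, ← map_mul, hmem] at this

end NineElements

/-! ### Subdegrees for `T = PSL(2, q)` -/

section PSLSubdegrees

variable {F : Type*} [Field F] [Finite F]

theorem two_eq_zero_of_even_card (h : Even (Nat.card F)) : (2 : F) = 0 := by
  have := Fintype.ofFinite F
  have hchar : ringChar F = 2 := by
    rw [FiniteField.even_card_iff_char_two, ← Nat.card_eq_fintype_card]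
    exact Nat.even_iff.1 h
  have : CharP F 2 := ringChar.of_eq hchar
  exact CharTwo.two_eq_zero

theorem five_ne_zero_of_card (h : Nat.card F % 5 = 1 ∨ Nat.card F % 5 = 4) : (5 : F) ≠ 0 := by
  intro h5
  have := Fintype.ofFinite F
  have hq := FiniteField.cast_card_eq_zero F
  rw [← Nat.card_eq_fintype_card, ← Nat.div_add_mod (Nat.card F) 5] at hq
  push_cast at hq
  rw [h5, zero_mul, zero_add] at hq
  rcases h with h | h <;> rw [h] at hq
  · simp at hq
  · exact one_ne_zero (by push_cast at hq; linear_combination h5 - hq : (1 : F) = 0)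

theorem octahedral_pow_mem_subdegrees (h : Nat.card F % 8 = 1 ∨ Nat.card F % 8 = 7) {m : ℕ}
    [NeZero m] (hm : 2 ≤ m) (α : GPoints m PSL(2, F)) :
    (Nat.card PSL(2, F) / 24) ^ m ∈ subdegrees (GTW m PSL(2, F)) α := by
  have := Fintype.ofFinite F
  have h2 : (2 : F) ≠ 0 := two_ne_zero_of_odd_card (Nat.odd_iff.2 (by omega))
  obtain ⟨r, hr⟩ : IsSquare (2 : F) := by
    rw [FiniteField.isSquare_two_iff, ← Nat.card_eq_fintype_card]
    omega
  refine UnitQuat.octahedral_index_pow_mem_subdegrees h2 (s := r / 2) ?_ hm α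
  field_simp
  linear_combination -hr

theorem icosahedral_pow_mem_subdegrees (hq : 4 ≤ Nat.card F)
    (h : Nat.card F % 10 = 1 ∨ Nat.card F % 10 = 9) {m : ℕ} [NeZero m] (hm : 2 ≤ m)
    (h9 : ¬ (Nat.card F = 9 ∧ (m = 2 ∨ m = 4 ∨ m = 5))) (α : GPoints m PSL(2, F)) :
    (Nat.card PSL(2, F) / 60) ^ m ∈ subdegrees (GTW m PSL(2, F)) α := by
  have hodd : Odd (Nat.card F) := Nat.odd_iff.2 (by omega)
  have hmod : Nat.card F % 5 = 1 ∨ Nat.card F % 5 = 4 := by omega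
  by_cases hF : Nat.card F = 9
  · exact six_pow_mem_subdegrees_of_card_eq_nine hF (by omega) α
  · obtain ⟨φ, hφ⟩ := exists_golden_ratio hodd hmod
    exact UnitQuat.icosahedral_index_pow_mem_subdegrees (two_ne_zero_of_odd_card hodd)
      (five_ne_zero_of_card hmod) (by omega) hφ hm α

end PSLSubdegrees

theorem mainTheorem4 {F : Type*} [Field F] [Finite F] (m q : ℕ) [NeZero m] (hm : 2 ≤ m)
    (hF : Nat.card F = q) (hq : 4 ≤ q) (α : GPoints m PSL(2, F)) :
    (3 ≤ m → (q + 1) ^ m ∈ subdegrees (GTW m PSL(2, F)) α) ∧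
    (m = 2 → q ≡ 1 [MOD 4] → (q + 1) ^ 2 ∈ subdegrees (GTW m PSL(2, F)) α) ∧
    (q ≡ 1 [MOD 4] → (q * (q + 1) / 2) ^ m ∈ subdegrees (GTW m PSL(2, F)) α) ∧
    (q ≡ 3 [MOD 4] → (q * (q - 1) / 2) ^ m ∈ subdegrees (GTW m PSL(2, F)) α) ∧
    (Even q → (q * (q - 1) / 2) ^ m ∈ subdegrees (GTW m PSL(2, F)) α) ∧
    (Odd q → (q * (q - 1)) ^ m ∈ subdegrees (GTW m PSL(2, F)) α) ∧
    (Odd q → 7 ≤ q → (q * (q + 1)) ^ m ∈ subdegrees (GTW m PSL(2, F)) α) ∧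
    (Even q → (q * (q - 1)) ^ m ∈ subdegrees (GTW m PSL(2, F)) α ∧
      (q * (q + 1)) ^ m ∈ subdegrees (GTW m PSL(2, F)) α) ∧
    ((q ^ 2 - 1) / Nat.gcd 2 (q - 1)) ^ m ∈ subdegrees (GTW m PSL(2, F)) α ∧
    (q.Prime → (q ≡ 1 [MOD 8] ∨ q ≡ 7 [MOD 8]) →
      (Nat.card PSL(2, F) / 24) ^ m ∈ subdegrees (GTW m PSL(2, F)) α) ∧
    ((q ≡ 1 [MOD 10] ∨ q ≡ 9 [MOD 10]) →
      (q.Prime ∨ ∃ p : ℕ, p.Prime ∧ (p ≡ 3 [MOD 10] ∨ p ≡ 7 [MOD 10]) ∧ q = p ^ 2) →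
      ¬ (q = 9 ∧ (m = 2 ∨ m = 4 ∨ m = 5)) →
      (Nat.card PSL(2, F) / 60) ^ m ∈ subdegrees (GTW m PSL(2, F)) α) := by
  subst hF
  refine ⟨fun h => card_add_one_pow_mem_subdegrees hq (Or.inl h) α, ?_,
    fun h => involution_class_mem_subdegrees_of_one_mod_four h ?_ α,
    fun h => involution_class_mem_subdegrees_of_three_mod_four h ?_ α,
    fun h => torusNormalizer_index_pow_mem_subdegrees (two_eq_zero_of_even_card h) hq α hm,
    fun _ => nonsplit_class_mem_subdegrees hq α,
    fun _ h => split_class_mem_subdegrees hq (fun _ => by omega) α,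
    fun h => ⟨nonsplit_class_mem_subdegrees hq α, split_class_mem_subdegrees hq
      (fun h2 => absurd (two_eq_zero_of_even_card h) h2) α⟩,
    unipotent_class_mem_subdegrees α, fun _ h => octahedral_pow_mem_subdegrees h hm α,
    fun h _ h9 => icosahedral_pow_mem_subdegrees hq h hm h9 α⟩
  · rintro rfl h
    have := Fintype.ofFinite F
    have h : Nat.card F % 4 = 1 := h
    refine card_add_one_pow_mem_subdegrees hq (Or.inr ⟨rfl,
      two_ne_zero_of_odd_card (Nat.odd_iff.2 (by omega)), ?_⟩) α
    rw [FiniteField.isSquare_neg_one_iff, ← Nat.card_eq_fintype_card]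
    omega
  · have h : Nat.card F % 4 = 1 := h
    exact two_ne_zero_of_odd_card (Nat.odd_iff.2 (by omega))
  · have h : Nat.card F % 4 = 3 := h
    exact two_ne_zero_of_odd_card (Nat.odd_iff.2 (by omega))
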